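/- Let $K(x)=\dfrac{x_1^2+x_2^2-2x_3^2}{|x|^5}$ on $\mathbb R^3\setminus\{0\}$, let $K*f$ denote the principal value convolution (the $L^2$-limit, as $\varepsilon\downarrow0$, of $\int_{|x-y|>\varepsilon}K(x-y)f(y)\,dy$), and let $\widehat K(\xi)=\frac{4\pi}{3}\,\frac{2\xi_3^2-\xi_1^2-\xi_2^2}{|\xi|^2}$, where $\widehat f(\xi)=\int_{\mathbb R^3}f(x)e^{-ix\cdot\xi}\,dx$. Let $\lambda_1,\lambda_2,\lambda_3\in\mathbb R$ with $\lambda_3<0$. A pair $(u,\beta)\in H^1(\mathbb R^3;\mathbb C)\times\mathbb R$ is called a solution if $$-\tfrac12\Delta u+\lambda_1|u|^2u+\lambda_2(K*|u|^2)u+\lambda_3|u|^3u+\beta u=0\quad\text{in }H^{-1}(\mathbb R^3;\mathbb C).$$ For $u\in H^1(\mathbb R^3;\mathbb C)$ put $$A(u)=\|\nabla u\|_2^2,\qquad B(u)=\frac1{(2\pi)^3}\int_{\mathbb R^3}\big(\lambda_1+\lambda_2\widehat K(\xi)\big)\big|\widehat{|u|^2}(\xi)\big|^2\,d\xi,\qquad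 C(u)=\lambda_3\|u\|_5^5,$$ $$Q(u)=A(u)+\tfrac32B(u)+\tfrac95C(u),$$ and for $c>0$ let $S(c)=\{u\in H^1(\mathbb R^3;\mathbb C):\|u\|_2^2=c\}$. Then: (a) $\xi\cdot\nabla\widehat K(\xi)=0$ for all $\xi\neq0$, and every solution $(u,\beta)$ satisfies the Pohozaev identity with no rest term $$\tfrac14A(u)+\tfrac34B(u)+\tfrac35C(u)+\tfrac32\beta\|u\|_2^2=0,$$ as well as $Q(u)=0$. (b) There exists $c_0=c_0(\lambda_1,\lambda_2,\lambda_3)\in(0,\infty]$ such that for all $c\in(0,c_0)$ and all solutions $(u,\beta)$ with $u\in S(c)$ one has $\beta>0$; and one can take $c_0=\infty$ if either $\lambda_2>0$ and $\lambda_1+\frac{8\pi}{3}\lambda_2\le0$, or $\lambda_2\le0$ and $\lambda_1-\frac{4\pi}{3}\lambda_2\le0$. -/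

import Mathlib

open MeasureTheory Filter Topology
open scoped ENNReal ContDiff

noncomputable section

namespace DipolarGPE

/-- Euclidean three-space. -/
abbrev R3 : Type := EuclideanSpace ℝ (Fin 3)

/-! ### The Sobolev space `H¹(ℝ³; ℂ)` -/

/-- `g` is the weak `i`-th partial derivative of `u`:
`∫ (∂ᵢ φ) u = - ∫ φ g` for all real test functions `φ ∈ C_c^∞(ℝ³)`. -/
def HasWeakPartial (i : Fin 3) (u g : R3 → ℂ) : Prop :=
  ∀ φ : R3 → ℝ, ContDiff ℝ ∞ φ → HasCompactSupport φ →
    ∫ x, (fderiv ℝ φ x (EuclideanSpace.single i 1)) • u x = - ∫ x, φ x • g x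

/-- `u ∈ H¹(ℝ³; ℂ)`: `u` and its three weak partial derivatives are in `L²`. -/
def MemH1 (u : R3 → ℂ) : Prop :=
  MemLp u 2 ∧ ∀ i : Fin 3, ∃ g : R3 → ℂ, MemLp g 2 ∧ HasWeakPartial i u g

open Classical in
/-- The weak partial derivative `∂ᵢ u` in `L²` (unique up to null sets), and `0` if there is
none; it exists for every `u ∈ H¹`. -/
def weakPartial (i : Fin 3) (u : R3 → ℂ) : R3 → ℂ :=
  if h : ∃ g : R3 → ℂ, MemLp g 2 ∧ HasWeakPartial i u g then h.choose else 0

/-! ### The dipolar kernel -/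

/-- `K(x) = (x₁² + x₂² - 2 x₃²) / |x|⁵`. -/
def kernelK (x : R3) : ℝ :=
  ((x 0) ^ 2 + (x 1) ^ 2 - 2 * (x 2) ^ 2) / ‖x‖ ^ 5

/-- The symbol `K̂(ξ) = (4π/3) (2 ξ₃² - ξ₁² - ξ₂²) / |ξ|²`. -/
def symbolK (ξ : R3) : ℝ :=
  (4 * Real.pi / 3) * ((2 * (ξ 2) ^ 2 - (ξ 0) ^ 2 - (ξ 1) ^ 2) / ‖ξ‖ ^ 2)

/-- The truncated convolution `∫_{|x - y| > ε} K(x - y) f(y) dy`. -/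
def truncConvK (ε : ℝ) (f : R3 → ℝ) (x : R3) : ℝ :=
  ∫ y in {y : R3 | ε < ‖x - y‖}, kernelK (x - y) * f y

/-- `W = K * f`. Since `K` is homogeneous of degree `-3` and not locally integrable, the
convolution is a singular integral: `W` is the principal value, the limit in `L²(ℝ³)` of the
truncated convolutions. (It exists for every `f ∈ L¹ ∩ L²`, in particular for `f = |u|²` with
`u ∈ H¹`, and is unique up to null sets.) -/
def IsConvK (f W : R3 → ℝ) : Prop :=
  MemLp W 2 ∧
    Tendsto (fun ε : ℝ => eLpNorm (fun x => truncConvK ε f x - W x) 2 volume) (𝓝[>] 0) (𝓝 0)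

/-! ### The stationary equation -/

/-- `(u, β) ∈ H¹(ℝ³; ℂ) × ℝ` solves
`-½ Δu + l₁ |u|² u + l₂ (K * |u|²) u + l₃ |u|³ u + β u = 0` in `H⁻¹(ℝ³; ℂ)`,
that is, tested against every element of `H¹(ℝ³; ℂ)`. -/
def IsSolution (l₁ l₂ l₃ : ℝ) (u : R3 → ℂ) (β : ℝ) : Prop :=
  MemH1 u ∧ ∃ W : R3 → ℝ, IsConvK (fun x => ‖u x‖ ^ 2) W ∧
    ∀ φ : R3 → ℂ, MemH1 φ →
      (1 / 2 : ℂ) * (∑ i : Fin 3, ∫ x, weakPartial i u x * star (weakPartial i φ x))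
        + (l₁ : ℂ) * (∫ x, ((‖u x‖ ^ 2 : ℝ) : ℂ) * u x * star (φ x))
        + (l₂ : ℂ) * (∫ x, (W x : ℂ) * u x * star (φ x))
        + (l₃ : ℂ) * (∫ x, ((‖u x‖ ^ 3 : ℝ) : ℂ) * u x * star (φ x))
        + (β : ℂ) * (∫ x, u x * star (φ x)) = 0

/-! ### The functionals -/

/-- The Fourier transform `∫ f(x) e^{-i x·ξ} dx`. -/
def fourierT (f : R3 → ℝ) (ξ : R3) : ℂ :=
  ∫ x, (f x : ℂ) * Complex.exp (-(Complex.I * ((inner ℝ x ξ : ℝ) : ℂ)))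

/-- The squared `L²` norm. -/
def mass (u : R3 → ℂ) : ℝ := ∫ x, ‖u x‖ ^ 2

/-- `A(u) = ‖∇u‖₂²`. -/
def funA (u : R3 → ℂ) : ℝ := ∑ i : Fin 3, ∫ x, ‖weakPartial i u x‖ ^ 2

/-- `B(u) = (2π)⁻³ ∫ (l₁ + l₂ K̂(ξ)) |(|u|²)^(ξ)|² dξ`. -/
def funB (l₁ l₂ : ℝ) (u : R3 → ℂ) : ℝ :=
  1 / (2 * Real.pi) ^ 3 *
    ∫ ξ, (l₁ + l₂ * symbolK ξ) * ‖fourierT (fun x => ‖u x‖ ^ 2) ξ‖ ^ 2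

/-- `C(u) = l₃ ‖u‖₅⁵`. -/
def funC (l₃ : ℝ) (u : R3 → ℂ) : ℝ := l₃ * ∫ x, ‖u x‖ ^ 5

/-- The virial functional `Q(u) = A(u) + (3/2) B(u) + (9/5) C(u)`. -/
def funQ (l₁ l₂ l₃ : ℝ) (u : R3 → ℂ) : ℝ :=
  funA u + 3 / 2 * funB l₁ l₂ u + 9 / 5 * funC l₃ u

/-- `S(c) = {u ∈ H¹(ℝ³; ℂ) : ‖u‖₂² = c}`. -/
def sphereS (c : ℝ) : Set (R3 → ℂ) := {u | MemH1 u ∧ mass u = c}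

end DipolarGPE

end

noncomputable section

namespace DipolarGPE

/-! ### The symbol -/

/-! The symbol `symbolK` is constant along rays, so its radial derivative vanishes. For the same
reason the dipolar term scales like a local cubic term under dilations, and the Pohozaev identity
has no rest term. Formally that identity is the equation tested with x·∇u. The work lies in making
this legitimate for a singular nonlocal term and a solution known only to be in H¹.

First, the principal value is identified with a Fourier multiplier (`isConvK_pairing`). The
truncated kernel is compared with a heat-regularised one, obtained by damping the symbol with a
Gaussian. Writing the latter as a superposition of Gaussians shows that the difference is an
integrable kernel of mean zero, rescaled by ε, so it disappears weakly as ε tends to 0. From then on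
the nonlocal term is `bform`, a form with a bounded symbol.

Second, solutions are in H² (`IsSolution.memLp_weight`). The equation and its translate are
subtracted and tested with the difference. The nonlinear terms are absorbed by Sobolev
interpolation, and the translated differences bound the weighted Fourier transform.

Third, x is replaced by the compactly supported field y = χ(x/R) x, and u by Schwartz functions
close in H¹ and bounded in H² (`IsSolution.exists_approx`). For Schwartz functions every term is an
integration by parts. The nonlocal term splits into a divergence part and ½ Re b(ρ, Tρ), where ρ =
|u|² and T = y·∇ + ½ div y is skew-adjoint, so that only the commutator of T with the multiplier
survives. Its kernel contains a(ξ) - a(η), which gains a factor |ξ - η| / (|ξ| + |η|). By Young's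
inequality it is bounded on L², with a constant independent of R by scaling
(`abs_re_bform_vfield_sub_le`, `integral_commWeight_yfield`). On a fixed Schwartz function it tends
to the commutator with the full dilation, which is zero by Euler's identity for degree zero
(`re_bform_dil`). Hence it vanishes in the limit R → ∞, leaving the Pohozaev identity.

Testing with u itself gives a second linear relation. Eliminating β yields Q(u) = 0, and eliminating
C(u) yields β‖u‖₂² = A/18 - B/6, so β > 0 as soon as B < A/3. If the symbol l₁ + l₂ K̂ is
nonpositive, then B ≤ 0 < A/3 for every mass. Otherwise suppose B ≥ A/3. Since l₃ < 0, Q = 0 bounds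
‖u‖₅⁵ by B. Interpolating L⁴ between L² and L⁵ then bounds B, hence A, by the mass, while
Gagliardo–Nirenberg bounds the product of A and the mass from below. This is impossible for small
mass (`exists_funB_lt`). -/

theorem norm_sq_eq_sum (ξ : R3) : ‖ξ‖ ^ 2 = ξ 0 ^ 2 + ξ 1 ^ 2 + ξ 2 ^ 2 := by
  rw [EuclideanSpace.norm_sq_eq, Fin.sum_univ_three]
  simp

theorem symbolK_eq (ξ : R3) (hξ : ξ ≠ 0) :
    symbolK ξ = 4 * Real.pi * (ξ 2 / ‖ξ‖) ^ 2 - 4 * Real.pi / 3 := by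
  have h : ‖ξ‖ ≠ 0 := norm_ne_zero_iff.mpr hξ
  have h2 := norm_sq_eq_sum ξ
  unfold symbolK
  field_simp
  rw [h2]
  ring

theorem symbolK_zero : symbolK 0 = 0 := by simp [symbolK]

theorem sq_coord_div_norm_le (ξ : R3) : (ξ 2 / ‖ξ‖) ^ 2 ≤ 1 := by
  rw [div_pow]
  apply div_le_one_of_le₀ _ (sq_nonneg _)
  rw [norm_sq_eq_sum]
  nlinarith [sq_nonneg (ξ 0), sq_nonneg (ξ 1)]

theorem symbolK_le (ξ : R3) : symbolK ξ ≤ 8 * Real.pi / 3 := by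
  by_cases h : ξ = 0
  · rw [h, symbolK_zero]; positivity
  · rw [symbolK_eq ξ h]
    nlinarith [sq_coord_div_norm_le ξ, Real.pi_pos]

theorem le_symbolK (ξ : R3) : -(4 * Real.pi / 3) ≤ symbolK ξ := by
  by_cases h : ξ = 0
  · rw [h, symbolK_zero]; linarith [Real.pi_pos]
  · rw [symbolK_eq ξ h]
    nlinarith [sq_nonneg (ξ 2 / ‖ξ‖), Real.pi_pos]

theorem symbolK_smul (r : ℝ) (hr : r ≠ 0) (ξ : R3) : symbolK (r • ξ) = symbolK ξ := by
  unfold symbolK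
  simp only [PiLp.smul_apply, smul_eq_mul, norm_smul, Real.norm_eq_abs, mul_pow, sq_abs]
  congr 1
  rw [show 2 * (r ^ 2 * ξ 2 ^ 2) - r ^ 2 * ξ 0 ^ 2 - r ^ 2 * ξ 1 ^ 2
      = r ^ 2 * (2 * ξ 2 ^ 2 - ξ 0 ^ 2 - ξ 1 ^ 2) by ring,
    mul_div_mul_left _ _ (pow_ne_zero 2 hr)]

theorem measurable_symbolK : Measurable symbolK := by
  unfold symbolK; fun_prop

theorem differentiableAt_symbolK (ξ : R3) (hξ : ξ ≠ 0) : DifferentiableAt ℝ symbolK ξ := by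
  have h : ‖ξ‖ ^ 2 ≠ 0 := by simpa using hξ
  have hn : DifferentiableAt ℝ (fun ξ : R3 => ‖ξ‖ ^ 2) ξ :=
    (contDiff_norm_sq ℝ (n := 1)).differentiable (by simp) ξ
  have hp : DifferentiableAt ℝ (fun ξ : R3 => 2 * ξ 2 ^ 2 - ξ 0 ^ 2 - ξ 1 ^ 2) ξ := by fun_prop
  have hq := (hp.fun_mul (hn.fun_inv h)).const_mul (4 * Real.pi / 3)
  simp only [← div_eq_mul_inv] at hq
  exact hq

/-- The function r ↦ `symbolK (r • ξ)` is constant near r = 1, and its derivative there is the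
radial derivative. -/
theorem inner_gradient_symbolK (ξ : R3) (hξ : ξ ≠ 0) :
    inner ℝ ξ (gradient symbolK ξ) = 0 := by
  have hd := differentiableAt_symbolK ξ hξ
  rw [real_inner_comm]
  have h1 : inner ℝ (gradient symbolK ξ) ξ = fderiv ℝ symbolK ξ ξ := by
    simp [gradient]
  rw [h1]
  have h2 : HasDerivAt (fun r : ℝ => symbolK (r • ξ)) (fderiv ℝ symbolK ξ ξ) 1 := by
    have h3 : HasDerivAt (fun r : ℝ => r • ξ) ξ 1 := by
      simpa using (hasDerivAt_id (1 : ℝ)).smul_const ξ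
    have h4 : HasFDerivAt symbolK (fderiv ℝ symbolK ξ) ((1 : ℝ) • ξ) := by
      simpa using hd.hasFDerivAt
    exact h4.comp_hasDerivAt 1 h3
  have h5 : HasDerivAt (fun r : ℝ => symbolK (r • ξ)) 0 1 := by
    refine (hasDerivAt_const (1 : ℝ) (symbolK ξ)).congr_of_eventuallyEq ?_
    filter_upwards [eventually_ne_nhds (one_ne_zero (α := ℝ))] with r hr
    exact symbolK_smul r hr ξ
  exact h2.unique h5

/-! ### Lipschitz behaviour of a degree zero symbol -/

/-- The direction ξ/|ξ| is Lipschitz with constant of order 1/|ξ|: multiplying by |ξ| leaves the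
change of the coordinate and the change of the norm, each at most |ξ - η|. -/
theorem norm_mul_abs_coord_div_sub_le (ξ η : R3) (hξ : ξ ≠ 0) (hη : η ≠ 0) :
    ‖ξ‖ * |ξ 2 / ‖ξ‖ - η 2 / ‖η‖| ≤ 2 * ‖ξ - η‖ := by
  have h1 : 0 < ‖ξ‖ := norm_pos_iff.mpr hξ
  have h2 : 0 < ‖η‖ := norm_pos_iff.mpr hη
  have e : ‖ξ‖ * (ξ 2 / ‖ξ‖ - η 2 / ‖η‖) = (ξ 2 - η 2) - (‖ξ‖ - ‖η‖) * (η 2 / ‖η‖) := by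
    field_simp; ring
  have h3 : |ξ 2 - η 2| ≤ ‖ξ - η‖ := by
    simpa using PiLp.norm_apply_le (ξ - η) 2
  have h4 : |η 2 / ‖η‖| ≤ 1 := by
    rw [← sq_le_one_iff_abs_le_one]; exact sq_coord_div_norm_le η
  have h5 : |‖ξ‖ - ‖η‖| ≤ ‖ξ - η‖ := abs_norm_sub_norm_le ξ η
  calc ‖ξ‖ * |ξ 2 / ‖ξ‖ - η 2 / ‖η‖| = |‖ξ‖ * (ξ 2 / ‖ξ‖ - η 2 / ‖η‖)| := by
        rw [abs_mul, abs_of_pos h1]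
    _ ≤ |ξ 2 - η 2| + |‖ξ‖ - ‖η‖| * |η 2 / ‖η‖| := by
        rw [e, ← abs_mul]; exact abs_sub _ _
    _ ≤ ‖ξ - η‖ + ‖ξ - η‖ * 1 := by gcongr
    _ = _ := by ring

theorem abs_symbolK_le (ξ : R3) : |symbolK ξ| ≤ 8 * Real.pi / 3 :=
  abs_le.mpr ⟨by linarith [le_symbolK ξ, Real.pi_pos], symbolK_le ξ⟩

/-- Away from the origin the symbol varies at unit scale relative to `|ξ|`. -/
theorem abs_symbolK_sub_mul_le (ξ η : R3) :
    |symbolK ξ - symbolK η| * (‖ξ‖ + ‖η‖) ≤ 32 * Real.pi * ‖ξ - η‖ := by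
  have hpi := Real.pi_pos
  -- At the origin the quotient defining the symbol takes the default value 0, and the uniform bound
  -- 8π/3 replaces the homogeneous estimate.
  by_cases hξ : ξ = 0
  · subst hξ
    simp only [symbolK_zero, zero_sub, abs_neg, norm_zero, zero_add, norm_neg]
    have := abs_symbolK_le η
    have := norm_nonneg η
    gcongr; linarith
  by_cases hη : η = 0
  · subst hη
    simp only [symbolK_zero, sub_zero, norm_zero, add_zero]
    have := abs_symbolK_le ξ
    have := norm_nonneg ξ
    gcongr; linarith
  rw [symbolK_eq ξ hξ, symbolK_eq η hη]
  set s := ξ 2 / ‖ξ‖ with hs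
  set t := η 2 / ‖η‖ with ht
  have h1 := norm_mul_abs_coord_div_sub_le ξ η hξ hη
  have h2 := norm_mul_abs_coord_div_sub_le η ξ hη hξ
  rw [← hs, ← ht] at h1 h2
  rw [abs_sub_comm, norm_sub_rev] at h2
  have hs1 : |s| ≤ 1 := by rw [← sq_le_one_iff_abs_le_one]; exact sq_coord_div_norm_le ξ
  have ht1 : |t| ≤ 1 := by rw [← sq_le_one_iff_abs_le_one]; exact sq_coord_div_norm_le η
  -- The symbol depends only on the square of one coordinate of the direction, so its variation is
  -- that of s times a factor of size at most 8π. Both |ξ||s - t| and |η||s - t| are at most 2|ξ -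
  -- η|.
  have e : 4 * Real.pi * s ^ 2 - 4 * Real.pi / 3 - (4 * Real.pi * t ^ 2 - 4 * Real.pi / 3)
      = (4 * Real.pi * (s + t)) * (s - t) := by ring
  have h3 : |4 * Real.pi * (s + t)| ≤ 8 * Real.pi := by
    rw [abs_mul, abs_of_pos (by positivity : 0 < 4 * Real.pi)]
    nlinarith [abs_add_le s t]
  rw [e, abs_mul, mul_assoc]
  calc |4 * Real.pi * (s + t)| * (|s - t| * (‖ξ‖ + ‖η‖))
      ≤ (8 * Real.pi) * (|s - t| * (‖ξ‖ + ‖η‖)) := by gcongr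
    _ ≤ (8 * Real.pi) * (4 * ‖ξ - η‖) := by
        have : |s - t| * (‖ξ‖ + ‖η‖) ≤ 4 * ‖ξ - η‖ := by linarith
        gcongr
    _ = _ := by ring

end DipolarGPE

end

noncomputable section

namespace DipolarGPE

open FourierTransform SchwartzMap

/-! ### The `L²` norm -/

section L2

variable {E : Type*} [NormedAddCommGroup E]

/-- The `L²` norm of a function on `ℝ³`. -/
def l2norm (f : R3 → E) : ℝ := √(∫ x, ‖f x‖ ^ 2)

theorem l2norm_nonneg (f : R3 → E) : 0 ≤ l2norm f := Real.sqrt_nonneg _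

theorem sq_l2norm (f : R3 → E) : l2norm f ^ 2 = ∫ x, ‖f x‖ ^ 2 :=
  Real.sq_sqrt (integral_nonneg fun _ => by positivity)

theorem l2norm_eq_toReal {f : R3 → E} (hf : AEStronglyMeasurable f volume) :
    l2norm f = (eLpNorm f 2 volume).toReal := by
  rw [toReal_eLpNorm hf, lpNorm_eq_integral_norm_rpow_toReal (by simp) (by simp) hf, l2norm,
    Real.sqrt_eq_rpow]
  simp

theorem l2norm_eq_norm_toLp {f : R3 → E} (hf : MemLp f 2) : l2norm f = ‖hf.toLp f‖ := by
  rw [l2norm_eq_toReal hf.1, Lp.norm_toLp]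

theorem l2norm_congr_norm {F : Type*} [NormedAddCommGroup F] {f : R3 → E} {g : R3 → F}
    (h : ∀ᵐ x, ‖f x‖ = ‖g x‖) : l2norm f = l2norm g := by
  unfold l2norm
  congr 1
  apply integral_congr_ae
  filter_upwards [h] with x hx
  rw [hx]

theorem integrable_norm_sq {f : R3 → E} (hf : MemLp f 2) : Integrable fun x => ‖f x‖ ^ 2 :=
  (memLp_two_iff_integrable_sq_norm hf.1).mp hf

theorem memLp_two_of_sq_le {f : R3 → E} (hf : AEStronglyMeasurable f volume) {g : R3 → ℝ}
    (hg : Integrable g) (h : ∀ x, ‖f x‖ ^ 2 ≤ g x) : MemLp f 2 := by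
  rw [memLp_two_iff_integrable_sq_norm hf]
  refine hg.mono' (hf.norm.pow 2) (ae_of_all _ fun x => ?_)
  simpa using h x

theorem l2norm_mono {F : Type*} [NormedAddCommGroup F] {f : R3 → E} {g : R3 → F}
    (hg : MemLp g 2) (h : ∀ᵐ x, ‖f x‖ ≤ ‖g x‖) : l2norm f ≤ l2norm g := by
  unfold l2norm
  apply Real.sqrt_le_sqrt
  apply integral_mono_of_nonneg (ae_of_all _ fun _ => by positivity) (integrable_norm_sq hg)
  filter_upwards [h] with x hx
  have := norm_nonneg (f x)
  exact pow_le_pow_left₀ this hx 2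

theorem l2norm_add_le {f g : R3 → E} (hf : MemLp f 2) (hg : MemLp g 2) :
    l2norm (fun x => f x + g x) ≤ l2norm f + l2norm g := by
  rw [l2norm_eq_norm_toLp hf, l2norm_eq_norm_toLp hg,
    l2norm_eq_norm_toLp (f := fun x => f x + g x) (hf.add hg)]
  exact norm_add_le (hf.toLp f) (hg.toLp g)

theorem l2norm_neg (f : R3 → E) : l2norm (fun x => -f x) = l2norm f :=
  l2norm_congr_norm (ae_of_all _ fun _ => norm_neg _)

theorem l2norm_sub_le {f g : R3 → E} (hf : MemLp f 2) (hg : MemLp g 2) :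
    l2norm (fun x => f x - g x) ≤ l2norm f + l2norm g := by
  have := l2norm_add_le hf hg.neg
  simp only [Pi.neg_apply, ← sub_eq_add_neg] at this
  exact this.trans_eq (congrArg _ (l2norm_neg g))

theorem l2norm_le_add_sub {f g : R3 → E} (hf : MemLp f 2) (hg : MemLp g 2) :
    l2norm f ≤ l2norm g + l2norm (fun x => f x - g x) := by
  simpa using l2norm_add_le (g := fun x => f x - g x) hg (hf.sub hg)

theorem l2norm_const_mul (c : ℝ) (f : R3 → ℝ) : l2norm (fun x => c * f x) = |c| * l2norm f := by
  unfold l2norm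
  simp_rw [norm_mul, mul_pow, integral_const_mul]
  rw [Real.sqrt_mul (by positivity), Real.sqrt_sq (norm_nonneg c), Real.norm_eq_abs]

theorem integral_norm_mul_norm_le {F : Type*} [NormedAddCommGroup F] {f : R3 → E} {g : R3 → F}
    (hf : MemLp f 2) (hg : MemLp g 2) :
    ∫ x, ‖f x‖ * ‖g x‖ ≤ l2norm f * l2norm g := by
  have h := integral_mul_le_Lp_mul_Lq_of_nonneg (μ := (volume : Measure R3))
    (p := 2) (q := 2) (Real.HolderConjugate.two_two) (f := fun x => ‖f x‖) (g := fun x => ‖g x‖)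
    (ae_of_all _ fun x => norm_nonneg _) (ae_of_all _ fun x => norm_nonneg _)
    (by simpa using hf.norm) (by simpa using hg.norm)
  simpa [l2norm, Real.sqrt_eq_rpow] using h

theorem integrable_norm_mul_norm {F : Type*} [NormedAddCommGroup F] {f : R3 → E} {g : R3 → F}
    (hf : MemLp f 2) (hg : MemLp g 2) : Integrable fun x => ‖f x‖ * ‖g x‖ :=
  MemLp.integrable_mul hf.norm hg.norm

/-- Cauchy–Schwarz for a function dominated by a product. -/
theorem norm_integral_le_l2norm_mul {F G : Type*} [NormedAddCommGroup F] [NormedAddCommGroup G]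
    [NormedSpace ℝ G] {h : R3 → G} {f : R3 → E} {g : R3 → F}
    (hf : MemLp f 2) (hg : MemLp g 2) (hh : ∀ᵐ x, ‖h x‖ ≤ ‖f x‖ * ‖g x‖) :
    ‖∫ x, h x‖ ≤ l2norm f * l2norm g :=
  (norm_integral_le_of_norm_le (integrable_norm_mul_norm hf hg) hh).trans
    (integral_norm_mul_norm_le hf hg)

theorem integrable_of_norm_le_mul {F G : Type*} [NormedAddCommGroup F] [NormedAddCommGroup G]
    {h : R3 → G} {f : R3 → E} {g : R3 → F}
    (hf : MemLp f 2) (hg : MemLp g 2) (hm : AEStronglyMeasurable h volume)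
    (hh : ∀ᵐ x, ‖h x‖ ≤ ‖f x‖ * ‖g x‖) : Integrable h :=
  (integrable_norm_mul_norm hf hg).mono' hm hh

theorem memLp_norm_pow_three {f : R3 → E} (hf : MemLp f 6) : MemLp (fun x => ‖f x‖ ^ 3) 2 := by
  have h := hf.norm_rpow_div (3 : ℝ≥0∞)
  have e : (6 : ℝ≥0∞) / 3 = 2 := by
    symm; rw [ENNReal.eq_div_iff (by simp) (by simp)]; norm_num
  rw [e] at h
  refine h.congr_norm (hf.1.norm.pow 3) (ae_of_all _ fun x => ?_)
  rw [Real.norm_of_nonneg (by positivity), Real.norm_of_nonneg (by positivity),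
    ← Real.rpow_natCast]
  norm_num

theorem integrable_norm_pow_six {f : R3 → E} (hf : MemLp f 6) : Integrable fun x => ‖f x‖ ^ 6 := by
  refine (integrable_norm_sq (memLp_norm_pow_three hf)).congr (ae_of_all _ fun x => ?_)
  simp [← pow_mul]

theorem memLp_norm_mul_norm {F : Type*} [NormedAddCommGroup F] {p : R3 → E} {q : R3 → F}
    (hp : MemLp p 2) (hp6 : MemLp p 6) (hq : MemLp q 2) (hq6 : MemLp q 6) :
    MemLp (fun x => ‖p x‖ * ‖q x‖) 2 := by
  refine memLp_two_of_sq_le (hp.1.norm.mul hq.1.norm)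
    (((integrable_norm_sq hp).add (integrable_norm_pow_six hp6)).add
      ((integrable_norm_sq hq).add (integrable_norm_pow_six hq6))) fun x => ?_
  simp only [Pi.add_apply, norm_mul, norm_norm]
  -- This puts L² ∩ L⁶ inside L⁴ pointwise, without a Hölder interpolation.
  have key : ∀ a : ℝ, 0 ≤ a → a ^ 4 ≤ a ^ 2 + a ^ 6 := fun a _ => by
    nlinarith [mul_nonneg (sq_nonneg a) (sq_nonneg (a ^ 2 - 1)), pow_nonneg ‹0 ≤ a› 4]
  have h1 := key _ (norm_nonneg (p x))
  have h2 := key _ (norm_nonneg (q x))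
  nlinarith [sq_nonneg (‖p x‖ ^ 2 - ‖q x‖ ^ 2), pow_nonneg (norm_nonneg (p x)) 4,
    pow_nonneg (norm_nonneg (q x)) 4]

theorem memLp_norm_sq {p : R3 → E} (hp : MemLp p 2) (hp6 : MemLp p 6) :
    MemLp (fun x => ‖p x‖ ^ 2) 2 := by
  simpa [pow_two] using memLp_norm_mul_norm hp hp6 hp hp6

/-- Interpolation of L⁴ between L² and L⁶: write |p|⁴ = |p|·|p|³ and apply Cauchy–Schwarz. -/
theorem sq_l2norm_norm_sq_le {p : R3 → E} (hp : MemLp p 2) (hp6 : MemLp p 6) :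
    l2norm (fun x => ‖p x‖ ^ 2) ^ 2 ≤ l2norm p * l2norm (fun x => ‖p x‖ ^ 3) := by
  rw [sq_l2norm]
  refine le_trans (le_of_eq ?_) (integral_norm_mul_norm_le hp (memLp_norm_pow_three hp6))
  congr 1; ext x
  simp only [norm_pow, norm_norm]; ring

theorem sq_l2norm_mul_le {F : Type*} [NormedAddCommGroup F] {p : R3 → E} {q : R3 → F}
    (hp : MemLp p 2) (hp6 : MemLp p 6) (hq : MemLp q 2) (hq6 : MemLp q 6) :
    l2norm (fun x => ‖p x‖ * ‖q x‖) ^ 2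
      ≤ l2norm (fun x => ‖p x‖ ^ 2) * l2norm (fun x => ‖q x‖ ^ 2) := by
  rw [sq_l2norm]
  refine le_trans (le_of_eq ?_)
    (integral_norm_mul_norm_le (memLp_norm_sq hp hp6) (memLp_norm_sq hq hq6))
  congr 1; ext x
  simp only [norm_pow, norm_norm, norm_mul]; ring

end L2

/-! ### The Fourier transform on `L²` -/

/-- The Fourier transform of a square integrable function, as a function. -/
def ft2 (u : R3 → ℂ) : R3 → ℂ :=
  open Classical in
  if h : MemLp u 2 volume then ((𝓕 (h.toLp u) : Lp ℂ 2 (volume : Measure R3)) : R3 → ℂ) else 0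

theorem ft2_eq {u : R3 → ℂ} (h : MemLp u 2) :
    ft2 u = ((𝓕 (h.toLp u) : Lp ℂ 2 (volume : Measure R3)) : R3 → ℂ) := dif_pos h

theorem memLp_ft2 {u : R3 → ℂ} (h : MemLp u 2) : MemLp (ft2 u) 2 := by
  rw [ft2_eq h]; exact Lp.memLp _

theorem toLp_ft2 {u : R3 → ℂ} (h : MemLp u 2) :
    (memLp_ft2 h).toLp (ft2 u) = 𝓕 (h.toLp u) := by
  apply Lp.ext
  refine (MemLp.coeFn_toLp _).trans ?_
  rw [ft2_eq h]

theorem l2norm_ft2 {u : R3 → ℂ} (h : MemLp u 2) : l2norm (ft2 u) = l2norm u := by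
  rw [l2norm_eq_norm_toLp (memLp_ft2 h), toLp_ft2, Lp.norm_fourier_eq, l2norm_eq_norm_toLp h]

theorem integral_conj_mul_ft2 {u v : R3 → ℂ} (hu : MemLp u 2) (hv : MemLp v 2) :
    ∫ ξ, ft2 u ξ * star (ft2 v ξ) = ∫ x, u x * star (v x) := by
  have h := Lp.inner_fourier_eq (hv.toLp v) (hu.toLp u)
  rw [L2.inner_def, L2.inner_def] at h
  rw [ft2_eq hu, ft2_eq hv]
  convert h using 1
  · rfl
  · apply integral_congr_ae
    filter_upwards [hu.coeFn_toLp, hv.coeFn_toLp] with x h1 h2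
    rw [h1, h2]
    rfl

/-- The L² transform agrees with the transform of tempered distributions. This pairing is what
identifies `ft2` of concrete functions below. -/
theorem integral_mul_ft2 {u : R3 → ℂ} (hu : MemLp u 2) (g : 𝓢(R3, ℂ)) :
    ∫ ξ, g ξ * ft2 u ξ = ∫ x, 𝓕 g x * u x := by
  have h := congrArg (fun T => T g) (Lp.fourier_toTemperedDistribution_eq (hu.toLp u))
  simp only [TemperedDistribution.fourier_apply, Lp.toTemperedDistribution_apply, smul_eq_mul] at h
  rw [ft2_eq hu, ← h]
  apply integral_congr_ae
  filter_upwards [hu.coeFn_toLp] with x h1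
  rw [h1]

/-- A locally integrable function with the right pairings is the Fourier transform. -/
theorem ft2_ae_eq {u v : R3 → ℂ} (hu : MemLp u 2) (hv : LocallyIntegrable v)
    (h : ∀ g : 𝓢(R3, ℂ), HasCompactSupport g → ∫ ξ, g ξ * v ξ = ∫ x, 𝓕 g x * u x) :
    ft2 u =ᵐ[volume] v := by
  refine ae_eq_of_integral_contDiff_smul_eq
    ((memLp_ft2 hu).locallyIntegrable (by norm_num)) hv fun g hg hc => ?_
  have hc' : HasCompactSupport (fun x => (g x : ℂ)) :=
    hc.comp_left (g := fun r : ℝ => (r : ℂ)) Complex.ofReal_zero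
  have hg' : ContDiff ℝ ∞ (fun x => (g x : ℂ)) := Complex.ofRealCLM.contDiff.comp hg
  let G : 𝓢(R3, ℂ) := hc'.toSchwartzMap hg'
  have e1 := integral_mul_ft2 hu G
  have e2 := h G hc'
  simp only [Complex.real_smul]
  exact e1.trans e2.symm

theorem integral_fourier_mul_eq_flip {f g : R3 → ℂ} (hf : Integrable f) (hg : Integrable g) :
    ∫ ξ, 𝓕 f ξ * g ξ = ∫ x, f x * 𝓕 g x := by
  have := VectorFourier.integral_fourierIntegral_smul_eq_flip (L := innerₗ R3)
    Real.continuous_fourierChar continuous_inner hf hg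
  rw [flip_innerₗ] at this
  exact this

theorem continuous_fourier {f : R3 → ℂ} (hf : Integrable f) : Continuous (𝓕 f) :=
  VectorFourier.fourierIntegral_continuous Real.continuous_fourierChar
    (by exact continuous_inner) hf

theorem ft2_ae_eq_fourier {u : R3 → ℂ} (h1 : Integrable u) (h2 : MemLp u 2) :
    ft2 u =ᵐ[volume] 𝓕 u := by
  refine ft2_ae_eq h2 (continuous_fourier h1).locallyIntegrable fun g _ => ?_
  rw [SchwartzMap.fourier_coe, integral_fourier_mul_eq_flip g.integrable h1]

theorem ft2_sub {u v : R3 → ℂ} (hu : MemLp u 2) (hv : MemLp v 2) :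
    ft2 (fun x => u x - v x) =ᵐ[volume] fun ξ => ft2 u ξ - ft2 v ξ := by
  have huv : MemLp (fun x => u x - v x) 2 := hu.sub hv
  have e : huv.toLp _ = hu.toLp u - hv.toLp v := MemLp.toLp_sub hu hv
  rw [ft2_eq huv, ft2_eq hu, ft2_eq hv, e]
  have : 𝓕 (hu.toLp u - hv.toLp v) = 𝓕 (hu.toLp u) - 𝓕 (hv.toLp v) :=
    (Lp.fourierTransformₗᵢ R3 ℂ).map_sub _ _
  rw [this]
  exact Lp.coeFn_sub _ _

end DipolarGPE

end

noncomputable section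

namespace DipolarGPE

open FourierTransform SchwartzMap

/-! ### Gaussian moments -/

/-- Integration by parts against the constant function 1; integrability of g and g' replaces any
boundary condition. -/
theorem integral_hasLineDerivAt_eq_zero {g g' : R3 → ℂ} {v : R3} (hg : Integrable g)
    (hg' : Integrable g') (h : ∀ x, HasLineDerivAt ℝ g (g' x) x v) : ∫ x, g' x = 0 := by
  have := integral_bilinear_hasLineDerivAt_right_eq_neg_left_of_integrable
    (μ := (volume : Measure R3)) (f := fun _ => (1 : ℂ)) (f' := fun _ => 0) (g := g) (g' := g')
    (v := v) (B := ContinuousLinearMap.mul ℝ ℂ) (by simp) (by simpa using hg') (by simpa using hg)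
    (fun x _ => hasDerivAt_const _ _) (fun x _ => h x)
  simpa using this

/-- The oscillating Gaussian `exp (-b |ξ|² + 2 π i z·ξ)`. -/
def gaussOsc (b : ℝ) (z ξ : R3) : ℂ :=
  Complex.exp (-(b : ℂ) * (‖ξ‖ : ℂ) ^ 2 + (2 * Real.pi * Complex.I) * ((inner ℝ z ξ : ℝ) : ℂ))

theorem norm_gaussOsc (b : ℝ) (z ξ : R3) : ‖gaussOsc b z ξ‖ = Real.exp (-b * ‖ξ‖ ^ 2) := by
  rw [gaussOsc, Complex.norm_exp]
  congr 1
  have : (-(b : ℂ) * (‖ξ‖ : ℂ) ^ 2 + (2 * Real.pi * Complex.I) * ((inner ℝ z ξ : ℝ) : ℂ))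
      = ((-b * ‖ξ‖ ^ 2 : ℝ) : ℂ) + ((2 * Real.pi * inner ℝ z ξ : ℝ) : ℂ) * Complex.I := by
    push_cast; ring
  rw [this]
  simp only [Complex.add_re, Complex.ofReal_re, Complex.re_ofReal_mul, Complex.I_re, mul_zero,
    add_zero]

theorem continuous_gaussOsc (b : ℝ) (z : R3) : Continuous (gaussOsc b z) := by
  unfold gaussOsc; fun_prop

theorem integral_gaussOsc {b : ℝ} (hb : 0 < b) (z : R3) :
    ∫ ξ, gaussOsc b z ξ
      = ((Real.pi / b) ^ (3 / 2 : ℝ) * Real.exp (-(Real.pi ^ 2 * ‖z‖ ^ 2 / b)) : ℝ) := by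
  have h := GaussianFourier.integral_cexp_neg_mul_sq_norm_add (V := R3) (b := (b : ℂ))
    (by simpa using hb) (2 * Real.pi * Complex.I) z
  unfold gaussOsc
  rw [h]
  push_cast
  congr 1
  · rw [Complex.ofReal_cpow (by positivity)]
    simp
  · congr 1
    rw [mul_pow, Complex.I_sq]
    have : (b : ℂ) ≠ 0 := by exact_mod_cast hb.ne'
    field_simp
    ring

theorem integrable_exp_neg_mul_norm_sq {b : ℝ} (hb : 0 < b) :
    Integrable fun ξ : R3 => Real.exp (-b * ‖ξ‖ ^ 2) := by
  have h := (GaussianFourier.integrable_cexp_neg_mul_sq_norm_add (V := R3) (b := (b : ℂ))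
    (by simpa using hb) 0 0).norm
  refine h.congr (ae_of_all _ fun ξ => ?_)
  simp only [Complex.norm_exp]
  simp [← Complex.ofReal_pow]

theorem norm_sq_mul_exp_le {b : ℝ} (hb : 0 < b) (ξ : R3) :
    ‖ξ‖ ^ 2 * Real.exp (-b * ‖ξ‖ ^ 2) ≤ 2 / b * Real.exp (-(b / 2) * ‖ξ‖ ^ 2) := by
  have h1 : Real.exp (-b * ‖ξ‖ ^ 2)
      = Real.exp (-(b / 2) * ‖ξ‖ ^ 2) * Real.exp (-(b / 2) * ‖ξ‖ ^ 2) := by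
    rw [← Real.exp_add]; congr 1; ring
  have h2 : b / 2 * ‖ξ‖ ^ 2 * Real.exp (-(b / 2) * ‖ξ‖ ^ 2) ≤ 1 := by
    have h3 : b / 2 * ‖ξ‖ ^ 2 ≤ Real.exp (b / 2 * ‖ξ‖ ^ 2) := by
      linarith [Real.add_one_le_exp (b / 2 * ‖ξ‖ ^ 2)]
    calc _ ≤ Real.exp (b / 2 * ‖ξ‖ ^ 2) * Real.exp (-(b / 2) * ‖ξ‖ ^ 2) := by gcongr
      _ = 1 := by rw [← Real.exp_add]; simp
  have h4 : 0 ≤ Real.exp (-(b / 2) * ‖ξ‖ ^ 2) := (Real.exp_pos _).le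
  calc ‖ξ‖ ^ 2 * Real.exp (-b * ‖ξ‖ ^ 2)
      = 2 / b * (b / 2 * ‖ξ‖ ^ 2 * Real.exp (-(b / 2) * ‖ξ‖ ^ 2))
          * Real.exp (-(b / 2) * ‖ξ‖ ^ 2) := by
        rw [h1]; field_simp
    _ ≤ 2 / b * 1 * Real.exp (-(b / 2) * ‖ξ‖ ^ 2) := by gcongr
    _ = _ := by ring

theorem integrable_norm_sq_mul_exp {b : ℝ} (hb : 0 < b) :
    Integrable fun ξ : R3 => ‖ξ‖ ^ 2 * Real.exp (-b * ‖ξ‖ ^ 2) := by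
  refine ((integrable_exp_neg_mul_norm_sq (half_pos hb)).const_mul (2 / b)).mono'
    (by fun_prop) (ae_of_all _ fun ξ => ?_)
  rw [Real.norm_of_nonneg (by positivity)]
  exact norm_sq_mul_exp_le hb ξ

theorem abs_coord_le (ξ : R3) (j : Fin 3) : |ξ j| ≤ ‖ξ‖ := by
  simpa using PiLp.norm_apply_le ξ j

theorem integrable_coord_sq_mul_gaussOsc {b : ℝ} (hb : 0 < b) (z : R3) (j : Fin 3) :
    Integrable fun ξ : R3 => ((ξ j : ℂ)) ^ 2 * gaussOsc b z ξ := by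
  refine (integrable_norm_sq_mul_exp hb).mono'
    (by have := continuous_gaussOsc b z; fun_prop) (ae_of_all _ fun ξ => ?_)
  rw [norm_mul, norm_gaussOsc, norm_pow, Complex.norm_real, Real.norm_eq_abs]
  gcongr
  exact abs_coord_le ξ j

theorem integrable_gaussOsc {b : ℝ} (hb : 0 < b) (z : R3) : Integrable (gaussOsc b z) := by
  refine (integrable_exp_neg_mul_norm_sq hb).mono' (continuous_gaussOsc b z).aestronglyMeasurable
    (ae_of_all _ fun ξ => ?_)
  rw [norm_gaussOsc]

theorem integrable_coord_mul_gaussOsc {b : ℝ} (hb : 0 < b) (z : R3) (j : Fin 3) :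
    Integrable fun ξ : R3 => (ξ j : ℂ) * gaussOsc b z ξ := by
  refine ((integrable_gaussOsc hb z).norm.add
    (integrable_coord_sq_mul_gaussOsc hb z j).norm).mono'
    (by have := continuous_gaussOsc b z; fun_prop) (ae_of_all _ fun ξ => ?_)
  simp only [Pi.add_apply, norm_mul, norm_pow]
  have h1 := norm_nonneg (gaussOsc b z ξ)
  have h2 : ‖(ξ j : ℂ)‖ ≤ 1 + ‖(ξ j : ℂ)‖ ^ 2 := by nlinarith [sq_nonneg (‖(ξ j : ℂ)‖ - 1)]
  nlinarith

theorem hasLineDerivAt_gaussOsc (b : ℝ) (z ξ : R3) (j : Fin 3) :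
    HasLineDerivAt ℝ (gaussOsc b z)
      ((-2 * b * (ξ j : ℂ) + 2 * Real.pi * Complex.I * (z j : ℂ)) * gaussOsc b z ξ) ξ
      (EuclideanSpace.single j 1) := by
  unfold HasLineDerivAt
  have e : (fun t : ℝ => gaussOsc b z (ξ + t • EuclideanSpace.single j 1)) = fun t : ℝ =>
      Complex.exp (-(b : ℂ) * ((‖ξ‖ : ℂ) ^ 2 + 2 * (t : ℂ) * (ξ j : ℂ) + (t : ℂ) ^ 2)
        + (2 * Real.pi * Complex.I) * (((inner ℝ z ξ : ℝ) : ℂ) + (t : ℂ) * (z j : ℂ))) := by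
    ext t
    unfold gaussOsc
    have h1 : ‖ξ + t • EuclideanSpace.single j (1 : ℝ)‖ ^ 2 = ‖ξ‖ ^ 2 + 2 * t * ξ j + t ^ 2 := by
      rw [norm_add_sq_real, norm_smul, inner_smul_right, EuclideanSpace.inner_single_right]
      simp
      ring
    have h2 : inner ℝ z (ξ + t • EuclideanSpace.single j (1 : ℝ)) = inner ℝ z ξ + t * z j := by
      rw [inner_add_right, inner_smul_right, EuclideanSpace.inner_single_right]
      simp
    rw [← Complex.ofReal_pow, h1, h2]
    push_cast
    rfl
  rw [e]
  have ht : HasDerivAt (fun t : ℝ => (t : ℂ)) 1 0 := Complex.ofRealCLM.hasDerivAt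
  have h1 : HasDerivAt (fun t : ℝ => -(b : ℂ) * ((‖ξ‖ : ℂ) ^ 2 + 2 * (t : ℂ) * (ξ j : ℂ) + (t : ℂ) ^ 2)
        + (2 * Real.pi * Complex.I) * (((inner ℝ z ξ : ℝ) : ℂ) + (t : ℂ) * (z j : ℂ)))
      (-2 * b * (ξ j : ℂ) + 2 * Real.pi * Complex.I * (z j : ℂ)) 0 := by
    have := (((((ht.const_mul 2).mul_const (ξ j : ℂ)).const_add ((‖ξ‖ : ℂ) ^ 2)).add
      (ht.pow 2)).const_mul (-(b : ℂ))).add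
      (((ht.mul_const (z j : ℂ)).const_add ((inner ℝ z ξ : ℝ) : ℂ)).const_mul
        (2 * Real.pi * Complex.I))
    refine this.congr_deriv ?_
    simp
    ring
  refine h1.cexp.congr_deriv ?_
  simp [gaussOsc]
  ring

/-- The integral of ∂ⱼ of the oscillating Gaussian vanishes, which expresses the first moment
through the zeroth. The second moment follows in the same way from ∂ⱼ(ξⱼ · Gaussian). -/
theorem integral_coord_mul_gaussOsc {b : ℝ} (hb : 0 < b) (z : R3) (j : Fin 3) :
    (b : ℂ) * ∫ ξ, (ξ j : ℂ) * gaussOsc b z ξ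
      = Real.pi * Complex.I * (z j : ℂ) * ∫ ξ, gaussOsc b z ξ := by
  have h := integral_hasLineDerivAt_eq_zero (integrable_gaussOsc hb z)
    (g' := fun ξ => (-2 * b * (ξ j : ℂ) + 2 * Real.pi * Complex.I * (z j : ℂ)) * gaussOsc b z ξ)
    (by
      refine (((integrable_coord_mul_gaussOsc hb z j).const_mul (-2 * b : ℂ)).add
        ((integrable_gaussOsc hb z).const_mul (2 * Real.pi * Complex.I * (z j : ℂ)))).congr
          (ae_of_all _ fun ξ => ?_)
      simp only [Pi.add_apply]; ring)
    (hasLineDerivAt_gaussOsc b z · j)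
  have e : (fun ξ : R3 => (-2 * b * (ξ j : ℂ) + 2 * Real.pi * Complex.I * (z j : ℂ))
      * gaussOsc b z ξ) = fun ξ => (-2 * b : ℂ) * ((ξ j : ℂ) * gaussOsc b z ξ)
        + (2 * Real.pi * Complex.I * (z j : ℂ)) * gaussOsc b z ξ := by ext; ring
  rw [e, integral_add ((integrable_coord_mul_gaussOsc hb z j).const_mul _)
    ((integrable_gaussOsc hb z).const_mul _), integral_const_mul, integral_const_mul] at h
  linear_combination (-1 / 2) * h

theorem integral_coord_sq_mul_gaussOsc {b : ℝ} (hb : 0 < b) (z : R3) (j : Fin 3) :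
    2 * (b : ℂ) ^ 2 * ∫ ξ, (ξ j : ℂ) ^ 2 * gaussOsc b z ξ
      = (b - 2 * Real.pi ^ 2 * (z j : ℂ) ^ 2) * ∫ ξ, gaussOsc b z ξ := by
  have i0 := integrable_gaussOsc hb z
  have i1 := integrable_coord_mul_gaussOsc hb z j
  have i2 := integrable_coord_sq_mul_gaussOsc hb z j
  have e : (fun ξ : R3 => gaussOsc b z ξ + (ξ j : ℂ) *
      ((-2 * b * (ξ j : ℂ) + 2 * Real.pi * Complex.I * (z j : ℂ)) * gaussOsc b z ξ))
      = fun ξ => gaussOsc b z ξ + ((-2 * b : ℂ) * ((ξ j : ℂ) ^ 2 * gaussOsc b z ξ)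
        + (2 * Real.pi * Complex.I * (z j : ℂ)) * ((ξ j : ℂ) * gaussOsc b z ξ)) := by ext; ring
  have h := integral_hasLineDerivAt_eq_zero i1
    (g' := fun ξ => gaussOsc b z ξ + (ξ j : ℂ) *
      ((-2 * b * (ξ j : ℂ) + 2 * Real.pi * Complex.I * (z j : ℂ)) * gaussOsc b z ξ))
    (v := EuclideanSpace.single j 1)
    (by rw [e]; exact i0.add ((i2.const_mul _).fun_add (i1.const_mul _)))
    (fun ξ => by
      have hc : HasLineDerivAt ℝ (fun ξ : R3 => (ξ j : ℂ)) 1 ξ (EuclideanSpace.single j 1) := by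
        unfold HasLineDerivAt
        have : (fun t : ℝ => (((ξ + t • EuclideanSpace.single j (1 : ℝ)) j : ℝ) : ℂ))
            = fun t : ℝ => (ξ j : ℂ) + (t : ℂ) := by ext t; simp
        rw [this]
        exact (Complex.ofRealCLM.hasDerivAt (x := (0 : ℝ))).const_add (ξ j : ℂ)
      have := HasDerivAt.mul hc (hasLineDerivAt_gaussOsc b z ξ j)
      unfold HasLineDerivAt
      refine this.congr_deriv ?_
      simp)
  rw [e, integral_add i0 ((i2.const_mul _).fun_add (i1.const_mul _)), integral_add (i2.const_mul _)
    (i1.const_mul _), integral_const_mul, integral_const_mul] at h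
  have h1 := integral_coord_mul_gaussOsc hb z j
  have hI := Complex.I_sq
  linear_combination (-b : ℂ) * h + 2 * Real.pi * Complex.I * (z j : ℂ) * h1
    + 2 * Real.pi ^ 2 * (z j : ℂ) ^ 2 * (∫ ξ, gaussOsc b z ξ) * hI

/-- The numerator of the dipolar kernel. -/
def dipolePoly (z : R3) : ℝ := z 0 ^ 2 + z 1 ^ 2 - 2 * z 2 ^ 2

/-- The polynomial is harmonic: its coefficients 1, 1, -2 sum to zero, so the isotropic part of the
second moments cancels. The transform of the polynomial times a Gaussian is therefore the same
polynomial times a Gaussian. -/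
theorem integral_dipolePoly_mul_gaussOsc {b : ℝ} (hb : 0 < b) (z : R3) :
    ∫ ξ, (dipolePoly ξ : ℂ) * gaussOsc b z ξ
      = -(Real.pi ^ 2 / b ^ 2) * dipolePoly z * ∫ ξ, gaussOsc b z ξ := by
  have e : (fun ξ : R3 => (dipolePoly ξ : ℂ) * gaussOsc b z ξ) = fun ξ =>
      (ξ 0 : ℂ) ^ 2 * gaussOsc b z ξ + ((ξ 1 : ℂ) ^ 2 * gaussOsc b z ξ
        + (-2 : ℂ) * ((ξ 2 : ℂ) ^ 2 * gaussOsc b z ξ)) := by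
    ext ξ; simp only [dipolePoly]; push_cast; ring
  have i := fun j => integrable_coord_sq_mul_gaussOsc hb z j
  rw [e, integral_add (i 0) ((i 1).fun_add ((i 2).const_mul _)), integral_add (i 1)
    ((i 2).const_mul _), integral_const_mul]
  have h := fun j => integral_coord_sq_mul_gaussOsc hb z j
  have hb' : (b : ℂ) ≠ 0 := by exact_mod_cast hb.ne'
  unfold dipolePoly
  push_cast
  field_simp
  linear_combination (1 / 2 : ℂ) * h 0 + (1 / 2 : ℂ) * h 1 - h 2

theorem abs_dipolePoly_le (z : R3) : |dipolePoly z| ≤ 2 * ‖z‖ ^ 2 := by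
  rw [norm_sq_eq_sum, dipolePoly, abs_le]
  constructor <;> nlinarith [sq_nonneg (z 0), sq_nonneg (z 1), sq_nonneg (z 2)]

end DipolarGPE

end

noncomputable section

namespace DipolarGPE

open FourierTransform SchwartzMap

/-! ### The mollified dipolar kernel -/

/-- The dipolar symbol times a Gaussian, a regularization of the symbol. -/
def symbolHeat (ε : ℝ) (ξ : R3) : ℂ :=
  ((symbolK ξ * Real.exp (-(Real.pi ^ 2 * ε ^ 2) * ‖ξ‖ ^ 2) : ℝ) : ℂ)

/-- The dipolar kernel mollified at scale `ε`. -/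
def heatK (ε : ℝ) (z : R3) : ℂ := ∫ ξ, (symbolK ξ : ℂ) * gaussOsc (Real.pi ^ 2 * ε ^ 2) z ξ

theorem gaussOsc_eq (b : ℝ) (z ξ : R3) : gaussOsc b z ξ
    = (Real.exp (-b * ‖ξ‖ ^ 2) : ℝ) * Complex.exp (2 * Real.pi * Complex.I * (inner ℝ z ξ : ℝ)) := by
  rw [gaussOsc, Complex.exp_add]
  push_cast
  rfl

theorem integrable_symbolHeat {ε : ℝ} (hε : 0 < ε) : Integrable (symbolHeat ε) := by
  refine ((integrable_exp_neg_mul_norm_sq (b := Real.pi ^ 2 * ε ^ 2) (by positivity)).const_mul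
    (8 * Real.pi / 3)).mono' ?_ (ae_of_all _ fun ξ => ?_)
  · have := measurable_symbolK
    unfold symbolHeat
    exact (by fun_prop : Measurable _).aestronglyMeasurable
  · rw [symbolHeat, Complex.norm_real, norm_mul, Real.norm_eq_abs, Real.norm_eq_abs, Real.abs_exp]
    gcongr
    exact abs_symbolK_le ξ

theorem heatK_eq_fourier (ε : ℝ) (z : R3) : heatK ε z = 𝓕 (symbolHeat ε) (-z) := by
  rw [Real.fourier_eq', heatK]
  congr 1; ext ξ
  rw [gaussOsc_eq, symbolHeat, smul_eq_mul, inner_neg_right, real_inner_comm]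
  push_cast
  rw [← mul_assoc, mul_comm]
  congr 2
  ring

theorem continuous_heatK {ε : ℝ} (hε : 0 < ε) : Continuous (heatK ε) := by
  have : heatK ε = fun z => 𝓕 (symbolHeat ε) (-z) := funext (heatK_eq_fourier ε)
  rw [this]
  exact (continuous_fourier (integrable_symbolHeat hε)).comp continuous_neg

/-- The weight in the representation of the kernel as a superposition of Gaussians. -/
def heatWeight (v : ℝ) : ℝ := 4 / (3 * √Real.pi) * v ^ (-(7 / 2) : ℝ)

theorem heatWeight_nonneg {v : ℝ} (hv : 0 ≤ v) : 0 ≤ heatWeight v := by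
  unfold heatWeight; positivity

theorem measurable_heatWeight : Measurable heatWeight := by
  unfold heatWeight; fun_prop

theorem integral_Ioi_exp_neg {r : ℝ} (hr : 0 < r) :
    ∫ v in Set.Ioi (1 : ℝ), Real.exp (-(Real.pi ^ 2 * v) * r ^ 2)
      = Real.exp (-Real.pi ^ 2 * r ^ 2) / (Real.pi ^ 2 * r ^ 2) := by
  have h := integral_exp_mul_Ioi (a := -(Real.pi ^ 2 * r ^ 2)) (by
    have := Real.pi_pos
    have : 0 < Real.pi ^ 2 * r ^ 2 := by positivity
    linarith) 1
  rw [show (fun v : ℝ => Real.exp (-(Real.pi ^ 2 * v) * r ^ 2))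
    = fun v => Real.exp (-(Real.pi ^ 2 * r ^ 2) * v) by ext v; congr 1; ring, h, mul_one,
    div_neg, neg_div, neg_neg]
  congr 2; ring

/-- Bookkeeping for a Gaussian of parameter b = π²v: 4π³/3 comes from writing the symbol as -(4π³/3)
P/(π²|ξ|²), with P the dipole polynomial, π²/b² from the second moments, and (π/b)^(3/2) from the
Gaussian integral. -/
theorem heatWeight_eq {v : ℝ} (hv : 0 < v) :
    4 * Real.pi ^ 3 / 3 * (Real.pi ^ 2 / (Real.pi ^ 2 * v) ^ 2
      * (Real.pi / (Real.pi ^ 2 * v)) ^ (3 / 2 : ℝ)) = heatWeight v := by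
  have hpi := Real.pi_pos
  have e1 : Real.pi / (Real.pi ^ 2 * v) = (Real.pi * v)⁻¹ := by field_simp
  have e2 : ((Real.pi * v)⁻¹) ^ (3 / 2 : ℝ)
      = (Real.pi * √Real.pi)⁻¹ * (v ^ (3 / 2 : ℝ))⁻¹ := by
    rw [Real.inv_rpow (by positivity), Real.mul_rpow hpi.le hv.le, mul_inv]
    congr 2
    rw [show (3 / 2 : ℝ) = 1 + 1 / 2 by norm_num, Real.rpow_add hpi, Real.rpow_one,
      Real.sqrt_eq_rpow]
  have e3 : v ^ (-(7 / 2) : ℝ) = (v ^ 2)⁻¹ * (v ^ (3 / 2 : ℝ))⁻¹ := by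
    rw [Real.rpow_neg hv.le, ← mul_inv, ← Real.rpow_natCast v 2, ← Real.rpow_add hv]
    norm_num
  rw [heatWeight, e1, e2, e3]
  have : √Real.pi ≠ 0 := by positivity
  have : v ^ (3 / 2 : ℝ) ≠ 0 := by positivity
  field_simp

/-- The factor 1/|ξ|² in the symbol is absorbed by the identity exp(-π²r²)/(π²r²) = ∫₁^∞ exp(-π²vr²)
dv. What remains for each v is a harmonic polynomial times a Gaussian, whose transform is explicit.
-/
theorem heatK_one_eq (z : R3) : heatK 1 z
    = ((dipolePoly z * ∫ v in Set.Ioi (1 : ℝ), heatWeight v * Real.exp (-(‖z‖ ^ 2 / v)) : ℝ) : ℂ) := by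
  have hpi := Real.pi_pos
  set F : R3 → ℝ → ℂ := fun ξ v =>
    (-(4 * Real.pi ^ 3 / 3) : ℂ) * ((dipolePoly ξ : ℂ) * gaussOsc (Real.pi ^ 2 * v) z ξ) with hF
  have hz : ∀ᵐ ξ : R3, ξ ≠ 0 := by
    rw [ae_iff]; simp
  have hnorm : ∀ ξ v, ‖F ξ v‖
      = 4 * Real.pi ^ 3 / 3 * |dipolePoly ξ| * Real.exp (-(Real.pi ^ 2 * v) * ‖ξ‖ ^ 2) := by
    intro ξ v
    rw [hF]
    simp only [norm_mul, norm_gaussOsc, norm_neg, Complex.norm_real, Real.norm_eq_abs]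
    have : ‖(4 * (Real.pi : ℂ) ^ 3 / 3)‖ = 4 * Real.pi ^ 3 / 3 := by
      rw [show (4 * (Real.pi : ℂ) ^ 3 / 3) = ((4 * Real.pi ^ 3 / 3 : ℝ) : ℂ) by push_cast; rfl,
        Complex.norm_real, Real.norm_of_nonneg (by positivity)]
    rw [this]; ring
  have hint : ∀ ξ : R3, ξ ≠ 0 → IntegrableOn
      (fun v : ℝ => Real.exp (-(Real.pi ^ 2 * v) * ‖ξ‖ ^ 2)) (Set.Ioi 1) := by
    intro ξ hξ
    have h1 : 0 < ‖ξ‖ := norm_pos_iff.mpr hξ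
    have := exp_neg_integrableOn_Ioi 1 (b := Real.pi ^ 2 * ‖ξ‖ ^ 2) (by positivity)
    refine this.congr_fun (fun v _ => ?_) measurableSet_Ioi
    simp only; congr 1; ring
  have hPs : ∀ ξ : R3, ξ ≠ 0 → 4 * Real.pi ^ 3 / 3 * dipolePoly ξ / (Real.pi ^ 2 * ‖ξ‖ ^ 2)
      = -symbolK ξ := by
    intro ξ hξ
    have h1 : ‖ξ‖ ≠ 0 := norm_ne_zero_iff.mpr hξ
    unfold dipolePoly symbolK
    field_simp
    ring
  have hFm : Measurable (Function.uncurry F) := by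
    rw [hF]
    unfold Function.uncurry gaussOsc dipolePoly
    fun_prop
  -- Fubini is legitimate because integrating the norm over v gives back the norm of `symbolHeat 1
  -- ξ`, which is integrable.
  have hprod : Integrable (Function.uncurry F) (volume.prod (volume.restrict (Set.Ioi (1 : ℝ)))) := by
    rw [integrable_prod_iff hFm.aestronglyMeasurable]
    constructor
    · filter_upwards [hz] with ξ hξ
      refine ((hint ξ hξ).const_mul (4 * Real.pi ^ 3 / 3 * |dipolePoly ξ|)).mono'
        (hFm.comp measurable_prodMk_left).aestronglyMeasurable (ae_of_all _ fun v => ?_)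
      exact (hnorm ξ v).le
    · refine (integrable_symbolHeat one_pos).norm.congr ?_
      filter_upwards [hz] with ξ hξ
      have h1 : 0 < ‖ξ‖ := norm_pos_iff.mpr hξ
      simp only [Function.uncurry, hnorm]
      rw [integral_const_mul, integral_Ioi_exp_neg h1, symbolHeat, Complex.norm_real, norm_mul,
        Real.norm_eq_abs, Real.norm_eq_abs, Real.abs_exp, ← abs_neg, ← hPs ξ hξ, abs_div, abs_mul,
        abs_of_pos (by positivity : 0 < 4 * Real.pi ^ 3 / 3),
        abs_of_pos (by positivity : 0 < Real.pi ^ 2 * ‖ξ‖ ^ 2)]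
      simp only [one_pow, mul_one]
      ring
  have hleft : heatK 1 z = ∫ ξ, ∫ v in Set.Ioi (1 : ℝ), F ξ v := by
    rw [heatK]
    apply integral_congr_ae
    filter_upwards [hz] with ξ hξ
    have h1 : 0 < ‖ξ‖ := norm_pos_iff.mpr hξ
    have e : ∀ v : ℝ, F ξ v = (((-(4 * Real.pi ^ 3 / 3) * dipolePoly ξ : ℝ) : ℂ) *
        Complex.exp (2 * Real.pi * Complex.I * (inner ℝ z ξ : ℝ))) *
        ((Real.exp (-(Real.pi ^ 2 * v) * ‖ξ‖ ^ 2) : ℝ) : ℂ) := by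
      intro v
      rw [hF]
      simp only [gaussOsc_eq]
      push_cast; ring
    simp_rw [e]
    rw [integral_const_mul, integral_complex_ofReal, integral_Ioi_exp_neg h1, gaussOsc_eq]
    have := hPs ξ hξ
    have h2 : symbolK ξ = -(4 * Real.pi ^ 3 / 3) * dipolePoly ξ / (Real.pi ^ 2 * ‖ξ‖ ^ 2) := by
      rw [← neg_neg (symbolK ξ), ← this]; ring
    rw [h2]
    simp only [one_pow, mul_one]
    push_cast
    ring
  rw [hleft, integral_integral_swap hprod]
  rw [← integral_const_mul, ← integral_complex_ofReal]
  apply setIntegral_congr_fun measurableSet_Ioi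
  intro v hv
  have hv0 : 0 < v := lt_trans one_pos hv
  simp only [hF]
  rw [integral_const_mul, integral_dipolePoly_mul_gaussOsc (by positivity),
    integral_gaussOsc (by positivity), ← heatWeight_eq hv0]
  have : Real.pi ^ 2 * ‖z‖ ^ 2 / (Real.pi ^ 2 * v) = ‖z‖ ^ 2 / v := by field_simp
  rw [this]
  push_cast
  ring

theorem Gamma_five_half : Real.Gamma (5 / 2) = 3 * √Real.pi / 4 := by
  rw [show (5 / 2 : ℝ) = (1 / 2 + 1) + 1 by norm_num, Real.Gamma_add_one (by norm_num),
    Real.Gamma_add_one (by norm_num), Real.Gamma_one_half_eq]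
  ring

/-- Integrating the same weight over all v > 0 instead of v > 1 gives exactly the radial factor of
the dipolar kernel. The substitution y = 1/v turns the integral into Γ(5/2). -/
theorem integral_heatWeight_mul_exp {r : ℝ} (hr : 0 < r) :
    ∫ v in Set.Ioi (0 : ℝ), heatWeight v * Real.exp (-(r ^ 2 / v)) = (r ^ 5)⁻¹ := by
  have h1 := integral_comp_rpow_Ioi
    (fun y : ℝ => y ^ ((5 / 2 : ℝ) - 1) * Real.exp (-(r ^ 2 * y))) (p := -1) (by norm_num)
  rw [Real.integral_rpow_mul_exp_neg_mul_Ioi (by norm_num) (by positivity), Gamma_five_half] at h1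
  have h2 : ∫ v in Set.Ioi (0 : ℝ), heatWeight v * Real.exp (-(r ^ 2 / v))
      = 4 / (3 * √Real.pi) * ((1 / r ^ 2) ^ (5 / 2 : ℝ) * (3 * √Real.pi / 4)) := by
    rw [← h1, ← integral_const_mul]
    apply setIntegral_congr_fun measurableSet_Ioi
    intro v hv
    have hv0 : 0 < v := hv
    simp only [smul_eq_mul, heatWeight]
    rw [← Real.rpow_mul hv0.le, Real.rpow_neg_one v, ← div_eq_mul_inv,
      show (-(7 / 2) : ℝ) = (-1 - 1) + (-1 * (5 / 2 - 1)) by norm_num, Real.rpow_add hv0]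
    simp only [abs_neg, abs_one, one_mul]
    ring
  rw [h2]
  have h3 : (1 / r ^ 2) ^ (5 / 2 : ℝ) = (r ^ 5)⁻¹ := by
    rw [one_div, ← inv_pow, ← Real.rpow_natCast (r⁻¹) 2, ← Real.rpow_mul (by positivity),
      ← inv_pow, ← Real.rpow_natCast]
    norm_num
  rw [h3]
  have : √Real.pi ≠ 0 := by positivity
  field_simp

theorem integrableOn_heatWeight_Ioi_one : IntegrableOn heatWeight (Set.Ioi 1) := by
  unfold heatWeight
  exact (integrableOn_Ioi_rpow_of_lt (by norm_num) one_pos).const_mul _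

/-- From exp(-x) ≤ 24/x⁴ at x = r²/v: the four powers of v beat the singularity v^(-7/2). The decay
r⁻⁸, multiplied by a quadratic polynomial, leaves r⁻⁶, which is integrable at infinity in ℝ³. -/
theorem heatWeight_mul_exp_le {r v : ℝ} (hr : 0 < r) (hv : 0 < v) (hv1 : v ≤ 1) :
    heatWeight v * Real.exp (-(r ^ 2 / v)) ≤ 4 / (3 * √Real.pi) * 24 / r ^ 8 := by
  have h1 : (r ^ 2 / v) ^ 4 / 24 ≤ Real.exp (r ^ 2 / v) := by
    have := Real.pow_div_factorial_le_exp (r ^ 2 / v) (by positivity) 4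
    simpa [Nat.factorial] using this
  have h2 : Real.exp (-(r ^ 2 / v)) ≤ 24 * v ^ 4 / r ^ 8 := by
    rw [Real.exp_neg]
    have : 0 < (r ^ 2 / v) ^ 4 / 24 := by positivity
    calc (Real.exp (r ^ 2 / v))⁻¹ ≤ ((r ^ 2 / v) ^ 4 / 24)⁻¹ := inv_anti₀ this h1
      _ = 24 * v ^ 4 / r ^ 8 := by field_simp
  have h3 : v ^ (-(7 / 2) : ℝ) * v ^ 4 ≤ 1 := by
    rw [← Real.rpow_natCast v 4, ← Real.rpow_add hv]
    exact Real.rpow_le_one hv.le hv1 (by norm_num)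
  calc heatWeight v * Real.exp (-(r ^ 2 / v))
      ≤ heatWeight v * (24 * v ^ 4 / r ^ 8) := by
        have := heatWeight_nonneg hv.le; gcongr
    _ = 4 / (3 * √Real.pi) * 24 / r ^ 8 * (v ^ (-(7 / 2) : ℝ) * v ^ 4) := by
        rw [heatWeight]; ring
    _ ≤ 4 / (3 * √Real.pi) * 24 / r ^ 8 * 1 := by gcongr
    _ = _ := by ring

theorem integrableOn_heatWeight_mul_exp {r : ℝ} (hr : 0 < r) :
    IntegrableOn (fun v => heatWeight v * Real.exp (-(r ^ 2 / v))) (Set.Ioi 0) := by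
  have hm : Measurable fun v => heatWeight v * Real.exp (-(r ^ 2 / v)) := by
    have := measurable_heatWeight; fun_prop
  rw [← Set.Ioc_union_Ioi_eq_Ioi (zero_le_one' ℝ)]
  refine IntegrableOn.union ?_ ?_
  · refine Measure.integrableOn_of_bounded (M := 4 / (3 * √Real.pi) * 24 / r ^ 8) (by simp)
      hm.aestronglyMeasurable ?_
    filter_upwards [ae_restrict_mem measurableSet_Ioc] with v hv
    rw [Real.norm_of_nonneg (mul_nonneg (heatWeight_nonneg hv.1.le) (Real.exp_pos _).le)]
    exact heatWeight_mul_exp_le hr hv.1 hv.2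
  · refine integrableOn_heatWeight_Ioi_one.mono' hm.aestronglyMeasurable ?_
    filter_upwards [ae_restrict_mem measurableSet_Ioi] with v hv
    have hv0 : 0 < v := lt_trans one_pos hv
    have h0 := heatWeight_nonneg hv0.le
    rw [Real.norm_of_nonneg (mul_nonneg h0 (Real.exp_pos _).le)]
    refine mul_le_of_le_one_right h0 (Real.exp_le_one_iff.mpr ?_)
    have : 0 ≤ r ^ 2 / v := by positivity
    linarith

end DipolarGPE

end

noncomputable section

namespace DipolarGPE

open FourierTransform SchwartzMap

/-! ### The principal value as a Fourier multiplier -/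

/-- The kernel truncated to `|z| > ε`. -/
def truncK (ε : ℝ) (z : R3) : ℝ := if ε < ‖z‖ then kernelK z else 0

theorem measurable_truncK (ε : ℝ) : Measurable (truncK ε) := by
  unfold truncK kernelK
  exact Measurable.ite (measurableSet_lt measurable_const measurable_norm) (by fun_prop)
    measurable_const

theorem kernelK_eq (z : R3) : kernelK z = dipolePoly z / ‖z‖ ^ 5 := rfl

theorem truncConvK_eq (ε : ℝ) (f : R3 → ℝ) (x : R3) :
    truncConvK ε f x = ∫ y, truncK ε (x - y) * f y := by
  unfold truncConvK
  rw [← integral_indicator (measurableSet_lt measurable_const (by fun_prop))]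
  congr 1; ext y
  simp only [Set.indicator, Set.mem_ofPred_eq, truncK]
  split_ifs <;> simp

theorem truncK_smul {ε : ℝ} (hε : 0 < ε) (z : R3) :
    truncK ε (ε • z) = (ε ^ 3)⁻¹ * truncK 1 z := by
  unfold truncK
  have h : ε < ‖ε • z‖ ↔ 1 < ‖z‖ := by
    rw [norm_smul, Real.norm_of_nonneg hε.le]
    exact lt_mul_iff_one_lt_right hε
  simp only [h]
  split_ifs with h1
  · have : ‖z‖ ≠ 0 := by linarith
    unfold kernelK
    rw [norm_smul, Real.norm_of_nonneg hε.le]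
    simp only [PiLp.smul_apply, smul_eq_mul]
    field_simp
  · simp

theorem gaussOsc_smul (ε : ℝ) (z ξ : R3) :
    gaussOsc (Real.pi ^ 2 * ε ^ 2) (ε • z) ξ = gaussOsc (Real.pi ^ 2 * 1 ^ 2) z (ε • ξ) := by
  unfold gaussOsc
  rw [real_inner_smul_left, real_inner_smul_right, norm_smul, ← Complex.ofReal_pow,
    ← Complex.ofReal_pow, mul_pow, Real.norm_eq_abs, sq_abs]
  congr 2
  push_cast; ring

theorem heatK_smul {ε : ℝ} (hε : 0 < ε) (z : R3) :
    heatK ε (ε • z) = ((ε ^ 3)⁻¹ : ℝ) * heatK 1 z := by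
  unfold heatK
  simp_rw [gaussOsc_smul]
  have e : (fun ξ : R3 => (symbolK ξ : ℂ) * gaussOsc (Real.pi ^ 2 * 1 ^ 2) z (ε • ξ))
      = fun ξ => (fun ζ : R3 => (symbolK ζ : ℂ) * gaussOsc (Real.pi ^ 2 * 1 ^ 2) z ζ) (ε • ξ) := by
    ext ξ; simp only [symbolK_smul ε hε.ne' ξ]
  rw [e]
  refine (Measure.integral_comp_smul (volume : Measure R3)
    (fun ζ : R3 => (symbolK ζ : ℂ) * gaussOsc (Real.pi ^ 2 * 1 ^ 2) z ζ) ε).trans ?_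
  simp [abs_of_pos hε]

/-- The difference between the truncated and the mollified kernel. -/
def kernelDiff (ε : ℝ) (z : R3) : ℂ := (truncK ε z : ℂ) - heatK ε z

theorem measurable_kernelDiff {ε : ℝ} (hε : 0 < ε) : Measurable (kernelDiff ε) := by
  have h1 := measurable_truncK ε
  have h2 := (continuous_heatK hε).measurable
  unfold kernelDiff
  fun_prop

/-- Both kernels scale with homogeneity -3, the regularised one because the symbol has degree zero.
The difference at scale ε is thus the L¹-normalised dilate of the one at scale 1. -/
theorem kernelDiff_smul {ε : ℝ} (hε : 0 < ε) (z : R3) :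
    kernelDiff ε (ε • z) = ((ε ^ 3)⁻¹ : ℝ) * kernelDiff 1 z := by
  unfold kernelDiff
  rw [truncK_smul hε, heatK_smul hε]
  push_cast; ring

/-- The radial factor of `kernelDiff 1`. -/
def radialDiff (r : ℝ) : ℝ :=
  (if 1 < r then (r ^ 5)⁻¹ else 0)
    - ∫ v in Set.Ioi (1 : ℝ), heatWeight v * Real.exp (-(r ^ 2 / v))

theorem kernelDiff_one (z : R3) :
    kernelDiff 1 z = ((dipolePoly z * radialDiff ‖z‖ : ℝ) : ℂ) := by
  unfold kernelDiff radialDiff truncK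
  rw [heatK_one_eq, kernelK_eq]
  split_ifs <;> push_cast <;> ring

/-- Outside the unit ball r⁻⁵ is the integral of the Gaussian weight over (0, ∞), and the
regularised kernel accounts for (1, ∞). Only the part over (0, 1] survives, and it decays fast. -/
theorem abs_radialDiff_le_of_one_lt {r : ℝ} (hr : 1 < r) :
    |radialDiff r| ≤ 4 / (3 * √Real.pi) * 24 / r ^ 8 := by
  have hr0 : 0 < r := by linarith
  have hi := integrableOn_heatWeight_mul_exp hr0
  rw [radialDiff, if_pos hr, ← integral_heatWeight_mul_exp hr0]
  have hu := setIntegral_union (μ := volume) (Set.Ioc_disjoint_Ioi (a := (0 : ℝ)) (le_refl (1 : ℝ)))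
    measurableSet_Ioi (hi.mono_set Set.Ioc_subset_Ioi_self)
    (hi.mono_set (Set.Ioi_subset_Ioi zero_le_one))
  rw [Set.Ioc_union_Ioi_eq_Ioi (zero_le_one' ℝ)] at hu
  rw [hu, add_sub_cancel_right]
  have := norm_setIntegral_le_of_norm_le_const (μ := (volume : Measure ℝ)) (s := Set.Ioc 0 1)
    (f := fun v => heatWeight v * Real.exp (-(r ^ 2 / v)))
    (C := 4 / (3 * √Real.pi) * 24 / r ^ 8) (by simp) (fun v hv => by
      rw [Real.norm_of_nonneg (mul_nonneg (heatWeight_nonneg hv.1.le) (Real.exp_pos _).le)]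
      exact heatWeight_mul_exp_le hr0 hv.1 hv.2)
  simpa using this

theorem abs_radialDiff_le_of_le_one {r : ℝ} (hr : r ≤ 1) :
    |radialDiff r| ≤ ∫ v in Set.Ioi (1 : ℝ), heatWeight v := by
  rw [radialDiff, if_neg (by linarith), zero_sub, abs_neg]
  rw [← Real.norm_eq_abs]
  refine norm_integral_le_of_norm_le integrableOn_heatWeight_Ioi_one ?_
  filter_upwards [ae_restrict_mem measurableSet_Ioi] with v hv
  have hv0 : 0 < v := lt_trans one_pos hv
  have h0 := heatWeight_nonneg hv0.le
  rw [Real.norm_of_nonneg (mul_nonneg h0 (Real.exp_pos _).le)]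
  refine mul_le_of_le_one_right h0 (Real.exp_le_one_iff.mpr ?_)
  have : 0 ≤ r ^ 2 / v := by positivity
  linarith

theorem exists_norm_kernelDiff_one_le :
    ∃ C, 0 ≤ C ∧ ∀ z : R3, ‖kernelDiff 1 z‖ ≤ C * (1 + ‖z‖) ^ (-6 : ℝ) := by
  set I := ∫ v in Set.Ioi (1 : ℝ), heatWeight v
  set c := 4 / (3 * √Real.pi) * 24
  have hc : 0 ≤ c := by positivity
  have hI : 0 ≤ I := setIntegral_nonneg measurableSet_Ioi fun v hv =>
    heatWeight_nonneg (le_trans zero_le_one (le_of_lt hv))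
  -- 128 = 2 · 2⁶: a factor 2 from the bound on the polynomial, and 2⁶ from comparing 1 + |z| with
  -- 2|z| or with 2.
  refine ⟨128 * (I + c), by positivity, fun z => ?_⟩
  have hz := norm_nonneg z
  rw [Real.rpow_neg (by positivity), kernelDiff_one, Complex.norm_real, norm_mul,
    Real.norm_eq_abs, Real.norm_eq_abs,
    show (1 + ‖z‖) ^ (6 : ℝ) = (1 + ‖z‖) ^ (6 : ℕ) by exact_mod_cast Real.rpow_natCast _ 6,
    ← div_eq_mul_inv, le_div_iff₀ (by positivity)]
  have hP := abs_dipolePoly_le z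
  by_cases h : 1 < ‖z‖
  · have h1 := abs_radialDiff_le_of_one_lt h
    have h2 : (1 + ‖z‖) ^ 6 ≤ (2 * ‖z‖) ^ 6 := by gcongr; linarith
    calc |dipolePoly z| * |radialDiff ‖z‖| * (1 + ‖z‖) ^ 6
        ≤ (2 * ‖z‖ ^ 2) * (c / ‖z‖ ^ 8) * (2 * ‖z‖) ^ 6 := by gcongr
      _ = 128 * c := by field_simp; ring
      _ ≤ 128 * (I + c) := by linarith
  · push Not at h
    have h1 := abs_radialDiff_le_of_le_one h
    have h2 : (1 + ‖z‖) ^ 6 ≤ 2 ^ 6 := by gcongr; linarith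
    have h3 : ‖z‖ ^ 2 ≤ 1 := by nlinarith
    calc |dipolePoly z| * |radialDiff ‖z‖| * (1 + ‖z‖) ^ 6
        ≤ 2 * I * 2 ^ 6 := by gcongr; linarith
      _ ≤ 128 * (I + c) := by linarith

theorem integrable_kernelDiff_one : Integrable (kernelDiff 1) := by
  obtain ⟨C, -, hC⟩ := exists_norm_kernelDiff_one_le
  refine ((integrable_one_add_norm (E := R3) (r := 6) (by simp; norm_num)).const_mul C).mono'
    (measurable_kernelDiff one_pos).aestronglyMeasurable (ae_of_all _ hC)

theorem exists_norm_kernelDiff_le {ε : ℝ} (hε : 0 < ε) : ∃ C, ∀ z : R3, ‖kernelDiff ε z‖ ≤ C := by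
  obtain ⟨C, hC0, hC⟩ := exists_norm_kernelDiff_one_le
  refine ⟨(ε ^ 3)⁻¹ * C, fun z => ?_⟩
  have : z = ε • (ε⁻¹ • z) := by rw [smul_smul, mul_inv_cancel₀ hε.ne', one_smul]
  rw [this, kernelDiff_smul hε, norm_mul, Complex.norm_real, Real.norm_of_nonneg (by positivity)]
  gcongr
  refine (hC _).trans (mul_le_of_le_one_right hC0 ?_)
  exact Real.rpow_le_one_of_one_le_of_nonpos (by linarith [norm_nonneg (ε⁻¹ • z)]) (by norm_num)

/-- The cyclic permutation of the coordinates. -/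
def cycle3 : R3 ≃ₗᵢ[ℝ] R3 := LinearIsometryEquiv.piLpCongrLeft 2 ℝ ℝ (finRotate 3)

theorem dipolePoly_add_cycle (z : R3) :
    dipolePoly z + dipolePoly (cycle3 z) + dipolePoly (cycle3 (cycle3 z)) = 0 := by
  have h0 : (finRotate 3).symm 0 = 2 := by decide
  have h1 : (finRotate 3).symm 1 = 0 := by decide
  have h2 : (finRotate 3).symm 2 = 1 := by decide
  have e : ∀ (w : R3) (i : Fin 3), cycle3 w i = w ((finRotate 3).symm i) := fun w i => rfl
  simp only [dipolePoly, e, h0, h1, h2]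
  ring

theorem integral_comp_cycle3 (F : R3 → ℂ) : ∫ z, F (cycle3 z) = ∫ z, F z :=
  cycle3.measurePreserving.integral_comp cycle3.toHomeomorph.measurableEmbedding F

/-- The kernel is the dipole polynomial times a radial function. The polynomial averages to zero
over the three cyclic permutations of the coordinates, which preserve both measure and norm. -/
theorem integral_kernelDiff_one : ∫ z, kernelDiff 1 z = 0 := by
  have hi := integrable_kernelDiff_one
  have hi1 : Integrable fun z => kernelDiff 1 (cycle3 z) :=
    cycle3.measurePreserving.integrable_comp_of_integrable hi
  have hi2 : Integrable fun z => kernelDiff 1 (cycle3 (cycle3 z)) :=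
    cycle3.measurePreserving.integrable_comp_of_integrable hi1
  have h : ∫ z, (kernelDiff 1 z + kernelDiff 1 (cycle3 z) + kernelDiff 1 (cycle3 (cycle3 z))) = 0 := by
    have : (fun z => kernelDiff 1 z + kernelDiff 1 (cycle3 z) + kernelDiff 1 (cycle3 (cycle3 z)))
        = fun _ => 0 := by
      ext z
      simp only [kernelDiff_one, LinearIsometryEquiv.norm_map]
      rw [← Complex.ofReal_add, ← Complex.ofReal_add, ← add_mul, ← add_mul, dipolePoly_add_cycle]
      simp
    rw [this]; simp
  rw [integral_add (hi.fun_add hi1) hi2, integral_add hi hi1,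
    integral_comp_cycle3 (fun z => kernelDiff 1 (cycle3 z)), integral_comp_cycle3] at h
  linear_combination h / 3

/-! ### From kernels to multipliers: passage to the limit in the truncation -/

/-- Translation by x becomes a modulation of h. The flip formula then moves the Fourier transform
onto f, so convolution with the transform of an integrable h acts as a multiplier. -/
theorem integral_fourier_sub_mul (h f : R3 → ℂ) (hh : Integrable h) (hf : Integrable f) (x : R3) :
    ∫ y, 𝓕 h (-(x - y)) * f y
      = ∫ ξ, Complex.exp (2 * Real.pi * Complex.I * (inner ℝ x ξ : ℝ)) * (h ξ * 𝓕 f ξ) := by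
  set e : R3 → ℂ := fun ξ => Complex.exp (2 * Real.pi * Complex.I * (inner ℝ x ξ : ℝ)) with he
  have hn : ∀ ξ, ‖e ξ‖ = 1 := fun ξ => by
    simp only [he]
    rw [show (2 * Real.pi * Complex.I * (inner ℝ x ξ : ℝ) : ℂ)
      = ((2 * Real.pi * inner ℝ x ξ : ℝ) : ℂ) * Complex.I by push_cast; ring]
    exact Complex.norm_exp_ofReal_mul_I _
  have hc : Continuous e := by rw [he]; fun_prop
  have hi : Integrable fun ξ => e ξ * h ξ := by
    refine hh.norm.mono' (hc.aestronglyMeasurable.mul hh.1) (ae_of_all _ fun ξ => ?_)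
    rw [norm_mul, hn, one_mul]
  have hF : ∀ y, 𝓕 h (-(x - y)) = 𝓕 (fun ξ => e ξ * h ξ) y := by
    intro y
    rw [Real.fourier_eq', Real.fourier_eq']
    congr 1; ext ξ
    rw [smul_eq_mul, smul_eq_mul, ← mul_assoc, he]
    simp only
    rw [← Complex.exp_add]
    congr 2
    rw [neg_sub, inner_sub_right, real_inner_comm x ξ]
    push_cast; ring
  simp_rw [hF]
  rw [integral_fourier_mul_eq_flip hi hf]
  congr 1; ext ξ; ring

theorem integrable_star {F : R3 → ℂ} (hF : Integrable F) : Integrable fun ξ => star (F ξ) :=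
  hF.norm.mono' (continuous_star.comp_aestronglyMeasurable hF.1) (ae_of_all _ fun ξ => by simp)

theorem integral_exp_mul_star (F : R3 → ℂ) (hF : Integrable F) (g : R3 → ℂ) (hg : Integrable g) :
    ∫ x, (∫ ξ, Complex.exp (2 * Real.pi * Complex.I * (inner ℝ x ξ : ℝ)) * F ξ) * star (g x)
      = ∫ ξ, F ξ * star (𝓕 g ξ) := by
  have e1 : ∀ x, ∫ ξ, Complex.exp (2 * Real.pi * Complex.I * (inner ℝ x ξ : ℝ)) * F ξ
      = star (𝓕 (fun ξ => star (F ξ)) x) := by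
    intro x
    rw [Real.fourier_eq', Complex.star_def, ← integral_conj]
    congr 1; ext ξ
    rw [smul_eq_mul, map_mul, Complex.conj_conj, ← Complex.exp_conj,
      real_inner_comm]
    congr 2
    rw [map_mul, Complex.conj_ofReal, Complex.conj_I]
    push_cast
    ring
  simp_rw [e1]
  have h := congrArg (starRingEnd ℂ) (integral_fourier_mul_eq_flip (integrable_star hF) hg)
  rw [← integral_conj, ← integral_conj] at h
  refine Eq.trans ?_ (h.trans ?_) <;> congr 1 <;> ext x <;> simp

theorem integral_kernelDiff_sub {ε : ℝ} (hε : 0 < ε) (g : R3 → ℂ) (y : R3) :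
    ∫ x, kernelDiff ε (x - y) * g x = ∫ z, kernelDiff 1 z * g (y + ε • z) := by
  have h1 : ∫ x, kernelDiff ε (x - y) * g x = ∫ w, kernelDiff ε w * g (y + w) := by
    rw [← integral_sub_right_eq_self (fun w => kernelDiff ε w * g (y + w)) y]
    simp
  have h2 := Measure.integral_comp_smul (volume : Measure R3)
    (fun w : R3 => kernelDiff ε w * g (y + w)) ε
  simp only [kernelDiff_smul hε, finrank_euclideanSpace, Fintype.card_fin, mul_assoc] at h2
  rw [integral_const_mul] at h2
  rw [h1]
  have h3 : (0 : ℝ) < (ε ^ 3)⁻¹ := by positivity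
  rw [abs_of_pos h3, Complex.real_smul] at h2
  exact (mul_left_cancel₀ (by exact_mod_cast h3.ne') h2).symm

/-- The error kernels form an approximate identity of total mass zero. After Fubini and rescaling,
the inner integral tends to g(y) times the mean of `kernelDiff 1`, by dominated convergence. -/
theorem tendsto_integral_kernelDiff (f : R3 → ℂ) (hf : Integrable f) (g : 𝓢(R3, ℂ)) :
    Tendsto (fun ε : ℝ => ∫ x, (∫ y, kernelDiff ε (x - y) * f y) * g x) (𝓝[>] 0) (𝓝 0) := by
  obtain ⟨M, hM⟩ : ∃ M, ∀ x, ‖g x‖ ≤ M :=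
    ⟨_, fun x => SchwartzMap.norm_le_seminorm ℝ g x⟩
  have hM0 : 0 ≤ M := (norm_nonneg _).trans (hM 0)
  have hD := integrable_kernelDiff_one
  have key : ∀ ε : ℝ, 0 < ε → ∫ x, (∫ y, kernelDiff ε (x - y) * f y) * g x
      = ∫ y, f y * ∫ z, kernelDiff 1 z * g (y + ε • z) := by
    intro ε hε
    obtain ⟨C, hC⟩ := exists_norm_kernelDiff_le hε
    have hm := measurable_kernelDiff hε
    have hprod : Integrable (Function.uncurry fun x y => kernelDiff ε (x - y) * f y * g x)
        (volume.prod volume) := by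
      have h1 : Integrable (fun p : R3 × R3 => g p.1 * f p.2) (volume.prod volume) :=
        g.integrable.mul_prod hf
      refine (h1.norm.const_mul C).mono' ?_ (ae_of_all _ fun p => ?_)
      · refine AEStronglyMeasurable.mul (AEStronglyMeasurable.mul ?_ ?_) ?_
        · exact (hm.comp (measurable_fst.sub measurable_snd)).aestronglyMeasurable
        · exact hf.1.comp_snd
        · exact g.continuous.aestronglyMeasurable.comp_fst
      · simp only [Function.uncurry, norm_mul]
        calc _ ≤ C * ‖f p.2‖ * ‖g p.1‖ := by gcongr; exact hC _
          _ = _ := by ring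
    simp_rw [← integral_mul_const]
    rw [integral_integral_swap hprod]
    congr 1; ext y
    rw [← integral_kernelDiff_sub hε, ← integral_const_mul]
    congr 1; ext x; ring
  have h0 : (0 : ℂ) = ∫ y, f y * ∫ z, kernelDiff 1 z * g y := by
    simp_rw [integral_mul_const, integral_kernelDiff_one]
    simp
  rw [h0]
  have hI : Tendsto (fun ε : ℝ => ∫ y, f y * ∫ z, kernelDiff 1 z * g (y + ε • z)) (𝓝[>] 0)
      (𝓝 (∫ y, f y * ∫ z, kernelDiff 1 z * g y)) := by
    refine tendsto_integral_filter_of_dominated_convergence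
      (fun y => ‖f y‖ * ((∫ z, ‖kernelDiff 1 z‖) * M)) ?_ ?_ ?_ ?_
    · refine Eventually.of_forall fun ε => hf.1.mul ?_
      refine AEStronglyMeasurable.integral_prod_right'
        (f := fun p : R3 × R3 => kernelDiff 1 p.2 * g (p.1 + ε • p.2)) ?_
      have := (measurable_kernelDiff one_pos)
      have := g.continuous
      exact (by fun_prop : Measurable _).aestronglyMeasurable
    · refine Eventually.of_forall fun ε => ae_of_all _ fun y => ?_
      rw [norm_mul, ← integral_mul_const]
      gcongr
      refine norm_integral_le_of_norm_le (hD.norm.mul_const M) (ae_of_all _ fun z => ?_)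
      rw [norm_mul]
      gcongr
      exact hM _
    · exact hf.norm.mul_const _
    · refine ae_of_all _ fun y => Tendsto.const_mul _ ?_
      refine tendsto_integral_filter_of_dominated_convergence
        (fun z => ‖kernelDiff 1 z‖ * M) ?_ ?_ (hD.norm.mul_const M) ?_
      · refine Eventually.of_forall fun ε => ?_
        have := g.continuous
        exact hD.1.mul (by fun_prop : Continuous fun z => g (y + ε • z)).aestronglyMeasurable
      · refine Eventually.of_forall fun ε => ae_of_all _ fun z => ?_
        rw [norm_mul]
        gcongr
        exact hM _
      · refine ae_of_all _ fun z => Tendsto.const_mul _ ?_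
        have hc : Continuous fun ε : ℝ => g (y + ε • z) := by
          have := g.continuous
          fun_prop
        have := hc.tendsto 0
        simp only [zero_smul, add_zero] at this
        exact this.mono_left nhdsWithin_le_nhds
  refine hI.congr' ?_
  filter_upwards [self_mem_nhdsWithin] with ε hε
  exact (key ε hε).symm

theorem norm_fourier_le {f : R3 → ℂ} (ξ : R3) : ‖𝓕 f ξ‖ ≤ ∫ x, ‖f x‖ :=
  VectorFourier.norm_fourierIntegral_le_integral_norm _ _ _ _ _

theorem integrable_mul_fourier {h f : R3 → ℂ} (hh : Integrable h) (hf : Integrable f) :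
    Integrable fun ξ => h ξ * 𝓕 f ξ := by
  refine (hh.norm.mul_const (∫ x, ‖f x‖)).mono'
    (hh.1.mul (continuous_fourier hf).aestronglyMeasurable) (ae_of_all _ fun ξ => ?_)
  rw [norm_mul]
  gcongr
  exact norm_fourier_le ξ

/-- Splits the truncation into the error kernel, which vanishes weakly, and the regularised kernel,
which is a multiplier with integrable symbol. -/
theorem truncConvK_eq_add {ε : ℝ} (hε : 0 < ε) {f : R3 → ℝ} (hf : Integrable f) (x : R3) :
    (truncConvK ε f x : ℂ) = (∫ y, kernelDiff ε (x - y) * (f y : ℂ))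
      + ∫ ξ, Complex.exp (2 * Real.pi * Complex.I * (inner ℝ x ξ : ℝ))
          * (symbolHeat ε ξ * 𝓕 (fun y => (f y : ℂ)) ξ) := by
  have hfc : Integrable fun y => (f y : ℂ) := hf.ofReal
  obtain ⟨C, hC⟩ := exists_norm_kernelDiff_le hε
  rw [← integral_fourier_sub_mul _ _ (integrable_symbolHeat hε) hfc, truncConvK_eq,
    ← integral_complex_ofReal, ← integral_add]
  · congr 1; ext y
    rw [← heatK_eq_fourier, kernelDiff]
    push_cast; ring
  · refine hfc.bdd_mul (c := C)
      ((measurable_kernelDiff hε).comp (measurable_const.sub measurable_id)).aestronglyMeasurable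
      (ae_of_all _ fun y => hC _)
  · refine hfc.bdd_mul (c := ∫ ξ, ‖symbolHeat ε ξ‖) ?_ (ae_of_all _ fun y => norm_fourier_le _)
    have := continuous_fourier (integrable_symbolHeat hε)
    exact (by fun_prop : Continuous fun y => 𝓕 (symbolHeat ε) (-(x - y))).aestronglyMeasurable

theorem aestronglyMeasurable_truncConvK (ε : ℝ) {f : R3 → ℝ} (hf : Integrable f) :
    AEStronglyMeasurable (truncConvK ε f) volume := by
  have : truncConvK ε f = fun x => ∫ y, truncK ε (x - y) * f y := funext (truncConvK_eq ε f)
  rw [this]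
  refine AEStronglyMeasurable.integral_prod_right'
    (f := fun p : R3 × R3 => truncK ε (p.1 - p.2) * f p.2) ?_
  refine AEStronglyMeasurable.mul ?_ hf.1.comp_snd
  exact ((measurable_truncK ε).comp (measurable_fst.sub measurable_snd)).aestronglyMeasurable

theorem tendsto_integral_symbolHeat (F : R3 → ℂ) (hF : Integrable F) :
    Tendsto (fun ε : ℝ => ∫ ξ, symbolHeat ε ξ * F ξ) (𝓝[>] 0)
      (𝓝 (∫ ξ, (symbolK ξ : ℂ) * F ξ)) := by
  refine tendsto_integral_filter_of_dominated_convergence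
    (fun ξ => 8 * Real.pi / 3 * ‖F ξ‖) ?_ ?_ (hF.norm.const_mul _) ?_
  · refine Eventually.of_forall fun ε => AEStronglyMeasurable.mul ?_ hF.1
    have := measurable_symbolK
    unfold symbolHeat
    exact (by fun_prop : Measurable _).aestronglyMeasurable
  · refine Eventually.of_forall fun ε => ae_of_all _ fun ξ => ?_
    rw [norm_mul, symbolHeat, Complex.norm_real, norm_mul, Real.norm_eq_abs, Real.norm_eq_abs,
      Real.abs_exp]
    gcongr
    have h1 := abs_symbolK_le ξ
    have h2 : Real.exp (-(Real.pi ^ 2 * ε ^ 2) * ‖ξ‖ ^ 2) ≤ 1 := by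
      rw [Real.exp_le_one_iff]
      have : 0 ≤ Real.pi ^ 2 * ε ^ 2 * ‖ξ‖ ^ 2 := by positivity
      linarith
    calc _ ≤ 8 * Real.pi / 3 * 1 := by gcongr
      _ = _ := by ring
  · refine ae_of_all _ fun ξ => Tendsto.mul_const _ ?_
    have hc : Continuous fun ε : ℝ => symbolHeat ε ξ := by unfold symbolHeat; fun_prop
    have := hc.tendsto 0
    simp only [symbolHeat] at this ⊢
    simp only [ne_eq, OfNat.ofNat_ne_zero, not_false_eq_true, zero_pow, mul_zero, neg_zero,
      zero_mul, Real.exp_zero, mul_one] at this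
    exact this.mono_left nhdsWithin_le_nhds

/-- The pairings of the truncated convolutions with g have two limits: one by L² convergence to W,
the other by splitting the kernel. Uniqueness of limits identifies them. -/
theorem isConvK_pairing_schwartz {f W : R3 → ℝ} (hf : Integrable f) (hW : IsConvK f W)
    (g : 𝓢(R3, ℂ)) :
    ∫ x, (W x : ℂ) * star (g x)
      = ∫ ξ, (symbolK ξ : ℂ) * (𝓕 (fun y => (f y : ℂ)) ξ * star (𝓕 g ξ)) := by
  have hfc : Integrable fun y => (f y : ℂ) := hf.ofReal
  have hg2 : MemLp g 2 := g.memLp 2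
  have hgs2 : MemLp (fun x => star (g x)) 2 :=
    hg2.of_le (continuous_star.comp_aestronglyMeasurable hg2.1) (ae_of_all _ fun x => by simp)
  let gs : 𝓢(R3, ℂ) := SchwartzMap.postcompCLM ((Complex.conjCLE : ℂ ≃L[ℝ] ℂ) : ℂ →L[ℝ] ℂ) g
  have hgs : ∀ x, gs x = star (g x) := fun x => by simp [gs]
  set T := fun ε : ℝ => ∫ x, (truncConvK ε f x : ℂ) * star (g x) with hT
  have hlim1 : Tendsto T (𝓝[>] 0) (𝓝 (∫ x, (W x : ℂ) * star (g x))) := by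
    rw [tendsto_iff_norm_sub_tendsto_zero]
    have hz : Tendsto (fun ε : ℝ =>
        (eLpNorm (fun x => truncConvK ε f x - W x) 2 volume).toReal * l2norm g) (𝓝[>] 0) (𝓝 0) := by
      have := ((ENNReal.tendsto_toReal (by simp)).comp hW.2).mul_const (l2norm g)
      simpa using this
    refine squeeze_zero' (Eventually.of_forall fun _ => norm_nonneg _) ?_ hz
    -- The truncated convolutions are not assumed to be in L²; for small ε this follows from their
    -- finite distance to W.
    have hfin : ∀ᶠ ε in 𝓝[>] (0 : ℝ),
        eLpNorm (fun x => truncConvK ε f x - W x) 2 volume < 1 :=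
      hW.2.eventually (gt_mem_nhds (by simp))
    filter_upwards [hfin] with ε hε
    have hd : MemLp (fun x => truncConvK ε f x - W x) 2 :=
      ⟨(aestronglyMeasurable_truncConvK ε hf).sub hW.1.1, hε.trans (by simp)⟩
    have ht : MemLp (fun x => truncConvK ε f x) 2 := by
      have := hd.add hW.1
      refine this.ae_eq (ae_of_all _ fun x => ?_)
      simp
    have i1 : Integrable fun x => (truncConvK ε f x : ℂ) * star (g x) :=
      integrable_of_norm_le_mul ht hg2 (ht.ofReal.1.mul hgs2.1)
        (ae_of_all _ fun x => by simp)
    have i2 : Integrable fun x => (W x : ℂ) * star (g x) :=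
      integrable_of_norm_le_mul hW.1 hg2 (hW.1.ofReal.1.mul hgs2.1)
        (ae_of_all _ fun x => by simp)
    rw [hT]
    simp only
    rw [← integral_sub i1 i2, ← l2norm_eq_toReal hd.1]
    refine norm_integral_le_l2norm_mul hd hg2 (ae_of_all _ fun x => ?_)
    rw [← sub_mul, ← Complex.ofReal_sub, norm_mul, Complex.norm_real, norm_star]
  have hlim2 : Tendsto T (𝓝[>] 0)
      (𝓝 (0 + ∫ ξ, (symbolK ξ : ℂ) * (𝓕 (fun y => (f y : ℂ)) ξ * star (𝓕 g ξ)))) := by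
    have hF : Integrable fun ξ => 𝓕 (fun y => (f y : ℂ)) ξ * star (𝓕 g ξ) := by
      refine (integrable_mul_fourier (integrable_star (𝓕 g).integrable) hfc).congr
        (ae_of_all _ fun ξ => ?_)
      simp only; ring
    have h := (tendsto_integral_kernelDiff _ hfc gs).add (tendsto_integral_symbolHeat _ hF)
    refine h.congr' ?_
    filter_upwards [self_mem_nhdsWithin] with ε hε
    have hε : 0 < ε := hε
    have hhf := integrable_mul_fourier (integrable_symbolHeat hε) hfc
    rw [hT]
    simp only
    simp_rw [truncConvK_eq_add hε hf, add_mul, hgs]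
    obtain ⟨C, hC⟩ := exists_norm_kernelDiff_le hε
    have hstar : Integrable fun x => star (g x) := integrable_star g.integrable
    rw [integral_add]
    · rw [integral_exp_mul_star _ hhf _ g.integrable]
      congr 2; ext ξ
      rw [SchwartzMap.fourier_coe]; ring
    · refine hstar.bdd_mul (c := C * ∫ y, ‖f y‖) ?_ (ae_of_all _ fun x => ?_)
      · refine AEStronglyMeasurable.integral_prod_right'
          (f := fun p : R3 × R3 => kernelDiff ε (p.1 - p.2) * (f p.2 : ℂ)) ?_
        refine AEStronglyMeasurable.mul ?_ hfc.1.comp_snd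
        exact ((measurable_kernelDiff hε).comp
          (measurable_fst.sub measurable_snd)).aestronglyMeasurable
      · rw [← integral_const_mul]
        refine norm_integral_le_of_norm_le (hf.norm.const_mul C) (ae_of_all _ fun y => ?_)
        rw [norm_mul, Complex.norm_real]
        gcongr
        exact hC _
    · refine hstar.bdd_mul (c := ∫ ξ, ‖symbolHeat ε ξ * 𝓕 (fun y => (f y : ℂ)) ξ‖) ?_
        (ae_of_all _ fun x => ?_)
      · refine AEStronglyMeasurable.integral_prod_right' (f := fun p : R3 × R3 =>
          Complex.exp (2 * Real.pi * Complex.I * (inner ℝ p.1 p.2 : ℝ))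
            * (symbolHeat ε p.2 * 𝓕 (fun y => (f y : ℂ)) p.2)) ?_
        refine AEStronglyMeasurable.mul ?_ hhf.1.comp_snd
        exact (by fun_prop : Continuous fun p : R3 × R3 =>
          Complex.exp (2 * Real.pi * Complex.I * (inner ℝ p.1 p.2 : ℝ))).aestronglyMeasurable
      · refine norm_integral_le_of_norm_le hhf.norm (ae_of_all _ fun ξ => ?_)
        rw [norm_mul, show (2 * Real.pi * Complex.I * (inner ℝ x ξ : ℝ) : ℂ)
          = ((2 * Real.pi * inner ℝ x ξ : ℝ) : ℂ) * Complex.I by push_cast; ring,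
          Complex.norm_exp_ofReal_mul_I, one_mul]
  rw [zero_add] at hlim2
  exact tendsto_nhds_unique hlim1 hlim2

/-- The principal value convolution with `K` is the Fourier multiplier with symbol `K̂`. -/
theorem isConvK_pairing {f W : R3 → ℝ} (hf : Integrable f) (hf2 : MemLp f 2) (hW : IsConvK f W)
    {g : R3 → ℂ} (hg : MemLp g 2) :
    ∫ x, (W x : ℂ) * star (g x)
      = ∫ ξ, (symbolK ξ : ℂ) * (ft2 (fun y => (f y : ℂ)) ξ * star (ft2 g ξ)) := by
  have hfc : Integrable fun y => (f y : ℂ) := hf.ofReal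
  have hWc : MemLp (fun x => (W x : ℂ)) 2 := hW.1.ofReal
  have hM : MemLp (fun ξ => (symbolK ξ : ℂ) * ft2 (fun y => (f y : ℂ)) ξ) 2 := by
    have h1 := memLp_ft2 (u := fun y => (f y : ℂ)) hf2.ofReal
    have := measurable_symbolK
    refine h1.of_le_mul (c := 8 * Real.pi / 3)
      ((by fun_prop : Measurable fun ξ => (symbolK ξ : ℂ)).aestronglyMeasurable.mul h1.1)
      (ae_of_all _ fun ξ => ?_)
    rw [norm_mul, Complex.norm_real]
    gcongr
    exact abs_symbolK_le ξ
  -- Both sides are continuous in G, so the Schwartz case suffices by density.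
  have key : ∀ G : Lp ℂ 2 (volume : Measure R3),
      inner ℂ G (hWc.toLp _) = inner ℂ (𝓕 G) (hM.toLp _) := by
    intro G
    refine DenseRange.induction_on
      (p := fun G => inner ℂ G (hWc.toLp _) = inner ℂ (𝓕 G) (hM.toLp _))
      (SchwartzMap.denseRange_toLpCLM (p := 2) ENNReal.ofNat_ne_top) G
      (isClosed_eq (by fun_prop) ?_) fun g => ?_
    · have : Continuous fun G : Lp ℂ 2 (volume : Measure R3) => 𝓕 G :=
        (Lp.fourierTransformₗᵢ R3 ℂ).continuous
      fun_prop
    · rw [SchwartzMap.toLpCLM_apply, SchwartzMap.toLp_fourier_eq, L2.inner_def, L2.inner_def]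
      have h := isConvK_pairing_schwartz hf hW g
      convert h using 1
      · apply integral_congr_ae
        filter_upwards [hWc.coeFn_toLp, g.coeFn_toLp 2] with x h1 h2
        rw [h1, h2]
        rfl
      · apply integral_congr_ae
        filter_upwards [hM.coeFn_toLp, (𝓕 g).coeFn_toLp 2,
          ft2_ae_eq_fourier hfc hf2.ofReal] with ξ h1 h2 h3
        rw [h1, h2, h3]
        simp only [RCLike.inner_apply, Complex.star_def]
        ring
  have h := key (hg.toLp g)
  rw [← toLp_ft2 hg, L2.inner_def, L2.inner_def] at h
  convert h using 1
  · apply integral_congr_ae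
    filter_upwards [hWc.coeFn_toLp, hg.coeFn_toLp] with x h1 h2
    rw [h1, h2]
    rfl
  · apply integral_congr_ae
    filter_upwards [hM.coeFn_toLp, (memLp_ft2 hg).coeFn_toLp] with ξ h1 h2
    rw [h1, h2]
    simp only [RCLike.inner_apply, Complex.star_def]
    ring

end DipolarGPE

end

noncomputable section

namespace DipolarGPE

open FourierTransform SchwartzMap LineDeriv

/-! ### Cutoff functions -/

/-- The standard basis vectors of `ℝ³`. -/
abbrev e3 (i : Fin 3) : R3 := EuclideanSpace.single i 1

/-- A smooth bump equal to `1` on the unit ball and supported in the ball of radius `2`. -/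
def bump : ContDiffBump (0 : R3) := ⟨1, 2, one_pos, one_lt_two⟩

/-- The rescaled bump `x ↦ bump (x / R)`. -/
def cutoff (R : ℝ) (x : R3) : ℝ := bump (R⁻¹ • x)

theorem contDiff_cutoff (R : ℝ) : ContDiff ℝ ∞ (cutoff R) :=
  bump.contDiff.comp (contDiff_const_smul _)

theorem hasCompactSupport_cutoff {R : ℝ} (hR : 0 < R) : HasCompactSupport (cutoff R) :=
  bump.hasCompactSupport.comp_smul (inv_ne_zero hR.ne')

theorem cutoff_nonneg (R : ℝ) (x : R3) : 0 ≤ cutoff R x := bump.nonneg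

theorem cutoff_le_one (R : ℝ) (x : R3) : cutoff R x ≤ 1 := bump.le_one

theorem abs_cutoff_le_one (R : ℝ) (x : R3) : |cutoff R x| ≤ 1 := by
  rw [abs_of_nonneg (cutoff_nonneg R x)]; exact cutoff_le_one R x

theorem cutoff_eq_one {R : ℝ} (hR : 0 < R) {x : R3} (hx : ‖x‖ ≤ R) : cutoff R x = 1 := by
  apply bump.one_of_mem_closedBall
  rw [mem_closedBall_zero_iff, norm_smul, norm_inv, Real.norm_of_nonneg hR.le,
    inv_mul_le_iff₀ hR]
  simpa [bump] using hx

theorem fderiv_cutoff (R : ℝ) (x v : R3) :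
    fderiv ℝ (cutoff R) x v = R⁻¹ * fderiv ℝ bump (R⁻¹ • x) v := by
  have h : HasFDerivAt (cutoff R) ((fderiv ℝ bump (R⁻¹ • x)).comp
      (R⁻¹ • ContinuousLinearMap.id ℝ R3)) x :=
    HasFDerivAt.comp x (g := bump) ((bump.contDiff (n := 1)).differentiable
      one_ne_zero _).hasFDerivAt ((hasFDerivAt_id x).const_smul R⁻¹)
  rw [h.fderiv]
  simp

theorem fderiv_cutoff_eq_zero {R : ℝ} (hR : 0 < R) {x : R3} (hx : ‖x‖ < R) :
    fderiv ℝ (cutoff R) x = 0 := by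
  have : cutoff R =ᶠ[𝓝 x] fun _ => 1 := by
    filter_upwards [Metric.isOpen_ball.mem_nhds (mem_ball_zero_iff.mpr hx)] with y hy
    exact cutoff_eq_one hR (mem_ball_zero_iff.mp hy).le
  rw [this.fderiv_eq, fderiv_fun_const]
  rfl

/-- A bound for `|x| |∇ bump|` and `|∇ bump|`. -/
theorem exists_bump_bound : ∃ C : ℝ, 0 ≤ C ∧ ∀ x v : R3,
    |fderiv ℝ bump x v| ≤ C * ‖v‖ ∧ ‖x‖ * |fderiv ℝ bump x v| ≤ C * ‖v‖ := by
  have hc : Continuous (fderiv ℝ bump) := (bump.contDiff (n := 1)).continuous_fderiv one_ne_zero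
  have hs : HasCompactSupport (fderiv ℝ bump) := bump.hasCompactSupport.fderiv (𝕜 := ℝ)
  obtain ⟨C₁, h₁⟩ := hs.exists_bound_of_continuous hc
  have hs' : HasCompactSupport fun x => ‖x‖ • fderiv ℝ bump x := hs.smul_left (f := fun x => ‖x‖)
  obtain ⟨C₂, h₂⟩ := hs'.exists_bound_of_continuous (continuous_norm.smul hc)
  have h0 : 0 ≤ max C₁ C₂ := le_max_of_le_left ((norm_nonneg _).trans (h₁ 0))
  refine ⟨max C₁ C₂, h0, fun x v => ⟨?_, ?_⟩⟩
  · rw [← Real.norm_eq_abs]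
    exact (ContinuousLinearMap.le_of_opNorm_le _ ((h₁ x).trans (le_max_left _ _)) v)
  · have := ContinuousLinearMap.le_of_opNorm_le _ ((h₂ x).trans (le_max_right C₁ C₂)) v
    simpa [norm_smul] using this

/-- The quantity |x||∇χ(x/R)| is invariant under scaling. Its bound is what keeps the derivatives of
the field χ(x/R) x bounded as R grows. -/
theorem exists_fderiv_cutoff_bound : ∃ C : ℝ, 0 ≤ C ∧ ∀ R : ℝ, 1 ≤ R → ∀ x v : R3,
    |fderiv ℝ (cutoff R) x v| ≤ C * ‖v‖ ∧ ‖x‖ * |fderiv ℝ (cutoff R) x v| ≤ C * ‖v‖ := by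
  obtain ⟨C, hC, h⟩ := exists_bump_bound
  refine ⟨C, hC, fun R hR x v => ?_⟩
  have hR0 : 0 < R := by linarith
  have hi : R⁻¹ ≤ 1 := inv_le_one_of_one_le₀ hR
  obtain ⟨h1, h2⟩ := h (R⁻¹ • x) v
  rw [norm_smul, norm_inv, Real.norm_of_nonneg hR0.le] at h2
  rw [fderiv_cutoff, abs_mul, abs_of_pos (inv_pos.mpr hR0)]
  refine ⟨(mul_le_of_le_one_left (abs_nonneg _) hi).trans h1, le_trans (le_of_eq (by ring)) h2⟩

theorem tendsto_cutoff (x : R3) : Tendsto (fun R => cutoff R x) atTop (𝓝 1) := by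
  refine tendsto_const_nhds.congr' ?_
  filter_upwards [eventually_gt_atTop 0, eventually_ge_atTop ‖x‖] with R h0 h1
  exact (cutoff_eq_one h0 h1).symm

theorem tendsto_fderiv_cutoff (x v : R3) :
    Tendsto (fun R => fderiv ℝ (cutoff R) x v) atTop (𝓝 0) := by
  refine tendsto_const_nhds.congr' ?_
  filter_upwards [eventually_gt_atTop 0, eventually_gt_atTop ‖x‖] with R h0 h1
  rw [fderiv_cutoff_eq_zero h0 h1]; simp

/-! ### Weak derivatives against Schwartz functions -/

/-- Weak derivatives are defined by compactly supported test functions. Multiplying a Schwartz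
function by cutoffs of growing radius and using dominated convergence extends the class of test
functions. -/
theorem HasWeakPartial.integral_real_schwartz {i : Fin 3} {u g : R3 → ℂ} (hu : MemLp u 2)
    (hg : MemLp g 2) (h : HasWeakPartial i u g) (φ : 𝓢(R3, ℝ)) :
    ∫ x, ∂_{e3 i} φ x • u x = - ∫ x, φ x • g x := by
  obtain ⟨C, hC, hb⟩ := exists_fderiv_cutoff_bound
  have hprod : ∀ R x, fderiv ℝ (fun x => cutoff R x * φ x) x (e3 i)
      = cutoff R x * ∂_{e3 i} φ x + φ x * fderiv ℝ (cutoff R) x (e3 i) := by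
    intro R x
    rw [fderiv_fun_mul ((contDiff_cutoff R).differentiable (by simp) x) φ.differentiableAt]
    simp [lineDerivOp_apply_eq_fderiv]
  have h1 : Tendsto (fun R => ∫ x, (fderiv ℝ (fun x => cutoff R x * φ x) x (e3 i)) • u x) atTop
      (𝓝 (∫ x, ∂_{e3 i} φ x • u x)) := by
    refine tendsto_integral_filter_of_dominated_convergence
      (fun x => ‖∂_{e3 i} φ x‖ * ‖u x‖ + C * (‖φ x‖ * ‖u x‖)) ?_ ?_ ?_ ?_
    · refine Eventually.of_forall fun R => ?_
      simp_rw [hprod]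
      have := (contDiff_cutoff R).continuous
      have h2 := (contDiff_cutoff R).continuous_fderiv_apply (by simp)
      have h3 := h2.comp (continuous_id.prodMk (continuous_const (y := e3 i)))
      exact ((this.mul (∂_{e3 i} φ).continuous).add
        (φ.continuous.mul h3)).aestronglyMeasurable.smul hu.1
    · filter_upwards [eventually_ge_atTop 1] with R hR
      refine ae_of_all _ fun x => ?_
      rw [hprod, norm_smul, ← mul_assoc, ← add_mul]
      gcongr
      refine (norm_add_le _ _).trans ?_
      rw [norm_mul, norm_mul]
      refine add_le_add ?_ ?_
      · exact mul_le_of_le_one_left (norm_nonneg _) (abs_cutoff_le_one R x)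
      · rw [mul_comm]
        refine mul_le_mul_of_nonneg_right ?_ (norm_nonneg _)
        simpa using (hb R hR x (e3 i)).1
    · exact (integrable_norm_mul_norm ((∂_{e3 i} φ).memLp 2) hu).add
        ((integrable_norm_mul_norm (φ.memLp 2) hu).const_mul C)
    · refine ae_of_all _ fun x => ?_
      simp_rw [hprod]
      have := ((tendsto_cutoff x).mul_const (∂_{e3 i} φ x)).add
        ((tendsto_fderiv_cutoff x (e3 i)).const_mul (φ x))
      simpa using this.smul_const (u x)
  have h2 : Tendsto (fun R => - ∫ x, (cutoff R x * φ x) • g x) atTop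
      (𝓝 (-∫ x, φ x • g x)) := by
    refine (tendsto_integral_filter_of_dominated_convergence
      (fun x => ‖φ x‖ * ‖g x‖) ?_ ?_ ?_ ?_).neg
    · refine Eventually.of_forall fun R => ?_
      have := (contDiff_cutoff R).continuous
      exact (this.mul φ.continuous).aestronglyMeasurable.smul hg.1
    · refine Eventually.of_forall fun R => ae_of_all _ fun x => ?_
      rw [norm_smul, norm_mul]
      gcongr
      exact mul_le_of_le_one_left (norm_nonneg _) (abs_cutoff_le_one R x)
    · exact integrable_norm_mul_norm (φ.memLp 2) hg
    · refine ae_of_all _ fun x => ?_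
      simpa using ((tendsto_cutoff x).mul_const (φ x)).smul_const (g x)
  refine tendsto_nhds_unique_of_eventuallyEq h1 h2 ?_
  filter_upwards [eventually_gt_atTop 0] with R hR
  exact h _ ((contDiff_cutoff R).mul (φ.smooth ⊤)) ((hasCompactSupport_cutoff hR).mul_right)

theorem HasWeakPartial.integral_schwartz {i : Fin 3} {u g : R3 → ℂ} (hu : MemLp u 2)
    (hg : MemLp g 2) (h : HasWeakPartial i u g) (φ : 𝓢(R3, ℂ)) :
    ∫ x, ∂_{e3 i} φ x * u x = - ∫ x, φ x * g x := by
  set p : 𝓢(R3, ℝ) := φ.postcompCLM Complex.reCLM with hp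
  set q : 𝓢(R3, ℝ) := φ.postcompCLM Complex.imCLM with hq
  have e0 : ∀ x, φ x = (p x : ℂ) + (q x : ℂ) * Complex.I := fun x => by simp [hp, hq]
  have e1 : ∀ x, ∂_{e3 i} φ x = ((∂_{e3 i} p x : ℝ) : ℂ) + ((∂_{e3 i} q x : ℝ) : ℂ) * Complex.I := by
    intro x
    have d1 : ∂_{e3 i} p x = (∂_{e3 i} φ x).re := by
      rw [lineDerivOp_apply_eq_fderiv, lineDerivOp_apply_eq_fderiv]
      have := (Complex.reCLM.hasFDerivAt.comp x (φ.hasFDerivAt x)).fderiv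
      exact congrArg (fun L => L (e3 i)) this
    have d2 : ∂_{e3 i} q x = (∂_{e3 i} φ x).im := by
      rw [lineDerivOp_apply_eq_fderiv, lineDerivOp_apply_eq_fderiv]
      have := (Complex.imCLM.hasFDerivAt.comp x (φ.hasFDerivAt x)).fderiv
      exact congrArg (fun L => L (e3 i)) this
    rw [d1, d2, Complex.re_add_im]
  have i1 : ∀ (s : 𝓢(R3, ℝ)) {v : R3 → ℂ}, MemLp v 2 → Integrable fun x => s x • v x :=
    fun s v hv => integrable_of_norm_le_mul (s.memLp 2) hv
      (s.continuous.aestronglyMeasurable.smul hv.1) (ae_of_all _ fun x => (norm_smul _ _).le)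
  have split : ∀ (s t : 𝓢(R3, ℝ)) {v : R3 → ℂ}, MemLp v 2 →
      ∫ x, ((s x : ℂ) + (t x : ℂ) * Complex.I) * v x
        = (∫ x, s x • v x) + Complex.I * ∫ x, t x • v x := by
    intro s t v hv
    rw [← integral_const_mul, ← integral_add (i1 s hv) ((i1 t hv).const_mul _)]
    congr 1; ext x
    simp only [Complex.real_smul]; ring
  calc ∫ x, ∂_{e3 i} φ x * u x
      = ∫ x, (((∂_{e3 i} p x : ℝ) : ℂ) + ((∂_{e3 i} q x : ℝ) : ℂ) * Complex.I) * u x := by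
        congr 1; ext x; rw [e1]
    _ = - ∫ x, ((p x : ℂ) + (q x : ℂ) * Complex.I) * g x := by
        rw [split _ _ hu, split _ _ hg, h.integral_real_schwartz hu hg,
          h.integral_real_schwartz hu hg]
        ring
    _ = _ := by congr 2; ext x; rw [e0]

theorem weakPartial_spec {u : R3 → ℂ} (hu : MemH1 u) (i : Fin 3) :
    MemLp (weakPartial i u) 2 ∧ HasWeakPartial i u (weakPartial i u) := by
  rw [weakPartial, dif_pos (hu.2 i)]
  exact (hu.2 i).choose_spec

theorem HasWeakPartial.ae_eq {i : Fin 3} {u g g' : R3 → ℂ} (hg : MemLp g 2) (hg' : MemLp g' 2)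
    (h : HasWeakPartial i u g) (h' : HasWeakPartial i u g') : g =ᵐ[volume] g' := by
  refine ae_eq_of_integral_contDiff_smul_eq (hg.locallyIntegrable (by norm_num))
    (hg'.locallyIntegrable (by norm_num)) fun φ hφ hc => ?_
  exact neg_injective ((h φ hφ hc).symm.trans (h' φ hφ hc))

theorem weakPartial_ae_eq {i : Fin 3} {u g : R3 → ℂ} (hu : MemH1 u) (hg : MemLp g 2)
    (h : HasWeakPartial i u g) : weakPartial i u =ᵐ[volume] g :=
  (weakPartial_spec hu i).2.ae_eq (weakPartial_spec hu i).1 hg h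

/-- Testing the weak derivative with the transform of a Schwartz function turns the derivative into
multiplication by the frequency, and duality identifies the result. -/
theorem ft2_hasWeakPartial {i : Fin 3} {u g : R3 → ℂ} (hu : MemLp u 2)
    (hg : MemLp g 2) (h : HasWeakPartial i u g) :
    ft2 g =ᵐ[volume] fun ξ => (2 * Real.pi * Complex.I * (ξ i : ℂ)) * ft2 u ξ := by
  have hc : Continuous fun ξ : R3 => (2 * Real.pi * Complex.I * (ξ i : ℂ)) := by fun_prop
  refine ft2_ae_eq hg ?_ fun φ _ => ?_
  · rw [locallyIntegrable_iff]
    intro K hK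
    have h1 := ((memLp_ft2 hu).locallyIntegrable (by norm_num)).integrableOn_isCompact hK
    exact h1.continuousOn_mul hc.continuousOn hK
  · have key := h.integral_schwartz hu hg (𝓕 φ)
    rw [SchwartzMap.lineDerivOp_fourier_eq] at key
    rw [← neg_eq_iff_eq_neg] at key
    rw [← key, ← integral_mul_ft2 hu, ← integral_neg]
    congr 1; ext ξ
    rw [smul_apply, smulLeftCLM_apply_apply (by fun_prop)]
    simp [EuclideanSpace.inner_single_right]
    ring

theorem ft2_weakPartial {u : R3 → ℂ} (hu : MemH1 u) (i : Fin 3) :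
    ft2 (weakPartial i u) =ᵐ[volume] fun ξ => (2 * Real.pi * Complex.I * (ξ i : ℂ)) * ft2 u ξ :=
  ft2_hasWeakPartial hu.1 (weakPartial_spec hu i).1 (weakPartial_spec hu i).2

/-- The `i`-th partial derivative of a Schwartz function. -/
abbrev pd (i : Fin 3) (φ : 𝓢(R3, ℂ)) : 𝓢(R3, ℂ) := ∂_{e3 i} φ

theorem hasWeakPartial_schwartz (φ : 𝓢(R3, ℂ)) (i : Fin 3) :
    HasWeakPartial i φ (pd i φ) := by
  intro ψ hψ hc
  let Ψ : 𝓢(R3, ℝ) := hc.toSchwartzMap hψ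
  have h := integral_bilinear_lineDerivOp_right_eq_neg_left (μ := volume) Ψ φ
    (ContinuousLinearMap.lsmul ℝ ℝ) (e3 i)
  simp only [ContinuousLinearMap.lsmul_apply] at h
  rw [eq_neg_iff_add_eq_zero, add_comm, ← eq_neg_iff_add_eq_zero]
  exact h

theorem memH1_schwartz (φ : 𝓢(R3, ℂ)) : MemH1 φ :=
  ⟨φ.memLp 2, fun i => ⟨_, (pd i φ).memLp 2, hasWeakPartial_schwartz φ i⟩⟩

theorem weakPartial_schwartz (φ : 𝓢(R3, ℂ)) (i : Fin 3) :
    weakPartial i φ =ᵐ[volume] pd i φ :=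
  weakPartial_ae_eq (memH1_schwartz φ) ((pd i φ).memLp 2) (hasWeakPartial_schwartz φ i)

theorem ft2_schwartz (φ : 𝓢(R3, ℂ)) : ft2 φ =ᵐ[volume] ⇑(𝓕 φ : 𝓢(R3, ℂ)) :=
  ft2_ae_eq_fourier φ.integrable (φ.memLp 2)

theorem fourier_lineDeriv (φ : 𝓢(R3, ℂ)) (i : Fin 3) (ξ : R3) :
    𝓕 (pd i φ) ξ = (2 * Real.pi * Complex.I * (ξ i : ℂ)) * 𝓕 φ ξ := by
  rw [SchwartzMap.fourier_lineDerivOp_eq, smul_apply,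
    smulLeftCLM_apply_apply (by fun_prop)]
  simp [EuclideanSpace.inner_single_right]
  ring

end DipolarGPE

end

noncomputable section

namespace DipolarGPE

open FourierTransform SchwartzMap LineDeriv

/-! ### Density of Schwartz functions in Sobolev spaces -/

theorem aestronglyMeasurable_ft2 (u : R3 → ℂ) : AEStronglyMeasurable (ft2 u) volume := by
  by_cases h : MemLp u 2
  · exact (memLp_ft2 h).1
  · rw [ft2, dif_neg h]; exact aestronglyMeasurable_zero

theorem l2norm_const_smul {E : Type*} [NormedAddCommGroup E] [NormedSpace ℝ E] (c : ℝ)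
    (f : R3 → E) : l2norm (fun x => c • f x) = |c| * l2norm f := by
  unfold l2norm
  simp_rw [norm_smul, mul_pow, integral_const_mul]
  rw [Real.sqrt_mul (by positivity), Real.sqrt_sq (norm_nonneg c), Real.norm_eq_abs]

/-- Schwartz functions are dense in L², hence approximate the weighted transform; dividing by the
weight stays in the Schwartz class, because powers of 1 + |ξ|² have tempered growth. -/
theorem exists_schwartz_weight (r : ℝ) {u : R3 → ℂ}
    (hw : MemLp (fun ξ => (1 + ‖ξ‖ ^ 2) ^ r • ft2 u ξ) 2) {δ : ℝ} (hδ : 0 < δ) :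
    ∃ φ : 𝓢(R3, ℂ), l2norm (fun ξ => (1 + ‖ξ‖ ^ 2) ^ r • (𝓕 φ ξ - ft2 u ξ)) < δ := by
  obtain ⟨h, hh⟩ := (denseRange_toLpCLM (E := R3) (F := ℂ) (p := 2)
    (by simp) (μ := volume)).exists_mem_open Metric.isOpen_ball
      ⟨hw.toLp _, Metric.mem_ball_self hδ⟩
  have hg : (fun ξ : R3 => (1 + ‖ξ‖ ^ 2) ^ (-r)).HasTemperateGrowth :=
    Function.hasTemperateGrowth_one_add_norm_sq_rpow R3 (-r)
  refine ⟨𝓕⁻ (smulLeftCLM ℂ (fun ξ : R3 => (1 + ‖ξ‖ ^ 2) ^ (-r)) h), ?_⟩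
  rw [fourier_fourierInv_eq]
  rw [mem_ball_iff_norm, toLpCLM_apply, SchwartzMap.toLp, ← MemLp.toLp_sub,
    ← l2norm_eq_norm_toLp] at hh
  convert hh using 3 with ξ
  have h1 : (0 : ℝ) < 1 + ‖ξ‖ ^ 2 := by positivity
  rw [smulLeftCLM_apply_apply hg, smul_sub, smul_smul, ← Real.rpow_add h1]
  simp

theorem l2norm_smul_mono {a b : R3 → ℝ} {v : R3 → ℂ} (h : ∀ ξ, |a ξ| ≤ b ξ)
    (hb : MemLp (fun ξ => b ξ • v ξ) 2) : l2norm (fun ξ => a ξ • v ξ) ≤ l2norm fun ξ => b ξ • v ξ := by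
  refine l2norm_mono hb (ae_of_all _ fun ξ => ?_)
  rw [norm_smul, norm_smul, Real.norm_eq_abs, Real.norm_eq_abs]
  refine mul_le_mul_of_nonneg_right ?_ (norm_nonneg _)
  exact (h ξ).trans (le_abs_self _)

/-! ### The Sobolev inequality -/

theorem eLpNorm_le_of_ae_tendsto {p : ℝ≥0∞} {f : ℕ → R3 → ℂ} {g : R3 → ℂ}
    (hm : ∀ n, AEStronglyMeasurable (f n) volume)
    (h : ∀ᵐ x, Tendsto (fun n => f n x) atTop (𝓝 (g x))) {c : ℕ → ℝ≥0∞} {C : ℝ≥0∞}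
    (hc : ∀ n, eLpNorm (f n) p volume ≤ c n) (hC : Tendsto c atTop (𝓝 C)) :
    eLpNorm g p volume ≤ C := by
  refine (Lp.eLpNorm_lim_le_liminf_eLpNorm hm g h).trans ?_
  rw [← hC.liminf_eq]
  exact liminf_le_liminf (Eventually.of_forall hc)

theorem norm_fderiv_le_sum (φ : 𝓢(R3, ℂ)) (x : R3) : ‖fderiv ℝ φ x‖ ≤ ∑ i, ‖pd i φ x‖ := by
  refine ContinuousLinearMap.opNorm_le_bound _ (Finset.sum_nonneg fun _ _ => norm_nonneg _)
    fun v => ?_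
  have hv : v = ∑ i, v i • e3 i := by
    ext j; simp [Finset.sum_apply, Pi.single_apply]
  conv_lhs => rw [hv, map_sum]
  refine (norm_sum_le _ _).trans ?_
  rw [Finset.sum_mul]
  refine Finset.sum_le_sum fun i _ => ?_
  rw [map_smul, norm_smul, mul_comm, ← lineDerivOp_apply_eq_fderiv]
  gcongr
  exact abs_coord_le v i

theorem exists_sobolev_compactSupport : ∃ S : ℝ≥0∞, S ≠ ⊤ ∧ ∀ v : R3 → ℂ, ContDiff ℝ 1 v →
    HasCompactSupport v → eLpNorm v 6 volume ≤ S * eLpNorm (fderiv ℝ v) 2 volume := by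
  refine ⟨SNormLESNormFDerivOfEqConst ℂ (volume : Measure R3) 2, ENNReal.coe_ne_top,
    fun v hv hc => ?_⟩
  exact eLpNorm_le_eLpNorm_fderiv_of_eq (volume : Measure R3) (F := ℂ) (p := 2) (p' := 6)
    hv hc (by norm_num) (by simp) (by simp; norm_num)

theorem eLpNorm_fderiv_le (φ : 𝓢(R3, ℂ)) :
    eLpNorm (fderiv ℝ φ) 2 volume ≤ ∑ i, eLpNorm (pd i φ) 2 volume := by
  have h1 : eLpNorm (fun x => ∑ i, ‖pd i φ x‖) 2 volume ≤ ∑ i, eLpNorm (pd i φ) 2 volume := by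
    have := eLpNorm_sum_le (μ := volume) (p := 2) (s := Finset.univ)
      (f := fun i : Fin 3 => fun x => ‖pd i φ x‖)
      (fun i _ => (pd i φ).continuous.norm.aestronglyMeasurable) (by norm_num)
    simp only [eLpNorm_norm] at this
    refine le_trans (le_of_eq ?_) this
    congr 1
  exact (eLpNorm_mono_real (norm_fderiv_le_sum φ)).trans h1

/-- Extends the compactly supported inequality by cutoffs of radius n + 1: the derivative falling on
the cutoff costs a term of order ‖φ‖₂/(n + 1), and Fatou's lemma handles the left-hand side. -/
theorem exists_sobolev_schwartz : ∃ S : ℝ≥0∞, S ≠ ⊤ ∧ ∀ φ : 𝓢(R3, ℂ),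
    eLpNorm φ 6 volume ≤ S * ∑ i, eLpNorm (pd i φ) 2 volume := by
  obtain ⟨C, hC, hb⟩ := exists_bump_bound
  obtain ⟨S, hS, hSob⟩ := exists_sobolev_compactSupport
  refine ⟨S, hS, fun φ => ?_⟩
  have hfd := eLpNorm_fderiv_le φ
  have main : ∀ n : ℕ, eLpNorm (fun x => cutoff (n + 1 : ℝ) x • φ x) 6 volume ≤
      S * (eLpNorm (fderiv ℝ φ) 2 volume
        + ENNReal.ofReal (((n : ℝ) + 1)⁻¹ * C) * eLpNorm φ 2 volume) := by
    intro n
    have hR : (0 : ℝ) < n + 1 := by positivity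
    refine (hSob (fun x => cutoff (n + 1 : ℝ) x • φ x)
      (((contDiff_cutoff _).of_le (by simp)).smul (φ.smooth 1))
      ((hasCompactSupport_cutoff hR).smul_right)).trans ?_
    refine mul_le_mul_right ?_ S
    have hfc : ∀ x, ‖fderiv ℝ (fun x => cutoff (n + 1 : ℝ) x • φ x) x‖
        ≤ ‖fderiv ℝ φ x‖ + ((n : ℝ) + 1)⁻¹ * C * ‖φ x‖ := by
      intro x
      rw [fderiv_fun_smul ((contDiff_cutoff _).differentiable (by simp) x) φ.differentiableAt]
      refine (norm_add_le _ _).trans ?_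
      refine add_le_add ?_ ?_
      · rw [norm_smul]
        exact mul_le_of_le_one_left (norm_nonneg _) (abs_cutoff_le_one _ x)
      · rw [ContinuousLinearMap.norm_smulRight_apply]
        gcongr
        refine ContinuousLinearMap.opNorm_le_bound _ (by positivity) fun v => ?_
        rw [fderiv_cutoff, norm_mul, norm_inv, Real.norm_of_nonneg hR.le, mul_assoc]
        gcongr
        exact (hb _ v).1
    refine (eLpNorm_mono_real hfc).trans ?_
    have hcd : Continuous (fderiv ℝ φ) := (φ.smooth 1).continuous_fderiv one_ne_zero
    refine (eLpNorm_add_le (p := 2) (μ := volume) (f := fun x => ‖fderiv ℝ φ x‖)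
      (g := fun x => ((n : ℝ) + 1)⁻¹ * C * ‖φ x‖) hcd.norm.aestronglyMeasurable
      (continuous_const.mul φ.continuous.norm).aestronglyMeasurable (by norm_num)).trans ?_
    rw [eLpNorm_norm]
    gcongr
    have := eLpNorm_const_smul (((n : ℝ) + 1)⁻¹ * C) (fun x => ‖φ x‖) 2 (volume : Measure R3)
    rw [eLpNorm_norm, Real.enorm_of_nonneg (by positivity)] at this
    exact this.le
  have hlim : Tendsto (fun n : ℕ => (n : ℝ) + 1) atTop atTop :=
    tendsto_atTop_add_const_right _ _ tendsto_natCast_atTop_atTop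
  refine (eLpNorm_le_of_ae_tendsto (fun n => ?_) (ae_of_all _ fun x => ?_) main
    (C := S * (eLpNorm (fderiv ℝ φ) 2 volume + 0 * eLpNorm φ 2 volume)) ?_).trans ?_
  · exact ((contDiff_cutoff _).continuous.smul φ.continuous).aestronglyMeasurable
  · simpa using ((tendsto_cutoff x).comp hlim).smul_const (φ x)
  · have t1 : Tendsto (fun n : ℕ => ((n : ℝ) + 1)⁻¹ * C) atTop (𝓝 (0 * C)) :=
      (tendsto_inv_atTop_zero.comp hlim).mul_const C
    have t2 := ENNReal.tendsto_ofReal t1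
    rw [zero_mul, ENNReal.ofReal_zero] at t2
    have hne : eLpNorm φ 2 volume ≠ ⊤ := (SchwartzMap.eLpNorm_lt_top φ 2 volume).ne
    have t3 := ENNReal.Tendsto.mul_const t2 (b := eLpNorm φ 2 volume) (Or.inr hne)
    have t4 := (tendsto_const_nhds (x := eLpNorm (fderiv ℝ φ) 2 volume) (f := atTop)).add t3
    exact ENNReal.Tendsto.const_mul t4 (Or.inr hS)
  · rw [zero_mul, add_zero]
    gcongr

/-- The sum of the `L²` norms of the weak partial derivatives. -/
def gradNorm (u : R3 → ℂ) : ℝ := ∑ i, l2norm (weakPartial i u)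

theorem gradNorm_nonneg (u : R3 → ℂ) : 0 ≤ gradNorm u :=
  Finset.sum_nonneg fun _ _ => l2norm_nonneg _

theorem memLp_sub_schwartz_weight (r : ℝ) {u : R3 → ℂ}
    (hw : MemLp (fun ξ => (1 + ‖ξ‖ ^ 2) ^ r • ft2 u ξ) 2) (φ : 𝓢(R3, ℂ)) :
    MemLp (fun ξ => (1 + ‖ξ‖ ^ 2) ^ r • (𝓕 φ ξ - ft2 u ξ)) 2 := by
  have hg : (fun ξ : R3 => (1 + ‖ξ‖ ^ 2) ^ r).HasTemperateGrowth :=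
    Function.hasTemperateGrowth_one_add_norm_sq_rpow R3 r
  have h1 := (smulLeftCLM ℂ (fun ξ : R3 => (1 + ‖ξ‖ ^ 2) ^ r) (𝓕 φ)).memLp 2 volume
  refine (h1.sub hw).congr_norm ?_ (ae_of_all _ fun ξ => ?_)
  · have : Continuous fun ξ : R3 => (1 + ‖ξ‖ ^ 2) ^ r := hg.1.continuous
    exact this.aestronglyMeasurable.smul ((𝓕 φ).continuous.aestronglyMeasurable.sub
      (aestronglyMeasurable_ft2 u))
  · simp [smulLeftCLM_apply_apply hg, smul_sub]

theorem l2norm_sub_schwartz {u : R3 → ℂ} (hu : MemLp u 2) (φ : 𝓢(R3, ℂ)) :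
    l2norm (fun x => φ x - u x) = l2norm (fun ξ => 𝓕 φ ξ - ft2 u ξ) := by
  rw [← l2norm_ft2 (u := fun x => φ x - u x) ((φ.memLp 2).sub hu)]
  refine l2norm_congr_norm ?_
  filter_upwards [ft2_sub (φ.memLp 2) hu, ft2_schwartz φ] with ξ h1 h2
  rw [h1, h2]

theorem l2norm_pd_sub_weakPartial {u : R3 → ℂ} (hu : MemH1 u) (φ : 𝓢(R3, ℂ)) (i : Fin 3) :
    l2norm (fun x => pd i φ x - weakPartial i u x)
      = l2norm (fun ξ => (2 * Real.pi * ξ i) • (𝓕 φ ξ - ft2 u ξ)) := by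
  rw [l2norm_sub_schwartz (weakPartial_spec hu i).1]
  refine l2norm_congr_norm ?_
  filter_upwards [ft2_weakPartial hu i] with ξ h1
  rw [h1, fourier_lineDeriv, ← mul_sub, norm_mul, norm_smul]
  simp

theorem memLp_coord_ft2 {u : R3 → ℂ} (hu : MemH1 u) (i : Fin 3) :
    MemLp (fun ξ => (ξ i) • ft2 u ξ) 2 := by
  have h := (memLp_ft2 (weakPartial_spec hu i).1).const_mul ((2 * Real.pi)⁻¹ : ℂ)
  refine h.congr_norm ?_ ?_
  · have hc : Continuous fun ξ : R3 => ξ i := by fun_prop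
    exact hc.aestronglyMeasurable.smul (memLp_ft2 hu.1).1
  · filter_upwards [ft2_weakPartial hu i] with ξ h1
    rw [h1, norm_mul, norm_mul, norm_smul]
    have := Real.pi_pos
    simp [abs_of_pos Real.pi_pos]
    field_simp

theorem memLp_weight_half {u : R3 → ℂ} (hu : MemH1 u) :
    MemLp (fun ξ => (1 + ‖ξ‖ ^ 2) ^ (1 / 2 : ℝ) • ft2 u ξ) 2 := by
  have hc : Continuous fun ξ : R3 => (1 + ‖ξ‖ ^ 2) ^ (1 / 2 : ℝ) :=
    (Function.hasTemperateGrowth_one_add_norm_sq_rpow R3 (1 / 2)).1.continuous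
  refine memLp_two_of_sq_le (hc.aestronglyMeasurable.smul (memLp_ft2 hu.1).1)
    ((integrable_norm_sq (memLp_ft2 hu.1)).add
      (integrable_finsetSum Finset.univ fun i _ => integrable_norm_sq (memLp_coord_ft2 hu i)))
    fun ξ => ?_
  have e : ((1 + ‖ξ‖ ^ 2) ^ (1 / 2 : ℝ)) ^ 2 = 1 + ‖ξ‖ ^ 2 := by
    rw [← Real.rpow_natCast, ← Real.rpow_mul (by positivity)]; norm_num
  rw [norm_smul, mul_pow, Real.norm_eq_abs, sq_abs, e, norm_sq_eq_sum]
  simp [mul_pow, Fin.sum_univ_three]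
  apply le_of_eq; ring

/-- Schwartz functions are dense in `H¹`. -/
theorem exists_schwartz_near {u : R3 → ℂ} (hu : MemH1 u) {δ : ℝ} (hδ : 0 < δ) :
    ∃ φ : 𝓢(R3, ℂ), l2norm (fun x => φ x - u x) < δ ∧
      ∀ i, l2norm (fun x => pd i φ x - weakPartial i u x) < δ := by
  have hpi := Real.pi_pos
  obtain ⟨φ, hφ⟩ := exists_schwartz_weight (1 / 2) (memLp_weight_half hu)
    (δ := δ / (1 + 2 * Real.pi)) (by positivity)
  have hm := memLp_sub_schwartz_weight (1 / 2) (memLp_weight_half hu) φ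
  set w : R3 → ℝ := fun ξ => (1 + ‖ξ‖ ^ 2) ^ (1 / 2 : ℝ) with hw
  have hw1 : ∀ ξ, 1 ≤ w ξ := fun ξ => Real.one_le_rpow (by nlinarith [norm_nonneg ξ]) (by norm_num)
  have hw2 : ∀ ξ, ‖ξ‖ ≤ w ξ := fun ξ => by
    rw [hw]; simp only
    rw [← Real.sqrt_eq_rpow]
    exact Real.le_sqrt_of_sq_le (by linarith)
  have bound : ∀ a : R3 → ℝ, (∀ ξ, |a ξ| ≤ (1 + 2 * Real.pi) * w ξ) →
      l2norm (fun ξ => a ξ • (𝓕 φ ξ - ft2 u ξ)) < δ := by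
    intro a ha
    have hm' : MemLp (fun ξ => ((1 + 2 * Real.pi) * w ξ) • (𝓕 φ ξ - ft2 u ξ)) 2 := by
      simp_rw [mul_smul]
      exact hm.const_smul (1 + 2 * Real.pi)
    refine (l2norm_smul_mono ha hm').trans_lt ?_
    simp_rw [mul_smul]
    rw [l2norm_const_smul, abs_of_pos (by positivity), mul_comm]
    exact (lt_div_iff₀ (by positivity)).mp hφ
  refine ⟨φ, ?_, fun i => ?_⟩
  · rw [l2norm_sub_schwartz hu.1]
    have := bound (fun _ => 1) fun ξ => by
      rw [abs_one]; nlinarith [hw1 ξ]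
    simpa using this
  · rw [l2norm_pd_sub_weakPartial hu]
    refine bound _ fun ξ => ?_
    rw [abs_mul, abs_of_pos (by positivity : 0 < 2 * Real.pi)]
    have := (abs_coord_le ξ i).trans (hw2 ξ)
    nlinarith [hw1 ξ]

theorem eLpNorm_two_eq_ofReal {E : Type*} [NormedAddCommGroup E] {f : R3 → E} (hf : MemLp f 2) :
    eLpNorm f 2 volume = ENNReal.ofReal (l2norm f) := by
  rw [l2norm_eq_toReal hf.1, ENNReal.ofReal_toReal hf.eLpNorm_ne_top]

/-- Density in H¹, an almost everywhere convergent subsequence, and lower semicontinuity of the L⁶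
norm under almost everywhere convergence. -/
theorem exists_sobolev : ∃ S : ℝ, 0 ≤ S ∧ ∀ u : R3 → ℂ, MemH1 u →
    eLpNorm u 6 volume ≤ ENNReal.ofReal (S * gradNorm u) := by
  obtain ⟨S, hS, hSob⟩ := exists_sobolev_schwartz
  refine ⟨S.toReal, ENNReal.toReal_nonneg, fun u hu => ?_⟩
  have hδ : ∀ n : ℕ, (0 : ℝ) < 1 / (n + 1) := fun n => by positivity
  choose φ hφ0 hφ1 using fun n => exists_schwartz_near hu (hδ n)
  have hz : Tendsto (fun n : ℕ => (1 : ℝ) / (n + 1)) atTop (𝓝 0) :=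
    tendsto_one_div_add_atTop_nhds_zero_nat
  have hm : TendstoInMeasure volume (fun n x => φ n x) atTop u := by
    refine tendstoInMeasure_of_tendsto_eLpNorm (p := 2) (by norm_num)
      (fun n => (φ n).continuous.aestronglyMeasurable) hu.1.1 ?_
    refine tendsto_of_tendsto_of_tendsto_of_le_of_le tendsto_const_nhds
      (h := fun n : ℕ => ENNReal.ofReal (1 / (n + 1))) ?_ (fun _ => zero_le) fun n => ?_
    · simpa using ENNReal.tendsto_ofReal hz
    · refine (eLpNorm_two_eq_ofReal (((φ n).memLp 2).sub hu.1)).trans_le ?_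
      exact ENNReal.ofReal_le_ofReal (hφ0 n).le
  obtain ⟨ns, hns, hae⟩ := hm.exists_seq_tendsto_ae
  refine eLpNorm_le_of_ae_tendsto (fun n => (φ (ns n)).continuous.aestronglyMeasurable) hae
    (c := fun n => ENNReal.ofReal (S.toReal * (gradNorm u + 3 * (1 / ((ns n : ℝ) + 1)))))
    (fun n => ?_) ?_
  · refine (hSob _).trans ?_
    rw [ENNReal.ofReal_mul ENNReal.toReal_nonneg, ENNReal.ofReal_toReal hS]
    refine mul_le_mul_right ?_ S
    calc ∑ i, eLpNorm (pd i (φ (ns n))) 2 volume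
        = ENNReal.ofReal (∑ i, l2norm (pd i (φ (ns n)))) := by
          rw [ENNReal.ofReal_sum_of_nonneg fun _ _ => l2norm_nonneg _]
          exact Finset.sum_congr rfl fun i _ => eLpNorm_two_eq_ofReal ((pd i _).memLp 2)
      _ ≤ _ := by
          refine ENNReal.ofReal_le_ofReal ?_
          calc ∑ i, l2norm (pd i (φ (ns n)))
              ≤ ∑ i, (l2norm (weakPartial i u) + 1 / ((ns n : ℝ) + 1)) := by
                refine Finset.sum_le_sum fun i _ => ?_
                refine (l2norm_le_add_sub ((pd i _).memLp 2) (weakPartial_spec hu i).1).trans ?_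
                exact add_le_add le_rfl (hφ1 (ns n) i).le
            _ = _ := by
                rw [Finset.sum_add_distrib, gradNorm]; simp
  · have h1 := (hz.comp hns.tendsto_atTop).const_mul 3
    have h2 := ((tendsto_const_nhds (x := gradNorm u)).add h1).const_mul S.toReal
    simpa using ENNReal.tendsto_ofReal h2

theorem MemH1.memLp_six {u : R3 → ℂ} (hu : MemH1 u) : MemLp u 6 := by
  obtain ⟨S, _, h⟩ := exists_sobolev
  exact ⟨hu.1.1, (h u hu).trans_lt ENNReal.ofReal_lt_top⟩

theorem exists_sobolev_cube : ∃ S : ℝ, 0 ≤ S ∧ ∀ u : R3 → ℂ, MemH1 u →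
    l2norm (fun x => ‖u x‖ ^ 3) ≤ S * gradNorm u ^ 3 := by
  obtain ⟨S, hS, h⟩ := exists_sobolev
  refine ⟨S ^ 3, by positivity, fun u hu => ?_⟩
  rw [l2norm_eq_toReal (f := fun x => ‖u x‖ ^ 3) (hu.1.1.norm.pow 3), ← mul_pow]
  have e := eLpNorm_norm_rpow (μ := volume) u (p := 2) (q := 3) (by norm_num)
  have e2 : eLpNorm (fun x => ‖u x‖ ^ 3) 2 volume = eLpNorm u 6 volume ^ 3 := by
    have e3 : (2 : ℝ≥0∞) * ENNReal.ofReal 3 = 6 := by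
      rw [show (3 : ℝ) = ((3 : ℕ) : ℝ) by norm_num, ENNReal.ofReal_natCast]; norm_num
    rw [e3] at e
    exact_mod_cast e
  rw [e2, ENNReal.toReal_pow]
  gcongr
  exact ENNReal.toReal_le_of_le_ofReal (mul_nonneg hS (gradNorm_nonneg u)) (h u hu)

/-- A bound for the `L⁴` norm in terms of the `L²` norms of a function and of its gradient. -/
theorem exists_sq_l2norm_sq_le : ∃ S : ℝ, 0 ≤ S ∧ ∀ u : R3 → ℂ, MemH1 u →
    l2norm (fun x => ‖u x‖ ^ 2) ^ 2 ≤ S * (l2norm u * gradNorm u ^ 3) := by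
  obtain ⟨S, hS, h⟩ := exists_sobolev_cube
  refine ⟨S, hS, fun u hu => (sq_l2norm_norm_sq_le hu.1 hu.memLp_six).trans ?_⟩
  calc _ ≤ l2norm u * (S * gradNorm u ^ 3) :=
        mul_le_mul_of_nonneg_left (h u hu) (l2norm_nonneg _)
    _ = _ := by ring

end DipolarGPE

end

noncomputable section

namespace DipolarGPE

open FourierTransform SchwartzMap LineDeriv

/-! ### Fourier multiplier forms -/

/-- The sesquilinear form of the Fourier multiplier with symbol `a`. -/
def bform (a : R3 → ℝ) (f g : R3 → ℂ) : ℂ := ∫ ξ, (a ξ : ℂ) * (ft2 f ξ * star (ft2 g ξ))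

/-- The symbol `l₁ + l₂ K̂`. -/
def symbolA (l₁ l₂ : ℝ) (ξ : R3) : ℝ := l₁ + l₂ * symbolK ξ

/-- A bound for the symbol `l₁ + l₂ K̂`. -/
def boundA (l₁ l₂ : ℝ) : ℝ := |l₁| + |l₂| * (8 * Real.pi / 3)

theorem boundA_nonneg (l₁ l₂ : ℝ) : 0 ≤ boundA l₁ l₂ := by
  have := Real.pi_pos
  unfold boundA; positivity

theorem abs_symbolA_le (l₁ l₂ : ℝ) (ξ : R3) : |symbolA l₁ l₂ ξ| ≤ boundA l₁ l₂ := by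
  unfold symbolA boundA
  refine (abs_add_le _ _).trans ?_
  rw [abs_mul]
  gcongr
  exact abs_symbolK_le ξ

theorem measurable_symbolA (l₁ l₂ : ℝ) : Measurable (symbolA l₁ l₂) :=
  measurable_const.add (measurable_const.mul measurable_symbolK)

section bform

variable {l₁ l₂ : ℝ} {f f' g g' : R3 → ℂ}

theorem norm_symbolA_mul_le (l₁ l₂ : ℝ) (z w : ℂ) (ξ : R3) :
    ‖(symbolA l₁ l₂ ξ : ℂ) * (z * star w)‖ ≤ boundA l₁ l₂ * (‖z‖ * ‖w‖) := by
  rw [norm_mul, norm_mul, norm_star, Complex.norm_real]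
  gcongr
  exact abs_symbolA_le l₁ l₂ ξ

theorem integrable_bform (hf : MemLp f 2) (hg : MemLp g 2) :
    Integrable fun ξ => (symbolA l₁ l₂ ξ : ℂ) * (ft2 f ξ * star (ft2 g ξ)) := by
  refine ((integrable_norm_mul_norm (memLp_ft2 hf) (memLp_ft2 hg)).const_mul
    (boundA l₁ l₂)).mono' ?_ (ae_of_all _ fun ξ => norm_symbolA_mul_le l₁ l₂ _ _ ξ)
  exact (Complex.measurable_ofReal.comp (measurable_symbolA l₁ l₂)).aestronglyMeasurable.mul
    ((memLp_ft2 hf).1.mul (memLp_ft2 hg).1.star)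

theorem norm_bform_le (hf : MemLp f 2) (hg : MemLp g 2) :
    ‖bform (symbolA l₁ l₂) f g‖ ≤ boundA l₁ l₂ * (l2norm f * l2norm g) := by
  refine (norm_integral_le_of_norm_le ((integrable_norm_mul_norm (memLp_ft2 hf)
    (memLp_ft2 hg)).const_mul (boundA l₁ l₂))
    (ae_of_all _ fun ξ => norm_symbolA_mul_le l₁ l₂ _ _ ξ)).trans ?_
  rw [integral_const_mul, ← l2norm_ft2 hf, ← l2norm_ft2 hg]
  exact mul_le_mul_of_nonneg_left (integral_norm_mul_norm_le (memLp_ft2 hf) (memLp_ft2 hg))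
    (boundA_nonneg _ _)

theorem bform_sub_left (hf : MemLp f 2) (hf' : MemLp f' 2) (hg : MemLp g 2) :
    bform (symbolA l₁ l₂) (fun x => f x - f' x) g
      = bform (symbolA l₁ l₂) f g - bform (symbolA l₁ l₂) f' g := by
  rw [bform, bform, bform, ← integral_sub (integrable_bform hf hg) (integrable_bform hf' hg)]
  apply integral_congr_ae
  filter_upwards [ft2_sub hf hf'] with ξ h
  rw [h]; ring

theorem bform_sub_right (hf : MemLp f 2) (hg : MemLp g 2) (hg' : MemLp g' 2) :
    bform (symbolA l₁ l₂) f (fun x => g x - g' x)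
      = bform (symbolA l₁ l₂) f g - bform (symbolA l₁ l₂) f g' := by
  rw [bform, bform, bform, ← integral_sub (integrable_bform hf hg) (integrable_bform hf hg')]
  apply integral_congr_ae
  filter_upwards [ft2_sub hg hg'] with ξ h
  rw [h, star_sub]; ring

/-- This is where the principal value leaves the argument: afterwards only the bounded symbol l₁ +
l₂ K̂ is used. -/
theorem bform_isConvK {f : R3 → ℝ} {W : R3 → ℝ} (hf : Integrable f) (hf2 : MemLp f 2)
    (hW : IsConvK f W) (hg : MemLp g 2) :
    (l₁ : ℂ) * (∫ x, (f x : ℂ) * star (g x)) + (l₂ : ℂ) * (∫ x, (W x : ℂ) * star (g x))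
      = bform (symbolA l₁ l₂) (fun x => (f x : ℂ)) g := by
  have hfc : MemLp (fun x => (f x : ℂ)) 2 := hf2.ofReal
  rw [isConvK_pairing hf hf2 hW hg, ← integral_conj_mul_ft2 hfc hg, ← integral_const_mul,
    ← integral_const_mul, ← integral_add, bform]
  · congr 1; ext ξ
    simp only [symbolA]; push_cast; ring
  · refine (integrable_of_norm_le_mul (memLp_ft2 hfc) (memLp_ft2 hg)
      ((memLp_ft2 hfc).1.mul (memLp_ft2 hg).1.star) (ae_of_all _ fun ξ => ?_)).const_mul _
    exact (norm_mul _ _).trans_le (by rw [Pi.star_apply, norm_star])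
  · have := (integrable_bform (l₁ := 0) (l₂ := 1) hfc hg).const_mul (l₂ : ℂ)
    simpa [symbolA] using this

end bform

/-! ### Translations -/

theorem memLp_translate {E : Type*} [NormedAddCommGroup E] {f : R3 → E} {p : ℝ≥0∞}
    (hf : MemLp f p) (h : R3) : MemLp (fun x => f (x + h)) p :=
  hf.comp_measurePreserving (measurePreserving_add_right volume h)

theorem l2norm_translate {E : Type*} [NormedAddCommGroup E] (f : R3 → E) (h : R3) :
    l2norm (fun x => f (x + h)) = l2norm f := by
  unfold l2norm
  rw [integral_add_right_eq_self (fun x => ‖f x‖ ^ 2)]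

theorem HasWeakPartial.translate {i : Fin 3} {u g : R3 → ℂ} (hg : HasWeakPartial i u g) (h : R3) :
    HasWeakPartial i (fun x => u (x + h)) (fun x => g (x + h)) := by
  intro φ hφ hc
  have h1 := hg (fun x => φ (x + -h)) (hφ.comp (contDiff_id.add contDiff_const))
    (hc.comp_homeomorph (Homeomorph.addRight (-h)))
  rw [← integral_add_right_eq_self _ h, ← integral_add_right_eq_self (fun x => _ • g x) h] at h1
  simp_rw [fderiv_comp_add_right] at h1
  simpa using h1

theorem MemH1.translate {u : R3 → ℂ} (hu : MemH1 u) (h : R3) : MemH1 fun x => u (x + h) :=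
  ⟨memLp_translate hu.1 h, fun i => ⟨_, memLp_translate (weakPartial_spec hu i).1 h,
    (weakPartial_spec hu i).2.translate h⟩⟩

theorem weakPartial_translate {u : R3 → ℂ} (hu : MemH1 u) (h : R3) (i : Fin 3) :
    weakPartial i (fun x => u (x + h)) =ᵐ[volume] fun x => weakPartial i u (x + h) :=
  weakPartial_ae_eq (hu.translate h) (memLp_translate (weakPartial_spec hu i).1 h)
    ((weakPartial_spec hu i).2.translate h)

theorem HasWeakPartial.sub {i : Fin 3} {u g u' g' : R3 → ℂ} (hu : MemLp u 2) (hg : MemLp g 2)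
    (hu' : MemLp u' 2) (hg' : MemLp g' 2)
    (h : HasWeakPartial i u g) (h' : HasWeakPartial i u' g') :
    HasWeakPartial i (fun x => u x - u' x) (fun x => g x - g' x) := by
  intro φ hφ hc
  let Φ : 𝓢(R3, ℝ) := hc.toSchwartzMap hφ
  have i1 : ∀ (s : 𝓢(R3, ℝ)) {v : R3 → ℂ}, MemLp v 2 → Integrable fun x => s x • v x :=
    fun s v hv => integrable_of_norm_le_mul (s.memLp 2) hv
      (s.continuous.aestronglyMeasurable.smul hv.1) (ae_of_all _ fun x => (norm_smul _ _).le)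
  simp_rw [smul_sub]
  have e1 := integral_sub (i1 (∂_{e3 i} Φ) hu) (i1 (∂_{e3 i} Φ) hu')
  have e2 := integral_sub (i1 Φ hg) (i1 Φ hg')
  refine e1.trans ((congrArg₂ _ (h φ hφ hc) (h' φ hφ hc)).trans ?_)
  rw [neg_sub_neg, ← neg_sub]
  exact congrArg _ e2.symm

theorem MemH1.sub {u v : R3 → ℂ} (hu : MemH1 u) (hv : MemH1 v) : MemH1 fun x => u x - v x :=
  ⟨hu.1.sub hv.1, fun i => ⟨_, (weakPartial_spec hu i).1.sub (weakPartial_spec hv i).1,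
    (weakPartial_spec hu i).2.sub hu.1 (weakPartial_spec hu i).1 hv.1 (weakPartial_spec hv i).1
      (weakPartial_spec hv i).2⟩⟩

theorem weakPartial_sub {u v : R3 → ℂ} (hu : MemH1 u) (hv : MemH1 v) (i : Fin 3) :
    weakPartial i (fun x => u x - v x) =ᵐ[volume]
      fun x => weakPartial i u x - weakPartial i v x :=
  weakPartial_ae_eq (hu.sub hv) ((weakPartial_spec hu i).1.sub (weakPartial_spec hv i).1)
    ((weakPartial_spec hu i).2.sub hu.1 (weakPartial_spec hu i).1 hv.1 (weakPartial_spec hv i).1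
      (weakPartial_spec hv i).2)

/-- The phase factor by which a translation acts on the Fourier side. -/
def phase (h ξ : R3) : ℂ := Complex.exp (((2 * Real.pi * inner ℝ h ξ : ℝ) : ℂ) * Complex.I)

theorem continuous_phase (h : R3) : Continuous (phase h) := by
  unfold phase; fun_prop

theorem norm_phase (h ξ : R3) : ‖phase h ξ‖ = 1 := Complex.norm_exp_ofReal_mul_I _

theorem norm_phase_sub_one_le (h ξ : R3) : ‖phase h ξ - 1‖ ≤ 2 * Real.pi * (‖h‖ * ‖ξ‖) := by
  have h1 := Real.norm_exp_I_mul_ofReal_sub_one_le (x := 2 * Real.pi * inner ℝ h ξ)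
  rw [mul_comm] at h1
  refine h1.trans ?_
  rw [norm_mul, Real.norm_of_nonneg (by positivity)]
  gcongr
  exact norm_inner_le_norm h ξ

theorem ft2_translate {f : R3 → ℂ} (hf : MemLp f 2) (h : R3) :
    ft2 (fun x => f (x + h)) =ᵐ[volume] fun ξ => phase h ξ * ft2 f ξ := by
  refine ft2_ae_eq (memLp_translate hf h) ?_ fun g _ => ?_
  · rw [locallyIntegrable_iff]
    intro K hK
    have h1 := ((memLp_ft2 hf).locallyIntegrable (by norm_num)).integrableOn_isCompact hK
    exact h1.continuousOn_mul (continuous_phase h).continuousOn hK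
  -- The modulated test function, obtained by translating the inverse transform so that it is
  -- visibly Schwartz.
  · let G : 𝓢(R3, ℂ) := 𝓕 (compSubConstCLM ℂ (-h) (𝓕⁻ g))
    have hG : ∀ ξ, G ξ = phase h ξ * g ξ := by
      intro ξ
      have h1 := congrFun (VectorFourier.fourierIntegral_comp_add_right Real.fourierChar
        (volume : Measure R3) (innerₗ R3) (𝓕⁻ g : 𝓢(R3, ℂ)) h) ξ
      have h2 : G ξ = VectorFourier.fourierIntegral Real.fourierChar (volume : Measure R3)
          (innerₗ R3) ((𝓕⁻ g : 𝓢(R3, ℂ)) ∘ fun v => v + h) ξ := by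
        have : (compSubConstCLM ℂ (-h) (𝓕⁻ g) : R3 → ℂ) = (𝓕⁻ g : 𝓢(R3, ℂ)) ∘ fun v => v + h := by
          ext x; simp
        rw [← this]; rfl
      have h3 : VectorFourier.fourierIntegral Real.fourierChar (volume : Measure R3)
          (innerₗ R3) (𝓕⁻ g : 𝓢(R3, ℂ)) ξ = g ξ := by
        have h4 : VectorFourier.fourierIntegral Real.fourierChar (volume : Measure R3)
          (innerₗ R3) (𝓕⁻ g : 𝓢(R3, ℂ)) ξ = (𝓕 (𝓕⁻ g : 𝓢(R3, ℂ)) : 𝓢(R3, ℂ)) ξ := rfl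
        rw [h4, fourier_fourierInv_eq]
      rw [h2, h1, h3, Circle.smul_def, Real.fourierChar_apply, smul_eq_mul, phase]
      simp
    have hG2 : ∀ x, 𝓕 G x = 𝓕 g (x - h) := by
      intro x
      refine (Real.fourier_eq (G : R3 → ℂ) x).trans
        (Eq.trans ?_ (Real.fourier_eq (g : R3 → ℂ) (x - h)).symm)
      congr 1; ext ξ
      rw [hG, Circle.smul_def, Circle.smul_def, Real.fourierChar_apply, Real.fourierChar_apply,
        smul_eq_mul, smul_eq_mul, ← mul_assoc, phase, ← Complex.exp_add]
      congr 2
      rw [inner_sub_right, real_inner_comm h ξ]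
      push_cast; ring
    calc ∫ ξ, g ξ * (phase h ξ * ft2 f ξ) = ∫ ξ, G ξ * ft2 f ξ := by
          congr 1; ext ξ; rw [hG]; ring
      _ = ∫ x, 𝓕 g (x - h) * f x := by
          rw [integral_mul_ft2 hf]; simp_rw [hG2]
      _ = _ := by
          rw [← integral_add_right_eq_self _ h]
          simp

/-- A multiplier commutes with translations: the two arguments acquire the same unimodular phase,
and it cancels. -/
theorem bform_translate {l₁ l₂ : ℝ} {f g : R3 → ℂ} (hf : MemLp f 2) (hg : MemLp g 2) (h : R3) :
    bform (symbolA l₁ l₂) (fun x => f (x + h)) (fun x => g (x + h))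
      = bform (symbolA l₁ l₂) f g := by
  apply integral_congr_ae
  filter_upwards [ft2_translate hf h, ft2_translate hg h] with ξ h1 h2
  rw [h1, h2, star_mul']
  have : phase h ξ * star (phase h ξ) = 1 := by
    rw [Complex.star_def, Complex.mul_conj, Complex.normSq_eq_norm_sq, norm_phase]; simp
  linear_combination (↑(symbolA l₁ l₂ ξ) * (ft2 f ξ * star (ft2 g ξ))) * this

end DipolarGPE

end

noncomputable section

namespace DipolarGPE

open FourierTransform SchwartzMap LineDeriv

/-! ### The weak formulation -/

/-- The density `|u|²`, as a complex valued function. -/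
def dens (u : R3 → ℂ) (x : R3) : ℂ := ((‖u x‖ ^ 2 : ℝ) : ℂ)

/-- The Dirichlet form `∫ ∇u · conj ∇φ`. -/
def gradForm (u φ : R3 → ℂ) : ℂ := ∑ i : Fin 3, ∫ x, weakPartial i u x * star (weakPartial i φ x)

/-- The left-hand side of the stationary equation, tested with `φ`. -/
def weakForm (l₁ l₂ l₃ β : ℝ) (u φ : R3 → ℂ) : ℂ :=
  (1 / 2 : ℂ) * gradForm u φ + bform (symbolA l₁ l₂) (dens u) (fun x => star (u x) * φ x)
    + (l₃ : ℂ) * (∫ x, ((‖u x‖ ^ 3 : ℝ) : ℂ) * u x * star (φ x))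
    + (β : ℂ) * (∫ x, u x * star (φ x))

theorem MemH1.memLp_normSq {u : R3 → ℂ} (hu : MemH1 u) : MemLp (fun x => ‖u x‖ ^ 2) 2 :=
  memLp_norm_sq hu.1 hu.memLp_six

theorem MemH1.memLp_dens {u : R3 → ℂ} (hu : MemH1 u) : MemLp (dens u) 2 :=
  hu.memLp_normSq.ofReal

theorem MemH1.memLp_star_mul {u v : R3 → ℂ} (hu : MemH1 u) (hv : MemH1 v) :
    MemLp (fun x => star (u x) * v x) 2 :=
  (memLp_norm_mul_norm hu.1 hu.memLp_six hv.1 hv.memLp_six).congr_norm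
    (hu.1.1.star.mul hv.1.1) (ae_of_all _ fun x => by simp)

/-- The cubic and the dipolar terms merge into one multiplier form. Since the form is conjugate
linear in its second argument, the test function there is conj(u) φ, whose conjugate is u conj(φ).
-/
theorem IsSolution.weakForm_eq_zero {l₁ l₂ l₃ β : ℝ} {u : R3 → ℂ} (h : IsSolution l₁ l₂ l₃ u β)
    {φ : R3 → ℂ} (hφ : MemH1 φ) : weakForm l₁ l₂ l₃ β u φ = 0 := by
  obtain ⟨hu, W, hW, heq⟩ := h
  have e := bform_isConvK (l₁ := l₁) (l₂ := l₂) (integrable_norm_sq hu.1) hu.memLp_normSq hW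
    (hu.memLp_star_mul hφ)
  have e1 := heq φ hφ
  unfold weakForm
  have e2 : bform (symbolA l₁ l₂) (dens u) (fun x => star (u x) * φ x)
      = bform (symbolA l₁ l₂) (fun x => ((‖u x‖ ^ 2 : ℝ) : ℂ)) (fun x => star (u x) * φ x) := rfl
  rw [e2, ← e, gradForm, ← e1]
  simp_rw [star_mul', star_star, mul_assoc]
  ring

/-! ### Difference quotients -/

theorem gradForm_translate {u φ : R3 → ℂ} (hu : MemH1 u) (hφ : MemH1 φ) (h : R3) :
    gradForm (fun x => u (x + h)) (fun x => φ (x + h)) = gradForm u φ := by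
  unfold gradForm
  refine Finset.sum_congr rfl fun i _ => ?_
  rw [← integral_add_right_eq_self (fun x => weakPartial i u x * star (weakPartial i φ x)) h]
  apply integral_congr_ae
  filter_upwards [weakPartial_translate hu h i, weakPartial_translate hφ h i] with x h1 h2
  rw [h1, h2]

theorem weakForm_translate {l₁ l₂ l₃ β : ℝ} {u φ : R3 → ℂ} (hu : MemH1 u) (hφ : MemH1 φ) (h : R3) :
    weakForm l₁ l₂ l₃ β (fun x => u (x + h)) (fun x => φ (x + h)) = weakForm l₁ l₂ l₃ β u φ := by
  unfold weakForm
  rw [gradForm_translate hu hφ h]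
  have e1 := bform_translate (l₁ := l₁) (l₂ := l₂) hu.memLp_dens (hu.memLp_star_mul hφ) h
  have e2 := integral_add_right_eq_self (μ := volume)
    (fun x => ((‖u x‖ ^ 3 : ℝ) : ℂ) * u x * star (φ x)) h
  have e3 := integral_add_right_eq_self (μ := volume) (fun x => u x * star (φ x)) h
  rw [e2, e3, ← e1]
  rfl

theorem integrable_mul_star {f g : R3 → ℂ} (hf : MemLp f 2) (hg : MemLp g 2) :
    Integrable fun x => f x * star (g x) :=
  integrable_of_norm_le_mul hf hg (hf.1.mul hg.1.star)
    (ae_of_all _ fun x => ((norm_mul _ _).trans (by rw [norm_star])).le)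

theorem gradForm_sub_left {u v φ : R3 → ℂ} (hu : MemH1 u) (hv : MemH1 v) (hφ : MemH1 φ) :
    gradForm (fun x => u x - v x) φ = gradForm u φ - gradForm v φ := by
  unfold gradForm
  rw [← Finset.sum_sub_distrib]
  refine Finset.sum_congr rfl fun i _ => ?_
  rw [← integral_sub (integrable_mul_star (weakPartial_spec hu i).1 (weakPartial_spec hφ i).1)
    (integrable_mul_star (weakPartial_spec hv i).1 (weakPartial_spec hφ i).1)]
  apply integral_congr_ae
  filter_upwards [weakPartial_sub hu hv i] with x h1
  rw [h1]; ring

theorem gradForm_self (u : R3 → ℂ) : gradForm u u = (funA u : ℂ) := by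
  unfold gradForm funA
  push_cast
  refine Finset.sum_congr rfl fun i _ => ?_
  rw [← integral_complex_ofReal]
  congr 1; ext x
  rw [Complex.star_def, Complex.mul_conj, Complex.normSq_eq_norm_sq]

theorem funA_nonneg (u : R3 → ℂ) : 0 ≤ funA u :=
  Finset.sum_nonneg fun _ _ => integral_nonneg fun _ => by positivity

theorem sq_gradNorm_le (u : R3 → ℂ) : gradNorm u ^ 2 ≤ 3 * funA u := by
  have h : funA u = ∑ i, l2norm (weakPartial i u) ^ 2 :=
    Finset.sum_congr rfl fun i _ => (sq_l2norm _).symm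
  rw [h, gradNorm]
  simpa using sq_sum_le_card_mul_sum_sq (s := Finset.univ) (f := fun i => l2norm (weakPartial i u))

theorem norm_cube_mul_sub_le (a b : ℂ) :
    ‖((‖a‖ ^ 3 : ℝ) : ℂ) * a - ((‖b‖ ^ 3 : ℝ) : ℂ) * b‖
      ≤ ‖a - b‖ * (2 * (‖a‖ ^ 3 + ‖b‖ ^ 3)) := by
  have e : ((‖a‖ ^ 3 : ℝ) : ℂ) * a - ((‖b‖ ^ 3 : ℝ) : ℂ) * b
      = ((‖a‖ ^ 3 : ℝ) : ℂ) * (a - b) + ((‖a‖ ^ 3 - ‖b‖ ^ 3 : ℝ) : ℂ) * b := by push_cast; ring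
  rw [e]
  refine (norm_add_le _ _).trans ?_
  rw [norm_mul, norm_mul, Complex.norm_real, Complex.norm_real, Real.norm_of_nonneg (by positivity)]
  have h1 : ‖‖a‖ ^ 3 - ‖b‖ ^ 3‖ ≤ ‖a - b‖ * (‖a‖ ^ 2 + ‖a‖ * ‖b‖ + ‖b‖ ^ 2) := by
    rw [show ‖a‖ ^ 3 - ‖b‖ ^ 3 = (‖a‖ - ‖b‖) * (‖a‖ ^ 2 + ‖a‖ * ‖b‖ + ‖b‖ ^ 2) by ring, norm_mul,
      Real.norm_of_nonneg (by positivity : 0 ≤ ‖a‖ ^ 2 + ‖a‖ * ‖b‖ + ‖b‖ ^ 2)]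
    gcongr
    exact abs_norm_sub_norm_le a b
  have h2 : (‖a‖ ^ 2 + ‖a‖ * ‖b‖ + ‖b‖ ^ 2) * ‖b‖ ≤ ‖a‖ ^ 3 + 2 * ‖b‖ ^ 3 := by
    nlinarith [mul_nonneg (add_nonneg (norm_nonneg a) (norm_nonneg b)) (sq_nonneg (‖a‖ - ‖b‖))]
  have h3 := mul_le_mul_of_nonneg_right h1 (norm_nonneg b)
  have h4 := mul_le_mul_of_nonneg_left h2 (norm_nonneg (a - b))
  nlinarith

theorem abs_normSq_sub_le (a b : ℂ) : ‖((‖a‖ ^ 2 : ℝ) : ℂ) - ((‖b‖ ^ 2 : ℝ) : ℂ)‖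
    ≤ ‖a - b‖ * (‖a‖ + ‖b‖) := by
  rw [← Complex.ofReal_sub, Complex.norm_real,
    show ‖a‖ ^ 2 - ‖b‖ ^ 2 = (‖a‖ - ‖b‖) * (‖a‖ + ‖b‖) by ring, norm_mul,
    Real.norm_of_nonneg (by positivity : 0 ≤ ‖a‖ + ‖b‖)]
  gcongr
  exact abs_norm_sub_norm_le a b

/-! ### Lipschitz bounds for the nonlinear terms -/

section Lipschitz

variable {l₁ l₂ l₃ β : ℝ} {u v φ : R3 → ℂ}

theorem l2norm_dens_sub_le (hu : MemH1 u) (hv : MemH1 v) :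
    l2norm (fun x => dens u x - dens v x)
      ≤ l2norm (fun x => ‖u x - v x‖ * ‖u x‖) + l2norm (fun x => ‖u x - v x‖ * ‖v x‖) := by
  have hd := hu.sub hv
  have m1 := memLp_norm_mul_norm hd.1 hd.memLp_six hu.1 hu.memLp_six
  have m2 := memLp_norm_mul_norm hd.1 hd.memLp_six hv.1 hv.memLp_six
  refine (l2norm_mono (m1.add m2) (ae_of_all _ fun x => ?_)).trans (l2norm_add_le m1 m2)
  refine (abs_normSq_sub_le _ _).trans ?_
  rw [mul_add]
  exact le_abs_self _

/-- The nonlocal term is Lipschitz in `u`. -/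
theorem norm_bform_dens_sub_le (hu : MemH1 u) (hv : MemH1 v) (hφ : MemH1 φ) :
    ‖bform (symbolA l₁ l₂) (dens u) (fun x => star (u x) * φ x)
        - bform (symbolA l₁ l₂) (dens v) (fun x => star (v x) * φ x)‖
      ≤ boundA l₁ l₂ * ((l2norm (fun x => ‖u x - v x‖ * ‖u x‖)
          + l2norm (fun x => ‖u x - v x‖ * ‖v x‖)) * l2norm (fun x => ‖u x‖ * ‖φ x‖)
        + l2norm (dens v) * l2norm (fun x => ‖u x - v x‖ * ‖φ x‖)) := by
  have hd := hu.sub hv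
  have e1 := bform_sub_left (l₁ := l₁) (l₂ := l₂) hu.memLp_dens hv.memLp_dens
    (hu.memLp_star_mul hφ)
  have e2 := bform_sub_right (l₁ := l₁) (l₂ := l₂) hv.memLp_dens (hu.memLp_star_mul hφ)
    (hv.memLp_star_mul hφ)
  have e : bform (symbolA l₁ l₂) (dens u) (fun x => star (u x) * φ x)
        - bform (symbolA l₁ l₂) (dens v) (fun x => star (v x) * φ x)
      = bform (symbolA l₁ l₂) (fun x => dens u x - dens v x) (fun x => star (u x) * φ x)
        + bform (symbolA l₁ l₂) (dens v) (fun x => star (u x) * φ x - star (v x) * φ x) := by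
    rw [e1, e2]; ring
  rw [e, mul_add]
  refine (norm_add_le _ _).trans (add_le_add ?_ ?_)
  · refine (norm_bform_le (hu.memLp_dens.sub hv.memLp_dens) (hu.memLp_star_mul hφ)).trans ?_
    refine mul_le_mul_of_nonneg_left ?_ (boundA_nonneg _ _)
    refine mul_le_mul (l2norm_dens_sub_le hu hv) (le_of_eq ?_) (l2norm_nonneg _)
      (add_nonneg (l2norm_nonneg _) (l2norm_nonneg _))
    exact l2norm_congr_norm (ae_of_all _ fun x => by simp)
  · refine (norm_bform_le hv.memLp_dens
      ((hu.memLp_star_mul hφ).sub (hv.memLp_star_mul hφ))).trans ?_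
    refine mul_le_mul_of_nonneg_left ?_ (boundA_nonneg _ _)
    refine mul_le_mul_of_nonneg_left (le_of_eq ?_) (l2norm_nonneg _)
    refine l2norm_congr_norm (ae_of_all _ fun x => ?_)
    simp only [Pi.sub_apply]
    rw [← sub_mul, ← star_sub, norm_mul, norm_star]; simp

theorem integrable_cube_mul (hu : MemH1 u) (hφ : MemH1 φ) :
    Integrable fun x => ((‖u x‖ ^ 3 : ℝ) : ℂ) * u x * star (φ x) := by
  refine integrable_of_norm_le_mul (memLp_norm_pow_three hu.memLp_six)
    (hu.memLp_star_mul hφ) ?_ (ae_of_all _ fun x => ?_)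
  · exact (((Complex.continuous_ofReal.comp_aestronglyMeasurable
      (hu.1.1.norm.pow 3)).mul hu.1.1).mul hφ.1.1.star)
  · simp [mul_assoc]

/-- The local term is Lipschitz in `u`. -/
theorem norm_integral_cube_sub_le (hu : MemH1 u) (hv : MemH1 v) (hφ : MemH1 φ) :
    ‖(∫ x, ((‖u x‖ ^ 3 : ℝ) : ℂ) * u x * star (φ x))
        - ∫ x, ((‖v x‖ ^ 3 : ℝ) : ℂ) * v x * star (φ x)‖
      ≤ 2 * ((l2norm (fun x => ‖u x‖ ^ 3) + l2norm (fun x => ‖v x‖ ^ 3))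
          * l2norm (fun x => ‖u x - v x‖ * ‖φ x‖)) := by
  have hd := hu.sub hv
  have m1 := memLp_norm_pow_three hu.memLp_six
  have m2 := memLp_norm_pow_three hv.memLp_six
  have m3 := memLp_norm_mul_norm hd.1 hd.memLp_six hφ.1 hφ.memLp_six
  rw [← integral_sub (integrable_cube_mul hu hφ) (integrable_cube_mul hv hφ)]
  have := norm_integral_le_l2norm_mul (h := fun x => ((‖u x‖ ^ 3 : ℝ) : ℂ) * u x * star (φ x)
      - ((‖v x‖ ^ 3 : ℝ) : ℂ) * v x * star (φ x)) ((m1.add m2).const_mul 2) m3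
      (ae_of_all _ fun x => ?_)
  · refine this.trans ?_
    simp only [Pi.add_apply]
    rw [l2norm_const_mul, abs_two, mul_assoc]
    gcongr
    · exact l2norm_nonneg _
    · exact l2norm_add_le m1 m2
  · rw [← sub_mul, norm_mul, norm_star]
    refine (mul_le_mul_of_nonneg_right (norm_cube_mul_sub_le _ _) (norm_nonneg _)).trans ?_
    simp only [Pi.add_apply, norm_mul, norm_norm, Real.norm_two]
    rw [Real.norm_of_nonneg (by positivity : 0 ≤ ‖u x‖ ^ 3 + ‖v x‖ ^ 3)]
    apply le_of_eq; ring

end Lipschitz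

/-! ### Second order regularity -/

/-- Absorption: if G exceeded the stated multiple of d, the second inequality would give X ≤ G²/2.
Then G² ≤ 2b d² would follow from the first, a contradiction. -/
theorem le_mul_of_sq_le {G d X b c : ℝ} (hG : 0 ≤ G) (hd : 0 ≤ d) (hb : 0 ≤ b) (hc : 0 ≤ c)
    (h1 : G ^ 2 ≤ X + b * d ^ 2) (h2 : X ^ 2 ≤ c * (d * G ^ 3)) :
    G ≤ (4 * c + √(2 * b)) * d := by
  by_contra hlt
  push Not at hlt
  have hs := Real.sqrt_nonneg (2 * b)
  have hs2 := Real.sq_sqrt (by positivity : 0 ≤ 2 * b)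
  have hG0 : 0 < G := lt_of_le_of_lt (by positivity) hlt
  have hcd : 4 * c * d ≤ G := by nlinarith [mul_nonneg hs hd]
  have hX2 : X ^ 2 ≤ (G ^ 2 / 2) ^ 2 := by
    nlinarith [mul_le_mul_of_nonneg_right hcd (pow_nonneg hG 3)]
  have hX : X ≤ G ^ 2 / 2 := le_of_sq_le_sq hX2 (by positivity)
  have hG2 : G ^ 2 ≤ (√(2 * b) * d) ^ 2 := by rw [mul_pow, hs2]; linarith
  have := le_of_sq_le_sq hG2 (by positivity)
  nlinarith [mul_nonneg hc hd]

/-- Difference quotient argument. Subtract the equations for u and its translate and test with their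
difference δ. The norms of |u|² and |u|³ are translation invariant, so the nonlinear terms are at
most a constant times ‖δ‖₄², which Gagliardo–Nirenberg bounds by ‖δ‖₂^(1/2) times the gradient norm
to the power 3/2. This is absorbed by the kinetic term, with a constant independent of the shift. -/
theorem IsSolution.exists_gradNorm_translate_sub_le {l₁ l₂ l₃ β : ℝ} {u : R3 → ℂ}
    (hs : IsSolution l₁ l₂ l₃ u β) : ∃ C : ℝ, 0 ≤ C ∧ ∀ h : R3,
      gradNorm (fun x => u (x + h) - u x) ≤ C * l2norm (fun x => u (x + h) - u x) := by
  obtain ⟨S, hS, hSob⟩ := exists_sq_l2norm_sq_le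
  have hu := hs.1
  set M := boundA l₁ l₂ with hM
  have hM0 : 0 ≤ M := boundA_nonneg _ _
  set N := l2norm (fun x => ‖u x‖ ^ 2) with hN
  have hN0 : 0 ≤ N := l2norm_nonneg _
  set P := l2norm (fun x => ‖u x‖ ^ 3) with hP
  have hP0 : 0 ≤ P := l2norm_nonneg _
  -- The factor 6 combines the 2 that clears the coefficient ½ of the kinetic term with the 3 of
  -- `sq_gradNorm_le`.
  set K := 6 * (3 * M * N + 4 * |l₃| * P) with hK
  have hK0 : 0 ≤ K := by positivity
  refine ⟨4 * (K ^ 2 * S) + √(2 * (6 * |β|)), by positivity, fun h => ?_⟩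
  set v : R3 → ℂ := fun x => u (x + h) with hv
  have hv1 : MemH1 v := hu.translate h
  set δ : R3 → ℂ := fun x => v x - u x with hδ
  have hδ1 : MemH1 δ := hv1.sub hu
  set d := l2norm δ with hd
  have hd0 : 0 ≤ d := l2norm_nonneg _
  set L := l2norm (fun x => ‖δ x‖ ^ 2) with hL
  have hL0 : 0 ≤ L := l2norm_nonneg _
  have z1 := hs.weakForm_eq_zero hδ1
  have z2 : weakForm l₁ l₂ l₃ β v δ = 0 := by
    rw [← hs.weakForm_eq_zero (hδ1.translate (-h)), ← weakForm_translate hu (hδ1.translate (-h)) h]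
    simp [hv]
  have hNv : l2norm (fun x => ‖v x‖ ^ 2) = N := l2norm_translate (fun x => ‖u x‖ ^ 2) h
  have hPv : l2norm (fun x => ‖v x‖ ^ 3) = P := l2norm_translate (fun x => ‖u x‖ ^ 3) h
  have hdens : l2norm (dens u) = N := l2norm_congr_norm (ae_of_all _ fun x => by simp [dens])
  have b1 := norm_bform_dens_sub_le (l₁ := l₁) (l₂ := l₂) hv1 hu hδ1
  have b2 := norm_integral_cube_sub_le hv1 hu hδ1
  have q1 := sq_l2norm_mul_le hδ1.1 hδ1.memLp_six hv1.1 hv1.memLp_six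
  have q2 := sq_l2norm_mul_le hδ1.1 hδ1.memLp_six hu.1 hu.memLp_six
  have q3 : l2norm (fun x => ‖v x - u x‖ * ‖δ x‖) = L := by
    refine l2norm_congr_norm (ae_of_all _ fun x => ?_)
    simp [hδ, sq]
  have q4 : l2norm (fun x => ‖v x‖ * ‖δ x‖) = l2norm (fun x => ‖δ x‖ * ‖v x‖) := by
    simp_rw [mul_comm]
  rw [q3, q4, hdens] at b1
  rw [q3, hPv] at b2
  rw [hNv] at q1
  set a := l2norm (fun x => ‖δ x‖ * ‖v x‖) with ha
  set b := l2norm (fun x => ‖δ x‖ * ‖u x‖) with hb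
  have b1' : ‖bform (symbolA l₁ l₂) (dens v) (fun x => star (v x) * δ x)
        - bform (symbolA l₁ l₂) (dens u) (fun x => star (u x) * δ x)‖ ≤ 3 * M * N * L := by
    refine b1.trans ?_
    have : (a + b) * a + N * L ≤ 3 * (N * L) := by nlinarith [sq_nonneg (a - b)]
    calc M * ((a + b) * a + N * L) ≤ M * (3 * (N * L)) := mul_le_mul_of_nonneg_left this hM0
      _ = _ := by ring
  have key : (1 / 2 : ℂ) * (funA δ : ℂ) =
      -(bform (symbolA l₁ l₂) (dens v) (fun x => star (v x) * δ x)
        - bform (symbolA l₁ l₂) (dens u) (fun x => star (u x) * δ x))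
      - (l₃ : ℂ) * ((∫ x, ((‖v x‖ ^ 3 : ℝ) : ℂ) * v x * star (δ x))
        - ∫ x, ((‖u x‖ ^ 3 : ℝ) : ℂ) * u x * star (δ x))
      - (β : ℂ) * ∫ x, δ x * star (δ x) := by
    have g1 := gradForm_sub_left hv1 hu hδ1
    have g2 : ∫ x, δ x * star (δ x) = (∫ x, v x * star (δ x)) - ∫ x, u x * star (δ x) := by
      rw [← integral_sub (integrable_mul_star hv1.1 hδ1.1) (integrable_mul_star hu.1 hδ1.1)]
      simp_rw [← sub_mul]
      rfl
    rw [← gradForm_self, show gradForm δ δ = gradForm v δ - gradForm u δ from g1, g2]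
    unfold weakForm at z1 z2
    linear_combination z2 - z1
  have hA : funA δ / 2 ≤ 3 * M * N * L + |l₃| * (2 * ((P + P) * L)) + |β| * d ^ 2 := by
    have n1 : ‖(1 / 2 : ℂ) * (funA δ : ℂ)‖ = funA δ / 2 := by
      rw [norm_mul, Complex.norm_real, Real.norm_of_nonneg (funA_nonneg _)]; simp; ring
    have n2 : ‖∫ x, δ x * star (δ x)‖ ≤ d ^ 2 := by
      rw [sq]
      exact norm_integral_le_l2norm_mul hδ1.1 hδ1.1
        (ae_of_all _ fun x => ((norm_mul _ _).trans (by rw [norm_star])).le)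
    rw [← n1, key]
    refine (norm_sub_le _ _).trans (add_le_add ((norm_sub_le _ _).trans (add_le_add ?_ ?_)) ?_)
    · rw [norm_neg]; exact b1'
    · rw [norm_mul, Complex.norm_real]
      exact mul_le_mul_of_nonneg_left b2 (norm_nonneg _)
    · rw [norm_mul, Complex.norm_real]
      exact mul_le_mul_of_nonneg_left n2 (norm_nonneg _)
  have hG := sq_gradNorm_le δ
  refine le_mul_of_sq_le (X := K * L) (gradNorm_nonneg δ) hd0 (by positivity) (by positivity) ?_ ?_
  · rw [hK]; nlinarith
  · have := hSob δ hδ1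
    calc (K * L) ^ 2 = K ^ 2 * L ^ 2 := by ring
      _ ≤ K ^ 2 * (S * (d * gradNorm δ ^ 3)) := mul_le_mul_of_nonneg_left this (by positivity)
      _ = _ := by ring

theorem memLp_norm_mul_ft2 {u : R3 → ℂ} (hu : MemH1 u) :
    MemLp (fun ξ => ‖ξ‖ • ft2 u ξ) 2 := by
  refine memLp_two_of_sq_le (continuous_norm.aestronglyMeasurable.smul (memLp_ft2 hu.1).1)
    (integrable_finsetSum Finset.univ fun i _ => integrable_norm_sq (memLp_coord_ft2 hu i))
    fun ξ => ?_
  rw [norm_smul, mul_pow, norm_norm, norm_sq_eq_sum]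
  simp [mul_pow, Fin.sum_univ_three]
  apply le_of_eq; ring

theorem l2norm_translate_sub_le {u : R3 → ℂ} (hu : MemH1 u) (h : R3) :
    l2norm (fun x => u (x + h) - u x) ≤ 2 * Real.pi * ‖h‖ * l2norm (fun ξ => ‖ξ‖ • ft2 u ξ) := by
  have hpi := Real.pi_pos
  rw [← l2norm_ft2 (u := fun x => u (x + h) - u x) ((memLp_translate hu.1 h).sub hu.1),
    ← abs_of_nonneg (by positivity : 0 ≤ 2 * Real.pi * ‖h‖), ← l2norm_const_smul]
  refine l2norm_mono ((memLp_norm_mul_ft2 hu).const_smul _) ?_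
  filter_upwards [ft2_sub (memLp_translate hu.1 h) hu.1, ft2_translate hu.1 h] with ξ h1 h2
  rw [h1, h2, ← sub_one_mul, norm_mul, norm_smul, norm_smul, ← mul_assoc]
  gcongr
  rw [Real.norm_of_nonneg (by positivity), norm_norm, mul_assoc]
  exact norm_phase_sub_one_le h ξ

/-- On the Fourier side the difference quotient of step t in direction k multiplies by (phase -
1)/t, which tends to 2πi ξₖ. The previous bound makes the first derivatives of these quotients
uniformly bounded in L², and Fatou's lemma passes this to the limit. -/
theorem IsSolution.memLp_coord_coord_ft2 {l₁ l₂ l₃ β : ℝ} {u : R3 → ℂ}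
    (hs : IsSolution l₁ l₂ l₃ u β) (i k : Fin 3) :
    MemLp (fun ξ => (ξ i * ξ k) • ft2 u ξ) 2 := by
  obtain ⟨C, hC, hb⟩ := hs.exists_gradNorm_translate_sub_le
  have hu := hs.1
  have hpi := Real.pi_pos
  have hc : Continuous fun ξ : R3 => ξ i * ξ k := by fun_prop
  refine ⟨hc.aestronglyMeasurable.smul (memLp_ft2 hu.1).1, ?_⟩
  set D := C * (2 * Real.pi * l2norm (fun ξ => ‖ξ‖ • ft2 u ξ)) / (2 * Real.pi) / (2 * Real.pi)
    with hD
  set t : ℕ → ℝ := fun n => 1 / ((n : ℝ) + 1) with ht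
  have ht0 : ∀ n, 0 < t n := fun n => by simp only [ht]; positivity
  -- Up to a constant of modulus one and powers of 2π, the transform of the i-th derivative of the
  -- difference quotient in direction k.
  let F : ℕ → R3 → ℂ := fun n ξ =>
    ((2 * Real.pi * t n)⁻¹ * ξ i) • ((phase (t n • e3 k) ξ - 1) * ft2 u ξ)
  have hF : ∀ n, AEStronglyMeasurable (F n) volume := fun n =>
    (Continuous.aestronglyMeasurable (f := fun ξ : R3 => (2 * Real.pi * t n)⁻¹ * ξ i)
      (by fun_prop)).smul
      (((continuous_phase _).sub continuous_const).aestronglyMeasurable.mul (memLp_ft2 hu.1).1)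
  have hlim : ∀ ξ, Tendsto (fun n => F n ξ) atTop
      (𝓝 (((ξ i : ℂ) * (Complex.I * ξ k)) * ft2 u ξ)) := by
    intro ξ
    have hder : HasDerivAt (fun s : ℝ => phase (s • e3 k) ξ)
        (((2 * Real.pi * ξ k : ℝ) : ℂ) * Complex.I) 0 := by
      have h1 : HasDerivAt (fun s : ℝ => ((2 * Real.pi * inner ℝ (s • e3 k) ξ : ℝ) : ℂ) * Complex.I)
          (((2 * Real.pi * ξ k : ℝ) : ℂ) * Complex.I) 0 := by
        have h2 : HasDerivAt (fun s : ℝ => 2 * Real.pi * inner ℝ (s • e3 k) ξ)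
            (2 * Real.pi * ξ k) 0 := by
          have := ((hasDerivAt_id (0 : ℝ)).mul_const (ξ k)).const_mul (2 * Real.pi)
          simpa [inner_smul_left, EuclideanSpace.inner_single_left] using this
        exact h2.ofReal_comp.mul_const Complex.I
      simpa [phase] using h1.cexp
    have hsl := hder.tendsto_slope_zero
    have htz : Tendsto t atTop (𝓝[≠] 0) := by
      refine tendsto_nhdsWithin_iff.mpr ⟨tendsto_one_div_add_atTop_nhds_zero_nat,
        Eventually.of_forall fun n => (ht0 n).ne'⟩
    have := ((hsl.comp htz).const_mul ((ξ i : ℂ) * (2 * Real.pi : ℂ)⁻¹)).mul_const (ft2 u ξ)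
    refine (this.congr fun n => ?_).trans_eq ?_
    · simp [F, phase]; ring
    · congr 1
      push_cast
      have : (Real.pi : ℂ) ≠ 0 := by exact_mod_cast hpi.ne'
      field_simp
  have hbound : ∀ n, eLpNorm (F n) 2 volume ≤ ENNReal.ofReal D := by
    intro n
    have hw : MemH1 fun x => u (x + t n • e3 k) - u x := (hu.translate _).sub hu
    have e1 : l2norm (weakPartial i fun x => u (x + t n • e3 k) - u x)
        ≤ C * (2 * Real.pi * t n * l2norm (fun ξ => ‖ξ‖ • ft2 u ξ)) := by
      refine le_trans ?_ ((hb (t n • e3 k)).trans (mul_le_mul_of_nonneg_left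
        ((l2norm_translate_sub_le hu _).trans_eq ?_) hC))
      · exact Finset.single_le_sum (f := fun i => l2norm (weakPartial i _))
          (fun _ _ => l2norm_nonneg _) (Finset.mem_univ i)
      · rw [norm_smul, Real.norm_of_nonneg (ht0 n).le]; simp
    have hae : ∀ᵐ ξ, ‖F n ξ‖ = ‖((2 * Real.pi * (2 * Real.pi * t n))⁻¹ : ℝ) •
        ft2 (weakPartial i fun x => u (x + t n • e3 k) - u x) ξ‖ := by
      filter_upwards [ft2_weakPartial hw i, ft2_sub (memLp_translate hu.1 (t n • e3 k)) hu.1,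
        ft2_translate hu.1 (t n • e3 k)] with ξ h1 h2 h3
      rw [h1, h2, h3]
      simp only [F]
      rw [← sub_one_mul, norm_smul, norm_smul, norm_mul (2 * (Real.pi : ℂ) * Complex.I * _)]
      have := ht0 n
      simp [abs_of_pos hpi, abs_of_pos this]
      field_simp
    have m2 := (memLp_ft2 (weakPartial_spec hw i).1).const_smul
      ((2 * Real.pi * (2 * Real.pi * t n))⁻¹ : ℝ)
    rw [eLpNorm_congr_norm_ae hae]
    refine (eLpNorm_two_eq_ofReal m2).trans_le (ENNReal.ofReal_le_ofReal ?_)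
    have e2 := l2norm_const_smul ((2 * Real.pi * (2 * Real.pi * t n))⁻¹ : ℝ)
      (ft2 (weakPartial i fun x => u (x + t n • e3 k) - u x))
    refine e2.trans_le ?_
    have := ht0 n
    rw [l2norm_ft2 (weakPartial_spec hw i).1, abs_of_pos (by positivity), inv_mul_le_iff₀
      (by positivity)]
    refine e1.trans_eq ?_
    rw [hD]; field_simp
  have := eLpNorm_le_of_ae_tendsto hF (ae_of_all _ hlim) hbound tendsto_const_nhds
  refine lt_of_le_of_lt (le_of_eq ?_) (this.trans_lt ENNReal.ofReal_lt_top)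
  refine eLpNorm_congr_norm_ae (ae_of_all _ fun ξ => ?_)
  simp

/-- Solutions are in `H²`. -/
theorem IsSolution.memLp_weight {l₁ l₂ l₃ β : ℝ} {u : R3 → ℂ}
    (hs : IsSolution l₁ l₂ l₃ u β) : MemLp (fun ξ => (1 + ‖ξ‖ ^ 2) ^ (1 : ℝ) • ft2 u ξ) 2 := by
  have h1 := memLp_ft2 hs.1.1
  have h2 := ((hs.memLp_coord_coord_ft2 0 0).add (hs.memLp_coord_coord_ft2 1 1)).add
    (hs.memLp_coord_coord_ft2 2 2)
  refine (h1.add h2).congr_norm ?_ (ae_of_all _ fun ξ => ?_)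
  · exact (Continuous.aestronglyMeasurable (f := fun ξ : R3 => (1 + ‖ξ‖ ^ 2) ^ (1 : ℝ))
      (by simp only [Real.rpow_one]; fun_prop)).smul h1.1
  · congr 1
    simp only [Pi.add_apply, Real.rpow_one]
    rw [norm_sq_eq_sum]
    simp only [add_smul, one_smul, sq]

end DipolarGPE

end

noncomputable section

namespace DipolarGPE

open FourierTransform SchwartzMap LineDeriv

/-! ### The Fourier transform of a product -/

/-- The product of two Schwartz functions. -/
def mulS (p q : 𝓢(R3, ℂ)) : 𝓢(R3, ℂ) := pairing (ContinuousLinearMap.mul ℂ ℂ) p q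

@[simp]
theorem mulS_apply (p q : 𝓢(R3, ℂ)) (x : R3) : mulS p q x = p x * q x := by
  simp [mulS, pairing_apply_apply]

theorem fourier_apply_eq (p : 𝓢(R3, ℂ)) (ξ : R3) :
    𝓕 p ξ = ∫ x, Complex.exp (((-2 * Real.pi * inner ℝ x ξ : ℝ) : ℂ) * Complex.I) * p x := by
  have := Real.fourier_eq' (p : R3 → ℂ) ξ
  rw [fourier_coe, this]
  simp only [smul_eq_mul]

theorem fourier_fourier_apply (g : 𝓢(R3, ℂ)) (x : R3) : 𝓕 (𝓕 g) x = g (-x) := by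
  have h : 𝓕⁻ (𝓕 g) (-x) = g (-x) := by rw [fourierInv_fourier_eq]
  rw [← h, fourierInv_apply_eq]
  simp

/-- The shifted transform η ↦ 𝓕 p (ξ - η) is itself the transform of a modulated reflection of p.
The flip formula and 𝓕𝓕 g(x) = g(-x) then give the convolution. -/
theorem fourier_mulS (p g : 𝓢(R3, ℂ)) (ξ : R3) :
    𝓕 (mulS p g) ξ = ∫ η, 𝓕 p (ξ - η) * 𝓕 g η := by
  let h : R3 → ℂ := fun x =>
    Complex.exp (((2 * Real.pi * inner ℝ x ξ : ℝ) : ℂ) * Complex.I) * p (-x)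
  have hexp : ∀ x, ‖Complex.exp (((2 * Real.pi * inner ℝ x ξ : ℝ) : ℂ) * Complex.I)‖ = 1 :=
    fun x => Complex.norm_exp_ofReal_mul_I _
  have hh : Integrable h := by
    refine p.integrable.comp_neg.norm.mono' ?_ (ae_of_all _ fun x => ?_)
    · exact Continuous.aestronglyMeasurable
        ((by fun_prop : Continuous fun x : R3 =>
          Complex.exp (((2 * Real.pi * inner ℝ x ξ : ℝ) : ℂ) * Complex.I)).mul
          (p.continuous.comp continuous_neg))
    · simp only [h]; rw [norm_mul, hexp, one_mul]
  have h1 : ∀ η, 𝓕 h η = 𝓕 p (ξ - η) := by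
    intro η
    rw [fourier_apply_eq, Real.fourier_eq', ← integral_neg_eq_self]
    congr 1; ext x
    simp only [h, smul_eq_mul, neg_neg]
    rw [← mul_assoc, ← Complex.exp_add]
    congr 2
    simp only [inner_neg_left, inner_sub_right]
    push_cast; ring
  have h2 := integral_fourier_mul_eq_flip (𝓕 g).integrable hh
  simp_rw [h1] at h2
  rw [fourier_apply_eq, ← integral_neg_eq_self]
  calc _ = ∫ x, 𝓕 (𝓕 g) x * h x := by
        congr 1; ext x
        rw [fourier_fourier_apply]
        simp only [h, mulS_apply]
        rw [show (-2 * Real.pi * inner ℝ (-x) ξ : ℝ) = 2 * Real.pi * inner ℝ x ξ by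
          rw [inner_neg_left]; ring]
        ring
    _ = _ := by
        refine Eq.trans h2 ?_
        simp_rw [mul_comm]

theorem star_fourier_neg {p : 𝓢(R3, ℂ)} (hp : ∀ x, star (p x) = p x) (ζ : R3) :
    star (𝓕 p (-ζ)) = 𝓕 p ζ := by
  rw [fourier_apply_eq, fourier_apply_eq, Complex.star_def, ← integral_conj]
  congr 1; ext x
  have hp' : (starRingEnd ℂ) (p x) = p x := hp x
  rw [map_mul, hp', ← Complex.exp_conj]
  congr 2
  rw [map_mul, Complex.conj_ofReal, Complex.conj_I, inner_neg_right]
  push_cast; ring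

/-! ### The commutator with a vector field -/

/-- `Y · ∇f + ½ (div Y) f`. -/
def vfield (Y : Fin 3 → 𝓢(R3, ℂ)) (f : 𝓢(R3, ℂ)) : 𝓢(R3, ℂ) :=
  ∑ j, (mulS (Y j) (pd j f) + (1 / 2 : ℂ) • mulS (pd j (Y j)) f)

theorem vfield_apply (Y : Fin 3 → 𝓢(R3, ℂ)) (f : 𝓢(R3, ℂ)) (x : R3) :
    vfield Y f x = ∑ j, (Y j x * pd j f x + 1 / 2 * (pd j (Y j) x * f x)) := by
  simp [vfield]

/-- The kernel of `vfield Y` on the Fourier side. -/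
def commKer (Y : Fin 3 → 𝓢(R3, ℂ)) (ξ η : R3) : ℂ :=
  ∑ j, Real.pi * Complex.I * 𝓕 (Y j) (ξ - η) * (ξ j + η j : ℝ)

theorem continuous_commKer (Y : Fin 3 → 𝓢(R3, ℂ)) :
    Continuous fun z : R3 × R3 => commKer Y z.1 z.2 := by
  unfold commKer
  refine continuous_finsetSum _ fun j _ => ?_
  have := (𝓕 (Y j)).continuous
  fun_prop

theorem integrable_mul_schwartz (p q : 𝓢(R3, ℂ)) (ξ : R3) :
    Integrable fun η => p (ξ - η) * q η := by
  obtain ⟨C, hC⟩ : ∃ C, ∀ x, ‖p x‖ ≤ C := ⟨_, fun x => p.norm_le_seminorm ℝ x⟩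
  exact q.integrable.bdd_mul (c := C)
    ((p.continuous.comp (by fun_prop)).aestronglyMeasurable) (ae_of_all _ fun x => hC _)

/-- The transport term contributes 2πi ηⱼ and the half divergence πi (ξⱼ - ηⱼ); their sum is the
symmetric factor πi (ξⱼ + ηⱼ). -/
theorem fourier_vfield (Y : Fin 3 → 𝓢(R3, ℂ)) (f : 𝓢(R3, ℂ)) (ξ : R3) :
    𝓕 (vfield Y f) ξ = ∫ η, commKer Y ξ η * 𝓕 f η := by
  have e1 : 𝓕 (vfield Y f) = ∑ j, (𝓕 (mulS (Y j) (pd j f))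
      + (1 / 2 : ℂ) • 𝓕 (mulS (pd j (Y j)) f)) := by
    have := map_sum (fourierCLM ℂ 𝓢(R3, ℂ))
      (fun j => mulS (Y j) (pd j f) + (1 / 2 : ℂ) • mulS (pd j (Y j)) f) Finset.univ
    simp only [map_add, map_smul] at this
    exact this
  have e2 : 𝓕 (vfield Y f) ξ = ∑ j, ((∫ η, 𝓕 (Y j) (ξ - η) * 𝓕 (pd j f) η)
      + (1 / 2 : ℂ) * ∫ η, 𝓕 (pd j (Y j)) (ξ - η) * 𝓕 f η) := by
    rw [e1]
    simp [fourier_mulS]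
  rw [e2]
  simp_rw [commKer, Finset.sum_mul]
  have hint : ∀ j, Integrable fun η =>
      Real.pi * Complex.I * 𝓕 (Y j) (ξ - η) * (ξ j + η j : ℝ) * 𝓕 f η := by
    intro j
    have h1 := (integrable_mul_schwartz (𝓕 (Y j)) (𝓕 (pd j f)) ξ).fun_add
      ((integrable_mul_schwartz (𝓕 (pd j (Y j))) (𝓕 f) ξ).const_mul (1 / 2 : ℂ))
    refine h1.congr (ae_of_all _ fun η => ?_)
    simp only [fourier_lineDeriv]
    push_cast [PiLp.sub_apply]
    ring
  rw [integral_finsetSum _ fun j _ => hint j]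
  refine Finset.sum_congr rfl fun j _ => ?_
  rw [← integral_const_mul, ← integral_add (integrable_mul_schwartz _ _ ξ)
    ((integrable_mul_schwartz _ _ ξ).const_mul _)]
  congr 1; ext η
  simp only [fourier_lineDeriv]
  push_cast [PiLp.sub_apply]
  ring

/-- Skew-adjointness of Y·∇ + ½ div Y for real Y, read off from the kernel. This is the reason for
including half the divergence. -/
theorem commKer_swap {Y : Fin 3 → 𝓢(R3, ℂ)} (hY : ∀ j x, star (Y j x) = Y j x) (ξ η : R3) :
    star (commKer Y η ξ) = - commKer Y ξ η := by
  unfold commKer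
  rw [star_sum, ← Finset.sum_neg_distrib]
  refine Finset.sum_congr rfl fun j _ => ?_
  rw [star_mul', star_mul', star_mul', show η - ξ = -(ξ - η) by abel, star_fourier_neg (hY j)]
  simp only [Complex.star_def, Complex.conj_ofReal, Complex.conj_I]
  push_cast
  ring

/-- The weight that bounds the commutator. -/
def commWeight (Y : Fin 3 → 𝓢(R3, ℂ)) (ζ : R3) : ℝ :=
  32 * Real.pi ^ 2 * ∑ j, ‖ζ‖ * ‖𝓕 (Y j) ζ‖

theorem commWeight_nonneg (Y : Fin 3 → 𝓢(R3, ℂ)) (ζ : R3) : 0 ≤ commWeight Y ζ := by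
  have := Real.pi_pos
  unfold commWeight; positivity

theorem integrable_commWeight (Y : Fin 3 → 𝓢(R3, ℂ)) : Integrable (commWeight Y) := by
  refine (integrable_finsetSum Finset.univ fun j _ => ?_).const_mul _
  have h := SchwartzMap.integrable_pow_mul volume (𝓕 (Y j) : 𝓢(R3, ℂ)) 1
  simp only [pow_one] at h
  exact h

theorem continuous_commWeight (Y : Fin 3 → 𝓢(R3, ℂ)) : Continuous (commWeight Y) := by
  unfold commWeight
  refine continuous_const.mul (continuous_finsetSum _ fun j _ => ?_)
  exact continuous_norm.mul (𝓕 (Y j)).continuous.norm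

/-- The kernel of the vector field grows like |ξ| + |η|, exactly the factor gained by the difference
of symbols. What remains depends on ξ - η alone, ready for Young's inequality. -/
theorem norm_symbolA_sub_mul_commKer_le (l₁ l₂ : ℝ) (Y : Fin 3 → 𝓢(R3, ℂ)) (ξ η : R3) :
    ‖((symbolA l₁ l₂ ξ - symbolA l₁ l₂ η : ℝ) : ℂ) * star (commKer Y ξ η)‖
      ≤ |l₂| * commWeight Y (ξ - η) := by
  have hpi := Real.pi_pos
  rw [norm_mul, norm_star, Complex.norm_real]
  have e : symbolA l₁ l₂ ξ - symbolA l₁ l₂ η = l₂ * (symbolK ξ - symbolK η) := by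
    unfold symbolA; ring
  have hk : ‖commKer Y ξ η‖ ≤ Real.pi * (‖ξ‖ + ‖η‖) * ∑ j, ‖𝓕 (Y j) (ξ - η)‖ := by
    unfold commKer
    rw [Finset.mul_sum]
    refine (norm_sum_le _ _).trans (Finset.sum_le_sum fun j _ => ?_)
    rw [norm_mul, norm_mul, norm_mul, Complex.norm_real, Complex.norm_real, Complex.norm_I,
      Real.norm_of_nonneg hpi.le, mul_one]
    have : ‖ξ j + η j‖ ≤ ‖ξ‖ + ‖η‖ :=
      (norm_add_le _ _).trans (add_le_add (abs_coord_le ξ j) (abs_coord_le η j))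
    calc Real.pi * ‖𝓕 (Y j) (ξ - η)‖ * ‖ξ j + η j‖
        ≤ Real.pi * ‖𝓕 (Y j) (ξ - η)‖ * (‖ξ‖ + ‖η‖) := by gcongr
      _ = _ := by ring
  rw [e, norm_mul, Real.norm_eq_abs, Real.norm_eq_abs]
  have h1 := abs_symbolK_sub_mul_le ξ η
  set s := ∑ j, ‖𝓕 (Y j) (ξ - η)‖ with hs
  have hs0 : 0 ≤ s := Finset.sum_nonneg fun _ _ => norm_nonneg _
  have hw : commWeight Y (ξ - η) = 32 * Real.pi ^ 2 * (‖ξ - η‖ * s) := by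
    rw [commWeight, hs, ← Finset.mul_sum]
  rw [hw]
  calc |l₂| * |symbolK ξ - symbolK η| * ‖commKer Y ξ η‖
      ≤ |l₂| * |symbolK ξ - symbolK η| * (Real.pi * (‖ξ‖ + ‖η‖) * s) := by gcongr
    _ = |l₂| * (Real.pi * s) * (|symbolK ξ - symbolK η| * (‖ξ‖ + ‖η‖)) := by ring
    _ ≤ |l₂| * (Real.pi * s) * (32 * Real.pi * ‖ξ - η‖) := by gcongr
    _ = _ := by ring

theorem exists_commWeight_le (Y : Fin 3 → 𝓢(R3, ℂ)) : ∃ C, ∀ ζ, commWeight Y ζ ≤ C := by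
  refine ⟨32 * Real.pi ^ 2 * ∑ j, SchwartzMap.seminorm ℝ 1 0 (𝓕 (Y j)), fun ζ => ?_⟩
  unfold commWeight
  gcongr with j
  have h := norm_pow_mul_le_seminorm ℝ (𝓕 (Y j) : 𝓢(R3, ℂ)) 1 ζ
  rw [pow_one] at h
  exact h

/-- Young's inequality for a convolution form. -/
theorem integral_convolution_form_le {k : R3 → ℝ} (hk0 : ∀ ζ, 0 ≤ k ζ) (hk : Integrable k)
    (hkc : Continuous k) {C : ℝ} (hC : ∀ ζ, k ζ ≤ C) (p q : 𝓢(R3, ℂ)) :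
    Integrable (fun z : R3 × R3 => k (z.1 - z.2) * (‖p z.1‖ * ‖q z.2‖)) (volume.prod volume) ∧
    ∫ z : R3 × R3, k (z.1 - z.2) * (‖p z.1‖ * ‖q z.2‖) ∂(volume.prod volume)
      ≤ (∫ ζ, k ζ) * (l2norm p * l2norm q) := by
  have hpq : Integrable (fun z : R3 × R3 => ‖p z.1‖ * ‖q z.2‖) (volume.prod volume) :=
    p.integrable.norm.mul_prod q.integrable.norm
  have hi : Integrable (fun z : R3 × R3 => k (z.1 - z.2) * (‖p z.1‖ * ‖q z.2‖))
      (volume.prod volume) :=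
    hpq.bdd_mul (c := C) (hkc.comp (by fun_prop)).aestronglyMeasurable
      (ae_of_all _ fun z => by rw [Real.norm_of_nonneg (hk0 _)]; exact hC _)
  refine ⟨hi, ?_⟩
  rw [integral_prod _ hi]
  have e1 : ∀ ξ, ∫ η, k (ξ - η) * (‖p ξ‖ * ‖q η‖) = ∫ ζ, k ζ * (‖p ξ‖ * ‖q (ξ - ζ)‖) := by
    intro ξ
    rw [← integral_sub_left_eq_self (fun η => k (ξ - η) * (‖p ξ‖ * ‖q η‖)) volume ξ]
    simp
  simp_rw [e1]
  obtain ⟨D, hD⟩ : ∃ D, ∀ x, ‖q x‖ ≤ D := ⟨_, fun x => q.norm_le_seminorm ℝ x⟩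
  have hi2 : Integrable (Function.uncurry fun ξ ζ : R3 => k ζ * (‖p ξ‖ * ‖q (ξ - ζ)‖))
      (volume.prod volume) := by
    have h0 : Integrable (fun z : R3 × R3 => ‖p z.1‖ * k z.2) (volume.prod volume) :=
      p.integrable.norm.mul_prod hk
    have h1 := h0.bdd_mul (c := D) (f := fun z : R3 × R3 => ‖q (z.1 - z.2)‖)
      (q.continuous.comp (by fun_prop)).norm.aestronglyMeasurable
      (ae_of_all _ fun z => by rw [norm_norm]; exact hD _)
    refine h1.congr (ae_of_all _ fun z => ?_)
    simp only [Function.uncurry]; ring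
  rw [integral_integral_swap hi2, ← integral_mul_const]
  refine integral_mono_of_nonneg (ae_of_all _ fun ζ => ?_) (hk.mul_const _)
    (ae_of_all _ fun ζ => ?_)
  · exact integral_nonneg fun ξ => mul_nonneg (hk0 ζ) (by positivity)
  · simp only
    rw [integral_const_mul]
    refine mul_le_mul_of_nonneg_left ?_ (hk0 ζ)
    have hq : MemLp (fun ξ => q (ξ - ζ)) 2 := by
      simpa [sub_eq_add_neg] using memLp_translate (q.memLp 2) (-ζ)
    refine (integral_norm_mul_norm_le (p.memLp 2) hq).trans_eq ?_
    congr 1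
    simpa [sub_eq_add_neg] using l2norm_translate q (-ζ)

theorem integrable_commKer_mul (Y : Fin 3 → 𝓢(R3, ℂ)) (p q : 𝓢(R3, ℂ)) :
    Integrable (fun z : R3 × R3 => star (commKer Y z.1 z.2) * (p z.1 * star (q z.2)))
      (volume.prod volume) := by
  have hpi := Real.pi_pos
  set D := ∑ j, SchwartzMap.seminorm ℝ 0 0 (𝓕 (Y j)) with hD
  have hp : Integrable fun ξ => (1 + ‖ξ‖) * ‖p ξ‖ := by
    simp_rw [add_mul, one_mul]
    exact p.integrable.norm.add (by simpa only [pow_one] using p.integrable_pow_mul volume 1)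
  have hq : Integrable fun ξ => (1 + ‖ξ‖) * ‖q ξ‖ := by
    simp_rw [add_mul, one_mul]
    exact q.integrable.norm.add (by simpa only [pow_one] using q.integrable_pow_mul volume 1)
  refine ((hp.mul_prod hq).const_mul (Real.pi * D)).mono' ?_ (ae_of_all _ fun z => ?_)
  · exact ((continuous_commKer Y).star.mul ((p.continuous.comp continuous_fst).mul
      (q.continuous.comp continuous_snd).star)).aestronglyMeasurable
  · rw [norm_mul, norm_mul, norm_star, norm_star]
    have hk : ‖commKer Y z.1 z.2‖ ≤ Real.pi * D * ((1 + ‖z.1‖) * (1 + ‖z.2‖)) := by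
      unfold commKer
      rw [hD, Finset.mul_sum, Finset.sum_mul]
      refine (norm_sum_le _ _).trans (Finset.sum_le_sum fun j _ => ?_)
      rw [norm_mul, norm_mul, norm_mul, Complex.norm_real, Complex.norm_real, Complex.norm_I,
        Real.norm_of_nonneg hpi.le, mul_one]
      have : ‖z.1 j + z.2 j‖ ≤ (1 + ‖z.1‖) * (1 + ‖z.2‖) := by
        refine (norm_add_le _ _).trans ((add_le_add (abs_coord_le z.1 j)
          (abs_coord_le z.2 j)).trans ?_)
        nlinarith [norm_nonneg z.1, norm_nonneg z.2]
      gcongr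
      exact norm_le_seminorm ℝ _ _
    calc _ ≤ Real.pi * D * ((1 + ‖z.1‖) * (1 + ‖z.2‖)) * (‖p z.1‖ * ‖q z.2‖) := by gcongr
      _ = _ := by ring

theorem bform_schwartz (l₁ l₂ : ℝ) (f g : 𝓢(R3, ℂ)) :
    bform (symbolA l₁ l₂) f g = ∫ ξ, (symbolA l₁ l₂ ξ : ℂ) * (𝓕 f ξ * star (𝓕 g ξ)) := by
  apply integral_congr_ae
  filter_upwards [ft2_schwartz f, ft2_schwartz g] with ξ h1 h2
  rw [h1, h2]

/-- Twice the real part is the form plus its conjugate. Exchanging the variables in the conjugate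
and using that the kernel is anti-Hermitian leaves a(ξ) - a(η). -/
theorem two_re_bform_vfield (l₁ l₂ : ℝ) {Y : Fin 3 → 𝓢(R3, ℂ)}
    (hY : ∀ j x, star (Y j x) = Y j x) (f : 𝓢(R3, ℂ)) :
    ((2 * (bform (symbolA l₁ l₂) f (vfield Y f)).re : ℝ) : ℂ)
      = ∫ z : R3 × R3, ((symbolA l₁ l₂ z.1 - symbolA l₁ l₂ z.2 : ℝ) : ℂ)
        * star (commKer Y z.1 z.2) * (𝓕 f z.1 * star (𝓕 f z.2)) ∂(volume.prod volume) := by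
  have hi := integrable_commKer_mul Y (𝓕 f) (𝓕 f)
  have hma : Measurable fun ξ => (symbolA l₁ l₂ ξ : ℂ) :=
    Complex.measurable_ofReal.comp (measurable_symbolA l₁ l₂)
  have hi1 := hi.bdd_mul (c := boundA l₁ l₂) (f := fun z : R3 × R3 => (symbolA l₁ l₂ z.1 : ℂ))
    (hma.comp measurable_fst).aestronglyMeasurable
    (ae_of_all _ fun z => by rw [Complex.norm_real]; exact abs_symbolA_le _ _ _)
  have hi2 := hi.bdd_mul (c := boundA l₁ l₂) (f := fun z : R3 × R3 => (symbolA l₁ l₂ z.2 : ℂ))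
    (hma.comp measurable_snd).aestronglyMeasurable
    (ae_of_all _ fun z => by rw [Complex.norm_real]; exact abs_symbolA_le _ _ _)
  have hT : bform (symbolA l₁ l₂) f (vfield Y f) = ∫ z : R3 × R3, (symbolA l₁ l₂ z.1 : ℂ)
      * (star (commKer Y z.1 z.2) * (𝓕 f z.1 * star (𝓕 f z.2))) ∂(volume.prod volume) := by
    rw [bform_schwartz, integral_prod _ hi1]
    congr 1; ext ξ
    have e : star (𝓕 (vfield Y f) ξ) = ∫ η, star (commKer Y ξ η) * star (𝓕 f η) := by
      rw [fourier_vfield, Complex.star_def, ← integral_conj]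
      simp only [map_mul]
    rw [e, ← integral_const_mul, ← integral_const_mul]
    congr 1; ext η
    ring
  have hT2 : star (bform (symbolA l₁ l₂) f (vfield Y f)) = -∫ z : R3 × R3, (symbolA l₁ l₂ z.2 : ℂ)
      * (star (commKer Y z.1 z.2) * (𝓕 f z.1 * star (𝓕 f z.2))) ∂(volume.prod volume) := by
    rw [hT, Complex.star_def, ← integral_conj, ← integral_neg, ← integral_prod_swap]
    congr 1; ext z
    have := commKer_swap hY z.1 z.2
    simp only [Prod.fst_swap, Prod.snd_swap, map_mul, Complex.conj_ofReal]
    have e1 : (starRingEnd ℂ) ((starRingEnd ℂ) (commKer Y z.2 z.1))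
        = -(starRingEnd ℂ) (commKer Y z.1 z.2) := by
      rw [← map_neg]; exact congrArg _ this
    have e2 : (starRingEnd ℂ) ((starRingEnd ℂ) (𝓕 f z.1)) = 𝓕 f z.1 := star_star (𝓕 f z.1)
    rw [e1, e2]; ring
  have h2 : ((2 * (bform (symbolA l₁ l₂) f (vfield Y f)).re : ℝ) : ℂ)
      = bform (symbolA l₁ l₂) f (vfield Y f) + star (bform (symbolA l₁ l₂) f (vfield Y f)) := by
    rw [Complex.star_def, Complex.add_conj]
  rw [h2, hT2, hT, ← sub_eq_add_neg, ← integral_sub hi1 hi2]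
  congr 1; ext z
  push_cast; ring

/-- The commutator is continuous with respect to the `L²` norm. -/
theorem abs_re_bform_vfield_sub_le (l₁ l₂ : ℝ) {Y : Fin 3 → 𝓢(R3, ℂ)}
    (hY : ∀ j x, star (Y j x) = Y j x) (f g : 𝓢(R3, ℂ)) :
    |(bform (symbolA l₁ l₂) f (vfield Y f)).re - (bform (symbolA l₁ l₂) g (vfield Y g)).re|
      ≤ |l₂| * (∫ ζ, commWeight Y ζ) *
        (l2norm (fun x => f x - g x) * (l2norm f + l2norm g)) := by
  obtain ⟨C, hC⟩ := exists_commWeight_le Y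
  have hyoung := integral_convolution_form_le (commWeight_nonneg Y) (integrable_commWeight Y)
    (continuous_commWeight Y) hC
  set d : 𝓢(R3, ℂ) := 𝓕 (f - g) with hd
  have hde : ∀ ξ, d ξ = 𝓕 f ξ - 𝓕 g ξ := fun ξ => by
    have h := map_sub (fourierCLM ℂ 𝓢(R3, ℂ)) f g
    exact congrArg (fun s : 𝓢(R3, ℂ) => s ξ) h
  have l2S : ∀ s : 𝓢(R3, ℂ), l2norm (𝓕 s : 𝓢(R3, ℂ)) = l2norm s := fun s => by
    refine Eq.trans ?_ (l2norm_ft2 (s.memLp 2))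
    exact l2norm_congr_norm ((ft2_schwartz s).symm.mono fun x hx => by rw [hx])
  have hdn : l2norm d = l2norm (fun x => f x - g x) := by
    rw [hd, l2S]; rfl
  have hbase : ∀ p q : 𝓢(R3, ℂ), Integrable (fun z : R3 × R3 =>
      ((symbolA l₁ l₂ z.1 - symbolA l₁ l₂ z.2 : ℝ) : ℂ)
        * star (commKer Y z.1 z.2) * (p z.1 * star (q z.2))) (volume.prod volume) := by
    intro p q
    refine ((hyoung p q).1.const_mul |l₂|).mono' ?_ (ae_of_all _ fun z => ?_)
    · have m1 : Measurable fun z : R3 × R3 =>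
          ((symbolA l₁ l₂ z.1 - symbolA l₁ l₂ z.2 : ℝ) : ℂ) :=
        Complex.measurable_ofReal.comp (((measurable_symbolA l₁ l₂).comp measurable_fst).sub
          ((measurable_symbolA l₁ l₂).comp measurable_snd))
      exact (m1.aestronglyMeasurable.mul (continuous_commKer Y).star.aestronglyMeasurable).mul
        ((p.continuous.comp continuous_fst).mul
          (q.continuous.comp continuous_snd).star).aestronglyMeasurable
    · rw [norm_mul, norm_mul (p z.1), norm_star, ← mul_assoc |l₂|]
      exact mul_le_mul_of_nonneg_right (norm_symbolA_sub_mul_commKer_le l₁ l₂ Y z.1 z.2)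
        (by positivity)
  have hest : ∀ p q : 𝓢(R3, ℂ), ‖∫ z : R3 × R3,
      ((symbolA l₁ l₂ z.1 - symbolA l₁ l₂ z.2 : ℝ) : ℂ)
        * star (commKer Y z.1 z.2) * (p z.1 * star (q z.2)) ∂(volume.prod volume)‖
      ≤ |l₂| * (∫ ζ, commWeight Y ζ) * (l2norm p * l2norm q) := by
    intro p q
    refine (norm_integral_le_of_norm_le ((hyoung p q).1.const_mul |l₂|)
      (ae_of_all _ fun z => ?_)).trans ?_
    · rw [norm_mul, norm_mul (p z.1), norm_star, ← mul_assoc |l₂|]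
      exact mul_le_mul_of_nonneg_right (norm_symbolA_sub_mul_commKer_le l₁ l₂ Y z.1 z.2)
        (by positivity)
    · rw [integral_const_mul, mul_assoc]
      exact mul_le_mul_of_nonneg_left (hyoung p q).2 (abs_nonneg _)
  -- The commutator is quadratic, so the difference of its values at f and g splits into one term
  -- with f - g in the first slot and one with f - g in the second.
  have key : ((2 * ((bform (symbolA l₁ l₂) f (vfield Y f)).re
        - (bform (symbolA l₁ l₂) g (vfield Y g)).re) : ℝ) : ℂ)
      = (∫ z : R3 × R3, ((symbolA l₁ l₂ z.1 - symbolA l₁ l₂ z.2 : ℝ) : ℂ)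
          * star (commKer Y z.1 z.2) * (d z.1 * star (𝓕 f z.2)) ∂(volume.prod volume))
        + ∫ z : R3 × R3, ((symbolA l₁ l₂ z.1 - symbolA l₁ l₂ z.2 : ℝ) : ℂ)
          * star (commKer Y z.1 z.2) * (𝓕 g z.1 * star (d z.2)) ∂(volume.prod volume) := by
    rw [mul_sub, Complex.ofReal_sub, two_re_bform_vfield l₁ l₂ hY, two_re_bform_vfield l₁ l₂ hY,
      ← integral_sub (hbase _ _) (hbase _ _), ← integral_add (hbase _ _) (hbase _ _)]
    congr 1; ext z
    rw [hde, hde, star_sub]; ring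
  have h1 := norm_add_le_of_le (hest d (𝓕 f)) (hest (𝓕 g) d)
  rw [← key, Complex.norm_real, norm_mul, Real.norm_two, hdn, l2S f, l2S g, Real.norm_eq_abs] at h1
  have h0 : 0 ≤ |(bform (symbolA l₁ l₂) f (vfield Y f)).re
    - (bform (symbolA l₁ l₂) g (vfield Y g)).re| := abs_nonneg _
  nlinarith

end DipolarGPE

end

noncomputable section

namespace DipolarGPE

open FourierTransform SchwartzMap LineDeriv

/-! ### Localized dilations -/

/-- The vector field `x ↦ cutoff R x • x`, componentwise. -/
def yfun (R : ℝ) (j : Fin 3) (x : R3) : ℝ := cutoff R x * x j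

theorem contDiff_yfun (R : ℝ) (j : Fin 3) : ContDiff ℝ ∞ (yfun R j) :=
  (contDiff_cutoff R).mul (EuclideanSpace.proj (𝕜 := ℝ) j).contDiff

theorem hasCompactSupport_yfun {R : ℝ} (hR : 0 < R) (j : Fin 3) : HasCompactSupport (yfun R j) :=
  (hasCompactSupport_cutoff hR).mul_right

theorem fderiv_yfun (R : ℝ) (j k : Fin 3) (x : R3) :
    fderiv ℝ (yfun R j) x (e3 k)
      = cutoff R x * (if j = k then 1 else 0) + x j * fderiv ℝ (cutoff R) x (e3 k) := by
  have h1 : HasFDerivAt (yfun R j) (cutoff R x • EuclideanSpace.proj (𝕜 := ℝ) j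
      + x j • fderiv ℝ (cutoff R) x) x :=
    ((contDiff_cutoff R).differentiable (by simp) x).hasFDerivAt.mul
      (EuclideanSpace.proj (𝕜 := ℝ) j).hasFDerivAt
  rw [h1.fderiv]
  simp

/-- The components of the vector field as Schwartz functions. -/
def yfield {R : ℝ} (hR : 0 < R) (j : Fin 3) : 𝓢(R3, ℂ) :=
  HasCompactSupport.toSchwartzMap (f := fun x => (yfun R j x : ℂ))
    ((hasCompactSupport_yfun hR j).comp_left (g := fun r : ℝ => (r : ℂ)) Complex.ofReal_zero)
    (Complex.ofRealCLM.contDiff.comp (contDiff_yfun R j))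

theorem yfield_apply {R : ℝ} (hR : 0 < R) (j : Fin 3) (x : R3) :
    yfield hR j x = (yfun R j x : ℂ) := rfl

theorem star_yfield {R : ℝ} (hR : 0 < R) (j : Fin 3) (x : R3) :
    star (yfield hR j x) = yfield hR j x := by
  rw [yfield_apply, Complex.star_def, Complex.conj_ofReal]

theorem pd_yfield {R : ℝ} (hR : 0 < R) (j k : Fin 3) (x : R3) :
    pd k (yfield hR j) x = (fderiv ℝ (yfun R j) x (e3 k) : ℂ) := by
  rw [lineDerivOp_apply_eq_fderiv]
  have h := Complex.ofRealCLM.hasFDerivAt.comp x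
    ((contDiff_yfun R j).differentiable (by simp) x).hasFDerivAt
  exact congrArg (fun L => L (e3 k)) h.fderiv

theorem exists_fderiv_yfun_bound : ∃ C : ℝ, 0 ≤ C ∧ ∀ R : ℝ, 1 ≤ R → ∀ (j k : Fin 3) (x : R3),
    |fderiv ℝ (yfun R j) x (e3 k)| ≤ C := by
  obtain ⟨C, hC, h⟩ := exists_fderiv_cutoff_bound
  refine ⟨1 + C, by positivity, fun R hR j k x => ?_⟩
  rw [fderiv_yfun]
  refine (abs_add_le _ _).trans (add_le_add ?_ ?_)
  · rw [abs_mul]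
    refine mul_le_one₀ (abs_cutoff_le_one R x) (abs_nonneg _) ?_
    split_ifs <;> simp
  · rw [abs_mul]
    refine (mul_le_mul_of_nonneg_right (abs_coord_le x j) (abs_nonneg _)).trans ?_
    simpa using (h R hR x (e3 k)).2

theorem tendsto_fderiv_yfun (j k : Fin 3) (x : R3) :
    Tendsto (fun R => fderiv ℝ (yfun R j) x (e3 k)) atTop (𝓝 (if j = k then 1 else 0)) := by
  simp_rw [fderiv_yfun]
  have := ((tendsto_cutoff x).mul_const (if j = k then (1 : ℝ) else 0)).add
    ((tendsto_fderiv_cutoff x (e3 k)).const_mul (x j))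
  simpa using this

/-- Three powers of R come from the volume, the fourth from the linear growth of the field. -/
theorem fourier_yfield {R : ℝ} (hR : 0 < R) (j : Fin 3) (ζ : R3) :
    𝓕 (yfield hR j) ζ = (R : ℂ) ^ 4 * 𝓕 (yfield one_pos j) (R • ζ) := by
  rw [fourier_apply_eq, fourier_apply_eq]
  have h := Measure.integral_comp_smul (volume : Measure R3) (fun x =>
    Complex.exp (((-2 * Real.pi * inner ℝ x ζ : ℝ) : ℂ) * Complex.I) * yfield hR j x) R
  have hfr : Module.finrank ℝ R3 = 3 := by simp
  rw [hfr, abs_of_pos (by positivity)] at h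
  have h2 : ∀ x : R3, Complex.exp (((-2 * Real.pi * inner ℝ (R • x) ζ : ℝ) : ℂ) * Complex.I)
      * yfield hR j (R • x) = (R : ℂ) *
      (Complex.exp (((-2 * Real.pi * inner ℝ x (R • ζ) : ℝ) : ℂ) * Complex.I)
        * yfield one_pos j x) := by
    intro x
    rw [inner_smul_left, inner_smul_right, yfield_apply, yfield_apply]
    have : yfun R j (R • x) = R * yfun 1 j x := by
      simp [yfun, cutoff, smul_smul, inv_mul_cancel₀ hR.ne']; ring
    rw [this]
    simp only [conj_trivial]
    push_cast; ring
  simp_rw [h2] at h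
  rw [integral_const_mul, Complex.real_smul] at h
  have hR' : (R : ℂ) ≠ 0 := by exact_mod_cast hR.ne'
  push_cast at h
  rw [show (R : ℂ) ^ 4 = R ^ 3 * R by ring, mul_assoc]
  push_cast
  rw [h, ← mul_assoc, mul_inv_cancel₀ (pow_ne_zero 3 hR'), one_mul]

/-- The powers balance: R⁴ from the transform of the field, R⁻¹ from the weight |ζ| and R⁻³ from the
change of variables. Hence the commutator bound is uniform in the radius. -/
theorem integral_commWeight_yfield {R : ℝ} (hR : 0 < R) :
    ∫ ζ, commWeight (yfield hR) ζ = ∫ ζ, commWeight (yfield one_pos) ζ := by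
  have h : ∀ ζ, commWeight (yfield hR) ζ = R ^ 3 * commWeight (yfield one_pos) (R • ζ) := by
    intro ζ
    unfold commWeight
    simp_rw [fourier_yfield hR, norm_mul, norm_pow, Complex.norm_real, norm_smul,
      Real.norm_of_nonneg hR.le, Finset.mul_sum]
    refine Finset.sum_congr rfl fun j _ => ?_
    ring
  simp_rw [h]
  rw [integral_const_mul]
  have h2 := Measure.integral_comp_smul (volume : Measure R3) (commWeight (yfield one_pos)) R
  have hfr : Module.finrank ℝ R3 = 3 := by simp
  rw [h2, hfr, abs_of_pos (by positivity), smul_eq_mul]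
  field_simp

/-! ### Dilations and homogeneous symbols -/

/-- Multiplication by a coordinate. -/
def xmul (j : Fin 3) (f : 𝓢(R3, ℂ)) : 𝓢(R3, ℂ) := smulLeftCLM ℂ (fun x : R3 => x j) f

theorem xmul_apply (j : Fin 3) (f : 𝓢(R3, ℂ)) (x : R3) : xmul j f x = (x j : ℂ) * f x := by
  have hg : (fun x : R3 => x j).HasTemperateGrowth :=
    (EuclideanSpace.proj (𝕜 := ℝ) j).hasTemperateGrowth
  rw [xmul, smulLeftCLM_apply_apply hg, Complex.real_smul]

/-- The generator of dilations. -/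
def dil (f : 𝓢(R3, ℂ)) : 𝓢(R3, ℂ) := ∑ j, xmul j (pd j f) + (3 / 2 : ℂ) • f

theorem dil_apply (f : 𝓢(R3, ℂ)) (x : R3) :
    dil f x = ∑ j, (x j : ℂ) * pd j f x + 3 / 2 * f x := by
  simp [dil, xmul_apply]

theorem fourier_xmul (j : Fin 3) (f : 𝓢(R3, ℂ)) (ξ : R3) :
    (-(2 * Real.pi * Complex.I)) * 𝓕 (xmul j f) ξ = pd j (𝓕 f) ξ := by
  have h := SchwartzMap.lineDerivOp_fourier_eq f (e3 j)
  have e : smulLeftCLM ℂ (fun x : R3 => inner ℝ x (e3 j)) f = xmul j f := by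
    have : (fun x : R3 => inner ℝ x (e3 j)) = fun x => x j := by
      ext x; simp [EuclideanSpace.inner_single_right]
    rw [xmul, this]
  rw [e] at h
  have h2 := congrArg (fun s : 𝓢(R3, ℂ) => s ξ) h
  rw [show pd j (𝓕 f) ξ = ∂_{e3 j} (𝓕 f) ξ from rfl, h2]
  have h3 := map_smul (fourierCLM ℂ 𝓢(R3, ℂ)) (-(2 * Real.pi * Complex.I)) (xmul j f)
  exact (congrArg (fun s : 𝓢(R3, ℂ) => s ξ) h3).symm

/-- The generator of L²-normalised dilations changes sign under the Fourier transform, since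
dilating in space contracts in frequency. -/
theorem fourier_dil (f : 𝓢(R3, ℂ)) (ξ : R3) :
    𝓕 (dil f) ξ = -(∑ j, (ξ j : ℂ) * pd j (𝓕 f) ξ + 3 / 2 * 𝓕 f ξ) := by
  have hpi : (2 * Real.pi * Complex.I : ℂ) ≠ 0 := by
    simp [Real.pi_ne_zero]
  have h1 : ∀ j, 𝓕 (xmul j (pd j f)) ξ = -((ξ j : ℂ) * pd j (𝓕 f) ξ + 𝓕 f ξ) := by
    intro j
    have h2 := fourier_xmul j (pd j f) ξ
    have h3 : 𝓕 (pd j f) = (2 * Real.pi * Complex.I) • xmul j (𝓕 f) := by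
      ext η
      rw [fourier_lineDeriv]
      simp [xmul_apply]; ring
    have h4 : pd j (𝓕 (pd j f)) ξ = (2 * Real.pi * Complex.I) * pd j (xmul j (𝓕 f)) ξ := by
      rw [h3]
      exact congrArg (fun s : 𝓢(R3, ℂ) => s ξ)
        (lineDerivOp_smul (e3 j) (2 * Real.pi * Complex.I : ℂ) (xmul j (𝓕 f)))
    have h5 : pd j (xmul j (𝓕 f)) ξ = (ξ j : ℂ) * pd j (𝓕 f) ξ + 𝓕 f ξ := by
      have e1 : (xmul j (𝓕 f) : R3 → ℂ) = fun x => x j • 𝓕 f x := by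
        ext x; rw [xmul_apply, Complex.real_smul]
      rw [lineDerivOp_apply_eq_fderiv, lineDerivOp_apply_eq_fderiv, e1]
      have h6 : HasFDerivAt (fun x : R3 => x j • 𝓕 f x) _ ξ :=
        (EuclideanSpace.proj (𝕜 := ℝ) j).hasFDerivAt.smul ((𝓕 f).hasFDerivAt ξ)
      rw [h6.fderiv]
      simp
    rw [h4, h5] at h2
    have := mul_left_cancel₀ hpi (h2.symm.trans (neg_mul_comm _ _))
    rw [this]; ring
  have h2 : 𝓕 (dil f) = ∑ j, 𝓕 (xmul j (pd j f)) + (3 / 2 : ℂ) • 𝓕 f := by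
    have := map_add (fourierCLM ℂ 𝓢(R3, ℂ)) (∑ j, xmul j (pd j f)) ((3 / 2 : ℂ) • f)
    rw [map_sum, map_smul] at this
    exact this
  rw [h2]
  simp only [add_apply, smul_apply, h1, smul_eq_mul, Fin.sum_univ_three]
  ring

theorem symbolA_smul (l₁ l₂ : ℝ) {r : ℝ} (hr : r ≠ 0) (ξ : R3) :
    symbolA l₁ l₂ (r • ξ) = symbolA l₁ l₂ ξ := by
  rw [symbolA, symbolA, symbolK_smul r hr]

/-- The radial derivative `2 Re (conj p (ξ · ∇p))` of `|p|²`. -/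
def radialDeriv (p : 𝓢(R3, ℂ)) (ξ : R3) : ℝ :=
  2 * (star (p ξ) * ∑ j, (ξ j : ℂ) * pd j p ξ).re

theorem hasDerivAt_norm_sq_smul (p : 𝓢(R3, ℂ)) (ξ : R3) {s : ℝ} (hs : s ≠ 0) :
    HasDerivAt (fun s : ℝ => ‖p (s • ξ)‖ ^ 2) (s⁻¹ * radialDeriv p (s • ξ)) s := by
  have h1 : HasDerivAt (fun s : ℝ => s • ξ) ξ s := by
    simpa using (hasDerivAt_id s).smul_const ξ
  have h2 : HasDerivAt (fun s : ℝ => p (s • ξ)) (fderiv ℝ p (s • ξ) ξ) s :=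
    (p.hasFDerivAt (s • ξ)).comp_hasDerivAt s h1
  have h3 := h2.norm_sq
  convert h3 using 1
  have hv : ξ = ∑ j, ξ j • e3 j := by
    ext j; simp [Finset.sum_apply, Pi.single_apply]
  have h4 : fderiv ℝ p (s • ξ) ξ = ∑ j, (ξ j : ℂ) * pd j p (s • ξ) := by
    conv_lhs => rw [hv, map_sum]
    refine Finset.sum_congr rfl fun j _ => ?_
    rw [map_smul, Complex.real_smul, ← hv]; rfl
  have h5 : ∑ j, (((s • ξ) j : ℝ) : ℂ) * pd j p (s • ξ)
      = (s : ℂ) * ∑ j, (ξ j : ℂ) * pd j p (s • ξ) := by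
    rw [Finset.mul_sum]
    refine Finset.sum_congr rfl fun j _ => ?_
    simp [mul_assoc]
  rw [h4, radialDeriv, h5, Complex.inner]
  have h6 : star (p (s • ξ)) * ((s : ℂ) * ∑ j, (ξ j : ℂ) * pd j p (s • ξ))
      = (s : ℂ) * (star (p (s • ξ)) * ∑ j, (ξ j : ℂ) * pd j p (s • ξ)) := by ring
  rw [h6, Complex.re_ofReal_mul, Complex.star_def]
  field_simp

theorem exists_radialDeriv_bound (p : 𝓢(R3, ℂ)) : ∃ D : ℝ, 0 ≤ D ∧ ∀ ξ,
    |radialDeriv p ξ| ≤ D * (1 + ‖ξ‖) ^ (-4 : ℝ) := by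
  obtain ⟨C, hC⟩ : ∃ C, ∀ x, ‖p x‖ ≤ C := ⟨_, fun x => p.norm_le_seminorm ℝ x⟩
  have hC0 : 0 ≤ C := (norm_nonneg _).trans (hC 0)
  -- Five powers of decay for the derivative: one is spent on the factor ξⱼ, and the remaining four
  -- give integrability in ℝ³.
  have hD : ∀ j, ∃ D : ℝ, 0 ≤ D ∧ ∀ ξ, (1 + ‖ξ‖) ^ 5 * ‖pd j p ξ‖ ≤ D := by
    intro j
    have h := fun ξ => one_add_le_sup_seminorm_apply (𝕜 := ℝ) (m := (5, 0)) (k := 5) (n := 0)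
      le_rfl le_rfl (pd j p) ξ
    simp only [norm_iteratedFDeriv_zero] at h
    exact ⟨_, le_trans (by positivity) (h 0), h⟩
  choose D hD0 hD using hD
  refine ⟨2 * C * ∑ j, D j, mul_nonneg (by positivity) (Finset.sum_nonneg fun j _ => hD0 j),
    fun ξ => ?_⟩
  have h1 : 0 < 1 + ‖ξ‖ := by positivity
  rw [radialDeriv, abs_mul, abs_two]
  have h2 : ‖∑ j, (ξ j : ℂ) * pd j p ξ‖ ≤ (∑ j, D j) * (1 + ‖ξ‖) ^ (-4 : ℝ) := by
    rw [Finset.sum_mul]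
    refine (norm_sum_le _ _).trans (Finset.sum_le_sum fun j _ => ?_)
    rw [norm_mul, Complex.norm_real, Real.rpow_neg h1.le, ← div_eq_mul_inv, le_div_iff₀ (by positivity)]
    have h3 : ‖ξ j‖ ≤ 1 + ‖ξ‖ := (abs_coord_le ξ j).trans (by linarith)
    have h4 : (1 + ‖ξ‖) ^ (4 : ℝ) = (1 + ‖ξ‖) ^ 4 := by norm_cast
    rw [h4]
    calc ‖ξ j‖ * ‖pd j p ξ‖ * (1 + ‖ξ‖) ^ 4
        ≤ (1 + ‖ξ‖) * ‖pd j p ξ‖ * (1 + ‖ξ‖) ^ 4 := by gcongr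
      _ = (1 + ‖ξ‖) ^ 5 * ‖pd j p ξ‖ := by ring
      _ ≤ D j := hD j ξ
  calc 2 * |(star (p ξ) * ∑ j, (ξ j : ℂ) * pd j p ξ).re|
      ≤ 2 * ‖star (p ξ) * ∑ j, (ξ j : ℂ) * pd j p ξ‖ := by gcongr; exact Complex.abs_re_le_norm _
    _ ≤ 2 * (C * ((∑ j, D j) * (1 + ‖ξ‖) ^ (-4 : ℝ))) := by
        rw [norm_mul, norm_star]
        gcongr
        exact hC ξ
    _ = _ := by ring

theorem continuous_radialDeriv (p : 𝓢(R3, ℂ)) : Continuous (radialDeriv p) := by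
  unfold radialDeriv
  have h := p.continuous
  have h2 := fun j => (pd j p).continuous
  refine continuous_const.mul (Complex.continuous_re.comp (h.star.mul
    (continuous_finsetSum _ fun j _ => Continuous.mul ?_ (h2 j))))
  fun_prop

/-- Euler's identity for a symbol that is homogeneous of degree zero. -/
theorem integral_symbolA_mul_radialDeriv (l₁ l₂ : ℝ) (p : 𝓢(R3, ℂ)) :
    ∫ ξ, symbolA l₁ l₂ ξ * radialDeriv p ξ = -3 * ∫ ξ, symbolA l₁ l₂ ξ * ‖p ξ‖ ^ 2 := by
  obtain ⟨D, hD0, hD⟩ := exists_radialDeriv_bound p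
  have hma := (measurable_symbolA l₁ l₂).aestronglyMeasurable (μ := (volume : Measure R3))
  have hint : Integrable fun ξ => symbolA l₁ l₂ ξ * ‖p ξ‖ ^ 2 :=
    (integrable_norm_sq (p.memLp 2)).bdd_mul (c := boundA l₁ l₂) hma
      (ae_of_all _ fun ξ => abs_symbolA_le l₁ l₂ ξ)
  have hM := boundA_nonneg l₁ l₂
  have hder := hasDerivAt_integral_of_dominated_loc_of_deriv_le (μ := (volume : Measure R3))
    (F := fun (s : ℝ) ξ => symbolA l₁ l₂ ξ * ‖p (s • ξ)‖ ^ 2)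
    (F' := fun (s : ℝ) ξ => symbolA l₁ l₂ ξ * (s⁻¹ * radialDeriv p (s • ξ)))
    (x₀ := 1) (s := Metric.ball 1 (1 / 2))
    (bound := fun ξ => boundA l₁ l₂ * (2 * (D * (16 * (1 + ‖ξ‖) ^ (-4 : ℝ)))))
    (Metric.ball_mem_nhds _ (by norm_num)) ?_ ?_ ?_ ?_ ?_ ?_
  · have h1 := hder.2
    have hfr : Module.finrank ℝ R3 = 3 := by simp
    -- Because the symbol does not see the dilation, the change of variables gives the factor s⁻³,
    -- whose derivative at s = 1 is -3. Differentiation under the integral gives the other side.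
    have hev : (fun s : ℝ => ∫ ξ, symbolA l₁ l₂ ξ * ‖p (s • ξ)‖ ^ 2)
        =ᶠ[𝓝 1] fun s => (s ^ 3)⁻¹ * ∫ ξ, symbolA l₁ l₂ ξ * ‖p ξ‖ ^ 2 := by
      filter_upwards [lt_mem_nhds (one_pos : (0 : ℝ) < 1)] with s hs
      have h2 := Measure.integral_comp_smul (volume : Measure R3)
        (fun ξ => symbolA l₁ l₂ ξ * ‖p ξ‖ ^ 2) s
      simp only [symbolA_smul l₁ l₂ hs.ne'] at h2
      rw [h2, hfr, abs_of_pos (by positivity), smul_eq_mul]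
    have h3 : HasDerivAt (fun s : ℝ => (s ^ 3)⁻¹ * ∫ ξ, symbolA l₁ l₂ ξ * ‖p ξ‖ ^ 2)
        (-3 * ∫ ξ, symbolA l₁ l₂ ξ * ‖p ξ‖ ^ 2) 1 := by
      have := ((hasDerivAt_pow 3 (1 : ℝ)).inv (by norm_num)).mul_const
        (∫ ξ, symbolA l₁ l₂ ξ * ‖p ξ‖ ^ 2)
      simpa using this
    have := (h1.congr_of_eventuallyEq hev.symm).unique h3
    simpa using this
  · refine Eventually.of_forall fun s => hma.mul ?_
    exact ((p.continuous.comp (continuous_const_smul s)).norm.pow 2).aestronglyMeasurable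
  · simpa using hint
  · refine hma.mul ?_
    exact (continuous_const.mul ((continuous_radialDeriv p).comp
      (continuous_const_smul (1 : ℝ)))).aestronglyMeasurable
  · refine ae_of_all _ fun ξ s hs => ?_
    rw [Metric.mem_ball, Real.dist_eq, abs_lt] at hs
    have hs1 : 1 / 2 < s := by linarith [hs.1]
    have hs0 : 0 < s := by linarith
    rw [norm_mul, norm_mul, norm_inv, Real.norm_of_nonneg hs0.le]
    have hi : s⁻¹ ≤ 2 := by
      rw [inv_le_comm₀ hs0 (by norm_num)]; linarith
    -- For s > ½ one has 1 + s|ξ| ≥ (1 + |ξ|)/2, and 16 = (½)⁻⁴.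
    have hb : ‖radialDeriv p (s • ξ)‖ ≤ D * (16 * (1 + ‖ξ‖) ^ (-4 : ℝ)) := by
      refine (hD _).trans ?_
      gcongr
      have e : (16 : ℝ) = (1 / 2 : ℝ) ^ (-4 : ℝ) := by
        rw [Real.rpow_neg (by norm_num)]; norm_num
      rw [e, ← Real.mul_rpow (by norm_num) (by positivity)]
      refine Real.rpow_le_rpow_of_nonpos (by positivity) ?_ (by norm_num)
      rw [norm_smul, Real.norm_of_nonneg hs0.le]
      nlinarith [norm_nonneg ξ]
    gcongr
    exact abs_symbolA_le l₁ l₂ ξ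
  · have h := integrable_one_add_norm (E := R3) (μ := volume) (r := 4) (by simp; norm_num)
    exact (((h.const_mul 16).const_mul D).const_mul 2).const_mul _
  · refine ae_of_all _ fun ξ s hs => ?_
    rw [Metric.mem_ball, Real.dist_eq, abs_lt] at hs
    exact (hasDerivAt_norm_sq_smul p ξ (by linarith [hs.1] : 0 < s).ne').const_mul _

/-- Passing to the Fourier side gives -½ ∫ a ∂ᵣ|p|² - (3/2) ∫ a|p|², with p the transform of f and
∂ᵣ = ξ·∇. Euler's identity turns the first term into +(3/2) ∫ a|p|², so the two cancel. This is
where the rest term of the Pohozaev identity disappears. -/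
theorem re_bform_dil (l₁ l₂ : ℝ) (f : 𝓢(R3, ℂ)) :
    (bform (symbolA l₁ l₂) f (dil f)).re = 0 := by
  have hi : Integrable fun ξ => (symbolA l₁ l₂ ξ : ℂ) * (𝓕 f ξ * star (𝓕 (dil f) ξ)) := by
    refine (integrable_bform (l₁ := l₁) (l₂ := l₂) (f.memLp 2) ((dil f).memLp 2)).congr ?_
    filter_upwards [ft2_schwartz f, ft2_schwartz (dil f)] with ξ h1 h2
    rw [h1, h2]
  have hma := (measurable_symbolA l₁ l₂).aestronglyMeasurable (μ := (volume : Measure R3))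
  have i1 : Integrable fun ξ => symbolA l₁ l₂ ξ * ‖𝓕 f ξ‖ ^ 2 :=
    (integrable_norm_sq ((𝓕 f).memLp 2)).bdd_mul (c := boundA l₁ l₂) hma
      (ae_of_all _ fun ξ => abs_symbolA_le l₁ l₂ ξ)
  have e : ∀ ξ, ((symbolA l₁ l₂ ξ : ℂ) * (𝓕 f ξ * star (𝓕 (dil f) ξ))).re
      = -(1 / 2) * (symbolA l₁ l₂ ξ * radialDeriv (𝓕 f) ξ)
        - 3 / 2 * (symbolA l₁ l₂ ξ * ‖𝓕 f ξ‖ ^ 2) := by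
    intro ξ
    rw [fourier_dil, Complex.re_ofReal_mul, radialDeriv]
    set z := 𝓕 f ξ
    set w := ∑ j, (ξ j : ℂ) * pd j (𝓕 f) ξ
    rw [← Complex.normSq_eq_norm_sq, Complex.normSq_apply]
    simp [Complex.mul_re, Complex.mul_im]
    ring
  have i2 : Integrable fun ξ => symbolA l₁ l₂ ξ * radialDeriv (𝓕 f) ξ := by
    have h := (hi.re.add (i1.const_mul (3 / 2))).const_mul (-2)
    refine h.congr (ae_of_all _ fun ξ => ?_)
    have := e ξ
    simp only [Pi.add_apply, RCLike.re_eq_complex_re]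
    rw [this]; ring
  have h1 := integral_re hi
  simp only [RCLike.re_eq_complex_re] at h1
  rw [bform_schwartz, ← h1]
  simp_rw [e]
  rw [integral_sub (i2.const_mul _) (i1.const_mul _), integral_const_mul, integral_const_mul,
    integral_symbolA_mul_radialDeriv]
  ring

/-! ### Vanishing of the commutator -/

theorem tendsto_l2norm_zero {F : ℝ → R3 → ℂ} {G : R3 → ℝ}
    (hm : ∀ᶠ R in atTop, AEStronglyMeasurable (F R) volume) (hG : MemLp G 2)
    (hb : ∀ᶠ R in atTop, ∀ x, ‖F R x‖ ≤ G x) (hlim : ∀ x, Tendsto (fun R => F R x) atTop (𝓝 0)) :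
    Tendsto (fun R => l2norm (F R)) atTop (𝓝 0) := by
  have h : Tendsto (fun R => ∫ x, ‖F R x‖ ^ 2) atTop (𝓝 (∫ _ : R3, (0 : ℝ))) := by
    refine tendsto_integral_filter_of_dominated_convergence (fun x => ‖G x‖ ^ 2) ?_ ?_
      (integrable_norm_sq hG) (ae_of_all _ fun x => ?_)
    · filter_upwards [hm] with R h
      exact h.norm.pow 2
    · filter_upwards [hb] with R h
      refine ae_of_all _ fun x => ?_
      rw [Real.norm_of_nonneg (by positivity)]
      gcongr
      exact (h x).trans (le_abs_self _)
    · simpa using (hlim x).norm.pow 2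
  have h2 := (Real.continuous_sqrt.tendsto _).comp h
  simpa [l2norm, Function.comp_def] using h2

/-- On a fixed Schwartz function the truncated dilations converge in L² to the full one, by
dominated convergence, and the full one contributes nothing. -/
theorem tendsto_re_bform_vfield (l₁ l₂ : ℝ) (f : 𝓢(R3, ℂ)) {ε : ℝ} (hε : 0 < ε) :
    ∃ R₀ : ℝ, ∀ R, R₀ ≤ R → ∀ hR : 0 < R,
      |(bform (symbolA l₁ l₂) f (vfield (yfield hR) f)).re| < ε := by
  obtain ⟨C, hC, hb⟩ := exists_fderiv_yfun_bound
  let F : ℝ → R3 → ℂ := fun R x =>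
    ∑ j, ((yfun R j x : ℂ) * pd j f x + 1 / 2 * ((fderiv ℝ (yfun R j) x (e3 j) : ℂ) * f x))
      - dil f x
  have hF : ∀ R (hR : 0 < R), F R = fun x => vfield (yfield hR) f x - dil f x := by
    intro R hR
    ext x
    simp only [F, vfield_apply, yfield_apply, pd_yfield]
  have hlim : Tendsto (fun R => l2norm (F R)) atTop (𝓝 0) := by
    refine tendsto_l2norm_zero (G := fun x => ∑ j, ‖xmul j (pd j f) x‖ + 3 / 2 * (C * ‖f x‖)
        + ‖dil f x‖) ?_ ?_ ?_ ?_
    · filter_upwards [eventually_gt_atTop 0] with R hR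
      rw [hF R hR]
      exact ((vfield (yfield hR) f).continuous.sub (dil f).continuous).aestronglyMeasurable
    · refine MemLp.add (MemLp.add ?_ ?_) ((dil f).memLp 2).norm
      · exact memLp_finsetSum _ fun j _ => ((xmul j (pd j f)).memLp 2).norm
      · exact ((f.memLp 2).norm.const_mul C).const_mul _
    · filter_upwards [eventually_ge_atTop 1] with R hR x
      refine (norm_sub_le _ _).trans (add_le_add ?_ le_rfl)
      have : ∑ j : Fin 3, ‖xmul j (pd j f) x‖ + 3 / 2 * (C * ‖f x‖)
          = ∑ j : Fin 3, (‖xmul j (pd j f) x‖ + 1 / 2 * (C * ‖f x‖)) := by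
        rw [Finset.sum_add_distrib]; simp; ring
      rw [this]
      refine (norm_sum_le _ _).trans (Finset.sum_le_sum fun j _ => ?_)
      refine (norm_add_le _ _).trans (add_le_add ?_ ?_)
      · rw [xmul_apply, norm_mul, norm_mul, Complex.norm_real, Complex.norm_real, yfun, norm_mul]
        gcongr
        exact mul_le_of_le_one_left (norm_nonneg _) (abs_cutoff_le_one R x)
      · rw [norm_mul, norm_mul, Complex.norm_real]
        have := hb R hR j j x
        rw [← Real.norm_eq_abs] at this
        have h2 : ‖(1 / 2 : ℂ)‖ = 1 / 2 := by norm_num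
        rw [h2]
        gcongr
    · intro x
      have h1 : ∀ j : Fin 3, Tendsto (fun R => ((yfun R j x : ℂ) * pd j f x
          + 1 / 2 * ((fderiv ℝ (yfun R j) x (e3 j) : ℂ) * f x))) atTop
          (𝓝 ((x j : ℂ) * pd j f x + 1 / 2 * ((1 : ℂ) * f x))) := by
        intro j
        have t1 : Tendsto (fun R => (yfun R j x : ℂ)) atTop (𝓝 (x j : ℂ)) := by
          have := (tendsto_cutoff x).mul_const (x j)
          rw [one_mul] at this
          exact (Complex.continuous_ofReal.tendsto _).comp this
        have t2 : Tendsto (fun R => (fderiv ℝ (yfun R j) x (e3 j) : ℂ)) atTop (𝓝 1) := by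
          have := (Complex.continuous_ofReal.tendsto _).comp (tendsto_fderiv_yfun j j x)
          simpa [Function.comp_def] using this
        exact (t1.mul_const _).add ((t2.mul_const _).const_mul _)
      have h2 := (tendsto_finsetSum Finset.univ fun j _ => h1 j).sub_const (dil f x)
      refine h2.trans_eq ?_
      congr 1
      rw [dil_apply, Fin.sum_univ_three, Fin.sum_univ_three]
      ring
  have hlim2 := (hlim.const_mul (l2norm f)).const_mul (boundA l₁ l₂)
  rw [mul_zero, mul_zero] at hlim2
  obtain ⟨R₀, hR₀⟩ := (eventually_atTop.mp (hlim2.eventually (gt_mem_nhds hε)))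
  refine ⟨R₀, fun R hRR hR => ?_⟩
  have h1 := bform_sub_right (l₁ := l₁) (l₂ := l₂) (f.memLp 2) ((vfield (yfield hR) f).memLp 2)
    ((dil f).memLp 2)
  have h2 := norm_bform_le (l₁ := l₁) (l₂ := l₂) (f.memLp 2)
    (((vfield (yfield hR) f).memLp 2).sub ((dil f).memLp 2))
  have h3 : (bform (symbolA l₁ l₂) f (vfield (yfield hR) f)).re
      = (bform (symbolA l₁ l₂) f (fun x => vfield (yfield hR) f x - dil f x)).re := by
    rw [h1, Complex.sub_re, re_bform_dil, sub_zero]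
  rw [h3]
  refine lt_of_le_of_lt ((Complex.abs_re_le_norm _).trans h2) ?_
  have := hR₀ R hRR
  rw [hF R hR] at this
  exact this

end DipolarGPE

end

noncomputable section

namespace DipolarGPE

open FourierTransform SchwartzMap LineDeriv

/-! ### Complex conjugation and densities of Schwartz functions -/

/-- The complex conjugate of a Schwartz function. -/
def conjS (u : 𝓢(R3, ℂ)) : 𝓢(R3, ℂ) := u.postcompCLM (Complex.conjCLE : ℂ →L[ℝ] ℂ)

theorem conjS_apply (u : 𝓢(R3, ℂ)) (x : R3) : conjS u x = star (u x) := rfl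

theorem pd_conjS (u : 𝓢(R3, ℂ)) (j : Fin 3) (x : R3) : pd j (conjS u) x = star (pd j u x) := by
  rw [lineDerivOp_apply_eq_fderiv, lineDerivOp_apply_eq_fderiv]
  have h := (Complex.conjCLE : ℂ →L[ℝ] ℂ).hasFDerivAt.comp x (u.hasFDerivAt x)
  exact congrArg (fun L => L (e3 j)) h.fderiv

theorem pd_mulS (p q : 𝓢(R3, ℂ)) (j : Fin 3) (x : R3) :
    pd j (mulS p q) x = pd j p x * q x + p x * pd j q x := by
  simp only [lineDerivOp_apply_eq_fderiv]
  have e : (mulS p q : R3 → ℂ) = fun x => p x * q x := by ext x; simp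
  rw [e, fderiv_fun_mul p.differentiableAt q.differentiableAt]
  simp; ring

theorem pd_comm (u : 𝓢(R3, ℂ)) (j k : Fin 3) (x : R3) : pd j (pd k u) x = pd k (pd j u) x := by
  have h1 : ∀ i l : Fin 3, pd i (pd l u) x = fderiv ℝ (fderiv ℝ u) x (e3 i) (e3 l) := by
    intro i l
    rw [lineDerivOp_apply_eq_fderiv]
    have e : (pd l u : R3 → ℂ) = fun y => fderiv ℝ u y (e3 l) := by
      ext y; rw [lineDerivOp_apply_eq_fderiv]
    have hd : DifferentiableAt ℝ (fderiv ℝ u) x :=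
      ((u.smooth 2).fderiv_right (m := 1) (by norm_num)).differentiable one_ne_zero x
    rw [e, fderiv_clm_apply hd (differentiableAt_const _)]
    simp
  rw [h1, h1]
  have hs : IsSymmSndFDerivAt ℝ u x :=
    ((u.smooth 2).contDiffAt).isSymmSndFDerivAt (by simp)
  exact hs.eq _ _

/-- The density `|u|²` of a Schwartz function. -/
def densS (u : 𝓢(R3, ℂ)) : 𝓢(R3, ℂ) := mulS u (conjS u)

theorem mul_star_eq (z : ℂ) : z * star z = ((‖z‖ ^ 2 : ℝ) : ℂ) := by
  rw [Complex.star_def, Complex.mul_conj, Complex.normSq_eq_norm_sq]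

theorem coe_densS (u : 𝓢(R3, ℂ)) : (densS u : R3 → ℂ) = dens u := by
  ext x
  rw [densS, mulS_apply, conjS_apply, mul_star_eq, dens]

theorem star_densS (u : 𝓢(R3, ℂ)) (x : R3) : star (densS u x) = densS u x := by
  rw [coe_densS, dens, Complex.star_def, Complex.conj_ofReal]

theorem pd_densS (u : 𝓢(R3, ℂ)) (j : Fin 3) (x : R3) :
    pd j (densS u) x = ((2 * (u x * star (pd j u x)).re : ℝ) : ℂ) := by
  rw [densS, pd_mulS, conjS_apply, pd_conjS, ← Complex.add_conj, map_mul, add_comm]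
  congr 1
  rw [mul_comm]
  congr 1
  exact (star_star _).symm

theorem fourier_conjS (g : 𝓢(R3, ℂ)) (ξ : R3) : 𝓕 (conjS g) ξ = star (𝓕 g (-ξ)) := by
  rw [fourier_apply_eq, fourier_apply_eq, Complex.star_def, ← integral_conj]
  congr 1; ext x
  rw [map_mul, ← Complex.exp_conj]
  refine congrArg₂ _ (congrArg _ ?_) rfl
  rw [map_mul, Complex.conj_ofReal, Complex.conj_I, inner_neg_right]
  push_cast; ring

/-- Conjugation in space becomes conjugation with reflection in frequency, and the symbol is real
and even. -/
theorem bform_conjS (l₁ l₂ : ℝ) (f g : 𝓢(R3, ℂ)) :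
    bform (symbolA l₁ l₂) (conjS f) (conjS g) = star (bform (symbolA l₁ l₂) f g) := by
  rw [bform_schwartz, bform_schwartz, Complex.star_def, ← integral_conj, ← integral_neg_eq_self]
  congr 1; ext ξ
  have : symbolA l₁ l₂ (-ξ) = symbolA l₁ l₂ ξ := by
    simpa using symbolA_smul l₁ l₂ (r := -1) (by norm_num) ξ
  rw [fourier_conjS, fourier_conjS, neg_neg, this, map_mul, map_mul, Complex.conj_ofReal]
  rfl

/-- When f is real, the real part of the form sees only Re g. This lets the test function be
replaced by its sum with its conjugate, at the price of a factor ½. -/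
theorem re_bform_eq (l₁ l₂ : ℝ) {f : 𝓢(R3, ℂ)} (hf : ∀ x, star (f x) = f x) (g : 𝓢(R3, ℂ)) :
    (bform (symbolA l₁ l₂) f g).re
      = 1 / 2 * (bform (symbolA l₁ l₂) f (fun x => g x + conjS g x)).re := by
  have h1 : conjS f = f := by ext x; exact hf x
  have h2 := bform_conjS l₁ l₂ f g
  rw [h1] at h2
  have h3 := bform_sub_right (l₁ := l₁) (l₂ := l₂) (f.memLp 2) (g.memLp 2) ((-conjS g).memLp 2)
  have h4 := bform_sub_right (l₁ := l₁) (l₂ := l₂) (f.memLp 2) ((0 : 𝓢(R3, ℂ)).memLp 2)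
    ((conjS g).memLp 2)
  have h5 := bform_sub_right (l₁ := l₁) (l₂ := l₂) (f.memLp 2) ((0 : 𝓢(R3, ℂ)).memLp 2)
    ((0 : 𝓢(R3, ℂ)).memLp 2)
  simp only [neg_apply, sub_neg_eq_add, zero_apply, zero_sub, neg_zero] at h3 h4 h5
  have e0 : ((0 : 𝓢(R3, ℂ)) : R3 → ℂ) = fun _ => 0 := by ext; rfl
  have e1 : ((-conjS g : 𝓢(R3, ℂ)) : R3 → ℂ) = fun x => -conjS g x := by ext; rfl
  rw [e0] at h4 h5
  rw [sub_self] at h5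
  rw [h5] at h4
  rw [h3, e1, h4, h2, Complex.sub_re, Complex.sub_re, Complex.star_def, Complex.conj_re]
  simp
  ring

/-! ### Integration by parts along the vector field -/

theorem re_integral_eq {F : R3 → ℂ} (hF : Integrable F) : (∫ x, F x).re = ∫ x, (F x).re := by
  have := integral_re hF
  simp only [RCLike.re_eq_complex_re] at this
  exact this.symm

theorem integrable_schwartz_mul_star (p q : 𝓢(R3, ℂ)) : Integrable fun x => p x * star (q x) :=
  integrable_mul_star (p.memLp 2) (q.memLp 2)

/-- Integration by parts with 2 Re(p conj ∂ⱼp) = ∂ⱼ|p|². -/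
theorem integral_yfield_pd {R : ℝ} (hR : 0 < R) (j : Fin 3) (p : 𝓢(R3, ℂ)) :
    ∫ x, yfun R j x * (p x * star (pd j p x)).re
      = -(1 / 2) * ∫ x, fderiv ℝ (yfun R j) x (e3 j) * ‖p x‖ ^ 2 := by
  have h := integral_mul_lineDerivOp_right_eq_neg_left (μ := volume) (yfield hR j) (densS p) (e3 j)
  have h1 : ∀ x, yfield hR j x * (∂_{e3 j} (densS p)) x
      = ((2 * (yfun R j x * (p x * star (pd j p x)).re) : ℝ) : ℂ) := by
    intro x
    have := pd_densS p j x
    rw [this, yfield_apply]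
    push_cast; ring
  have h2 : ∀ x, (∂_{e3 j} (yfield hR j)) x * densS p x
      = ((fderiv ℝ (yfun R j) x (e3 j) * ‖p x‖ ^ 2 : ℝ) : ℂ) := by
    intro x
    have := pd_yfield hR j j x
    rw [this, coe_densS, dens]
    push_cast; ring
  simp_rw [h1, h2] at h
  rw [integral_complex_ofReal, integral_complex_ofReal, integral_const_mul] at h
  have h3 : 2 * ∫ x, yfun R j x * (p x * star (pd j p x)).re
      = - ∫ x, fderiv ℝ (yfun R j) x (e3 j) * ‖p x‖ ^ 2 := by exact_mod_cast h
  linarith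

theorem integral_real_hasLineDerivAt_eq_zero {g g' : R3 → ℝ} {v : R3} (hg : Integrable g)
    (hg' : Integrable g') (h : ∀ x, HasLineDerivAt ℝ g (g' x) x v) : ∫ x, g' x = 0 := by
  have := integral_bilinear_hasLineDerivAt_right_eq_neg_left_of_integrable
    (μ := (volume : Measure R3)) (f := fun _ => (1 : ℝ)) (f' := fun _ => 0) (g := g) (g' := g')
    (v := v) (B := ContinuousLinearMap.mul ℝ ℝ) (by simp) (by simpa using hg') (by simpa using hg)
    (fun x _ => hasDerivAt_const _ _) (fun x _ => h x)
  simpa using this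

theorem hasDerivAt_norm_pow_five (u : 𝓢(R3, ℂ)) (j : Fin 3) (x : R3) :
    HasDerivAt (fun t : ℝ => ‖u (x + t • e3 j)‖ ^ 5)
      (5 * (‖u x‖ ^ 3 * (u x * star (pd j u x)).re)) 0 := by
  have h1 : HasDerivAt (fun t : ℝ => x + t • e3 j) (e3 j) 0 := by
    simpa using ((hasDerivAt_id (0 : ℝ)).smul_const (e3 j)).const_add x
  have h2 : HasDerivAt (fun t : ℝ => u (x + t • e3 j)) (fderiv ℝ u x (e3 j)) 0 := by
    have h0 : HasFDerivAt u (fderiv ℝ u x) (x + (0 : ℝ) • e3 j) := by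
      rw [zero_smul, add_zero]; exact u.hasFDerivAt x
    exact h0.comp_hasDerivAt 0 h1
  -- Differentiating (|u|²)^(5/2) rather than |u|⁵ avoids excluding the zeros of u, since the
  -- exponent is at least 1.
  have h3 := h2.norm_sq.rpow_const (p := 5 / 2) (Or.inr (by norm_num))
  have e1 : ∀ z : ℂ, (‖z‖ ^ 2) ^ (5 / 2 : ℝ) = ‖z‖ ^ 5 := by
    intro z
    rw [← Real.rpow_natCast, ← Real.rpow_mul (norm_nonneg _), ← Real.rpow_natCast]; norm_num
  have e2 : ∀ z : ℂ, (‖z‖ ^ 2) ^ (5 / 2 - 1 : ℝ) = ‖z‖ ^ 3 := by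
    intro z
    rw [← Real.rpow_natCast, ← Real.rpow_mul (norm_nonneg _), ← Real.rpow_natCast]; norm_num
  simp only [e1, e2, zero_smul, add_zero] at h3
  convert h3 using 1
  rw [lineDerivOp_apply_eq_fderiv, Complex.inner]
  have : (u x * star (fderiv ℝ u x (e3 j))).re
      = ((starRingEnd ℂ) (u x) * fderiv ℝ u x (e3 j)).re := by
    simp [Complex.mul_re]
  rw [this]; ring_nf

theorem integral_yfield_pow_five {R : ℝ} (hR : 0 < R) (j : Fin 3) (u : 𝓢(R3, ℂ)) :
    ∫ x, yfun R j x * (‖u x‖ ^ 3 * (u x * star (pd j u x)).re)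
      = -(1 / 5) * ∫ x, fderiv ℝ (yfun R j) x (e3 j) * ‖u x‖ ^ 5 := by
  have hyc : Continuous (yfun R j) := (contDiff_yfun R j).continuous
  have hdc : Continuous fun x => fderiv ℝ (yfun R j) x (e3 j) :=
    ((contDiff_yfun R j).continuous_fderiv (by simp)).clm_apply continuous_const
  have hys := hasCompactSupport_yfun hR j
  have hds : HasCompactSupport fun x => fderiv ℝ (yfun R j) x (e3 j) :=
    hys.fderiv_apply (𝕜 := ℝ) (e3 j)
  have huc := u.continuous
  have hpc := (pd j u).continuous
  have i1 : Integrable fun x => yfun R j x * (‖u x‖ ^ 3 * (u x * star (pd j u x)).re) := by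
    refine Continuous.integrable_of_hasCompactSupport ?_ hys.mul_right
    exact hyc.mul ((huc.norm.pow 3).mul (Complex.continuous_re.comp (huc.mul hpc.star)))
  have i2 : Integrable fun x => fderiv ℝ (yfun R j) x (e3 j) * ‖u x‖ ^ 5 :=
    (hdc.mul (huc.norm.pow 5)).integrable_of_hasCompactSupport hds.mul_right
  have i0 : Integrable fun x => yfun R j x * ‖u x‖ ^ 5 :=
    (hyc.mul (huc.norm.pow 5)).integrable_of_hasCompactSupport hys.mul_right
  have key : ∫ x, (fderiv ℝ (yfun R j) x (e3 j) * ‖u x‖ ^ 5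
      + yfun R j x * (5 * (‖u x‖ ^ 3 * (u x * star (pd j u x)).re))) = 0 := by
    refine integral_real_hasLineDerivAt_eq_zero (v := e3 j) (g := fun x => yfun R j x * ‖u x‖ ^ 5)
      i0 ?_ fun x => ?_
    · refine i2.add ((i1.const_mul 5).congr (ae_of_all _ fun x => ?_))
      simp only; ring
    · have h1 : HasDerivAt (fun t : ℝ => yfun R j (x + t • e3 j)) (fderiv ℝ (yfun R j) x (e3 j)) 0 :=
        ((contDiff_yfun R j).differentiable (by simp) x).hasFDerivAt.hasLineDerivAt (e3 j)
      have := h1.mul (hasDerivAt_norm_pow_five u j x)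
      simp only [zero_smul, add_zero] at this
      exact this
  rw [integral_add i2 ((i1.const_mul 5).congr (ae_of_all _ fun x => by simp only; ring))] at key
  have e : ∫ x, yfun R j x * (5 * (‖u x‖ ^ 3 * (u x * star (pd j u x)).re))
      = 5 * ∫ x, yfun R j x * (‖u x‖ ^ 3 * (u x * star (pd j u x)).re) := by
    rw [← integral_const_mul]; congr 1; ext x; ring
  rw [e] at key
  linarith

/-- The test function `y · ∇u`. -/
def ytest {R : ℝ} (hR : 0 < R) (u : 𝓢(R3, ℂ)) : 𝓢(R3, ℂ) := ∑ j, mulS (yfield hR j) (pd j u)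

theorem ytest_apply {R : ℝ} (hR : 0 < R) (u : 𝓢(R3, ℂ)) (x : R3) :
    ytest hR u x = ∑ j, (yfun R j x : ℂ) * pd j u x := by
  simp [ytest, yfield_apply]

theorem pd_ytest {R : ℝ} (hR : 0 < R) (u : 𝓢(R3, ℂ)) (k : Fin 3) (x : R3) :
    pd k (ytest hR u) x = ∑ j, ((fderiv ℝ (yfun R j) x (e3 k) : ℂ) * pd j u x
      + (yfun R j x : ℂ) * pd j (pd k u) x) := by
  have h1 : pd k (ytest hR u) = ∑ j, pd k (mulS (yfield hR j) (pd j u)) := by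
    have := map_sum (lineDerivOpCLM ℂ 𝓢(R3, ℂ) (e3 k)) (fun j => mulS (yfield hR j) (pd j u))
      Finset.univ
    exact this
  rw [h1]
  simp only [sum_apply]
  refine Finset.sum_congr rfl fun j _ => ?_
  rw [pd_mulS, pd_yfield, yfield_apply, pd_comm]

/-- The divergence of the vector field. -/
def ydiv (R : ℝ) (x : R3) : ℝ := ∑ j, fderiv ℝ (yfun R j) x (e3 j)

theorem continuous_fderiv_yfun (R : ℝ) (j k : Fin 3) :
    Continuous fun x => fderiv ℝ (yfun R j) x (e3 k) :=
  ((contDiff_yfun R j).continuous_fderiv (by simp)).clm_apply continuous_const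

theorem continuous_ydiv (R : ℝ) : Continuous (ydiv R) :=
  continuous_finsetSum _ fun j _ => continuous_fderiv_yfun R j j

theorem integrable_fderiv_yfun_mul {R : ℝ} (hR : 0 < R) (j k : Fin 3) {g : R3 → ℝ}
    (hg : Continuous g) : Integrable fun x => fderiv ℝ (yfun R j) x (e3 k) * g x :=
  ((continuous_fderiv_yfun R j k).mul hg).integrable_of_hasCompactSupport
    ((hasCompactSupport_yfun hR j).fderiv_apply (𝕜 := ℝ) (e3 k)).mul_right

theorem integrable_yfun_mul {R : ℝ} (hR : 0 < R) (j : Fin 3) {g : R3 → ℝ}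
    (hg : Continuous g) : Integrable fun x => yfun R j x * g x :=
  ((contDiff_yfun R j).continuous.mul hg).integrable_of_hasCompactSupport
    (hasCompactSupport_yfun hR j).mul_right

theorem integral_ydiv_mul {R : ℝ} (hR : 0 < R) {g : R3 → ℝ} (hg : Continuous g) :
    ∫ x, ydiv R x * g x = ∑ j, ∫ x, fderiv ℝ (yfun R j) x (e3 j) * g x := by
  simp_rw [ydiv, Finset.sum_mul]
  exact integral_finsetSum _ fun j _ => integrable_fderiv_yfun_mul hR j j hg

theorem continuous_re_mul_star (p q : 𝓢(R3, ℂ)) : Continuous fun x => (p x * star (q x)).re :=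
  Complex.continuous_re.comp (p.continuous.mul q.continuous.star)

theorem re_integral_mul_star_ytest {R : ℝ} (hR : 0 < R) (u : 𝓢(R3, ℂ)) :
    (∫ x, u x * star (ytest hR u x)).re = -(1 / 2) * ∫ x, ydiv R x * ‖u x‖ ^ 2 := by
  rw [re_integral_eq (integrable_schwartz_mul_star _ _),
    integral_ydiv_mul hR (g := fun x => ‖u x‖ ^ 2) (u.continuous.norm.pow 2), Finset.mul_sum]
  simp_rw [← integral_yfield_pd hR]
  rw [← integral_finsetSum _ fun j _ => integrable_yfun_mul hR j (continuous_re_mul_star u (pd j u))]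
  congr 1; ext x
  rw [ytest_apply, star_sum, Finset.mul_sum, Complex.re_sum]
  refine Finset.sum_congr rfl fun j _ => ?_
  rw [star_mul', Complex.star_def, Complex.conj_ofReal, ← Complex.star_def, mul_left_comm,
    Complex.re_ofReal_mul]

theorem re_integral_cube_mul_star_ytest {R : ℝ} (hR : 0 < R) (u : 𝓢(R3, ℂ)) :
    (∫ x, ((‖u x‖ ^ 3 : ℝ) : ℂ) * u x * star (ytest hR u x)).re
      = -(1 / 5) * ∫ x, ydiv R x * ‖u x‖ ^ 5 := by
  rw [re_integral_eq (integrable_cube_mul (memH1_schwartz u) (memH1_schwartz (ytest hR u))),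
    integral_ydiv_mul hR (g := fun x => ‖u x‖ ^ 5) (u.continuous.norm.pow 5), Finset.mul_sum]
  simp_rw [← integral_yfield_pow_five hR]
  rw [← integral_finsetSum _ fun j _ => integrable_yfun_mul hR j
    (g := fun x => ‖u x‖ ^ 3 * (u x * star (pd j u x)).re)
    ((u.continuous.norm.pow 3).mul (continuous_re_mul_star u (pd j u)))]
  congr 1; ext x
  rw [ytest_apply, star_sum, mul_assoc, Complex.re_ofReal_mul, Finset.mul_sum, Complex.re_sum,
    Finset.mul_sum]
  refine Finset.sum_congr rfl fun j _ => ?_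
  rw [star_mul', Complex.star_def, Complex.conj_ofReal, ← Complex.star_def, mul_left_comm,
    Complex.re_ofReal_mul]
  ring

theorem gradForm_schwartz (u v : 𝓢(R3, ℂ)) :
    gradForm u v = ∑ k, ∫ x, pd k u x * star (pd k v x) := by
  unfold gradForm
  refine Finset.sum_congr rfl fun k _ => integral_congr_ae ?_
  filter_upwards [weakPartial_schwartz u k, weakPartial_schwartz v k] with x h1 h2
  rw [h1, h2]

/-- Where the derivative falls on the field, the first sum appears. Where it falls on ∇u, the
integrand is the derivative of ½|∂ₖu|² along the field and is integrated by parts. -/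
theorem re_gradForm_ytest {R : ℝ} (hR : 0 < R) (u : 𝓢(R3, ℂ)) :
    (gradForm u (ytest hR u)).re
      = (∑ k, ∑ j, ∫ x, fderiv ℝ (yfun R j) x (e3 k) * (pd k u x * star (pd j u x)).re)
        - 1 / 2 * ∑ k, ∫ x, ydiv R x * ‖pd k u x‖ ^ 2 := by
  rw [gradForm_schwartz, Complex.re_sum, Finset.mul_sum, ← Finset.sum_sub_distrib]
  refine Finset.sum_congr rfl fun k _ => ?_
  rw [re_integral_eq (integrable_schwartz_mul_star _ _),
    integral_ydiv_mul hR (g := fun x => ‖pd k u x‖ ^ 2) ((pd k u).continuous.norm.pow 2), Finset.mul_sum,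
    ← Finset.sum_sub_distrib]
  have h1 : ∀ j, (∫ x, fderiv ℝ (yfun R j) x (e3 k) * (pd k u x * star (pd j u x)).re)
      - 1 / 2 * ∫ x, fderiv ℝ (yfun R j) x (e3 j) * ‖pd k u x‖ ^ 2
      = ∫ x, (fderiv ℝ (yfun R j) x (e3 k) * (pd k u x * star (pd j u x)).re
        + yfun R j x * (pd k u x * star (pd j (pd k u) x)).re) := by
    intro j
    rw [integral_add (integrable_fderiv_yfun_mul hR j k (continuous_re_mul_star (pd k u) (pd j u)))
      (integrable_yfun_mul hR j (continuous_re_mul_star (pd k u) (pd j (pd k u)))),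
      integral_yfield_pd hR]
    ring
  simp_rw [h1]
  rw [← integral_finsetSum _ fun j _ => (integrable_fderiv_yfun_mul hR j k
    (continuous_re_mul_star (pd k u) (pd j u))).fun_add
    (integrable_yfun_mul hR j (continuous_re_mul_star (pd k u) (pd j (pd k u))))]
  congr 1; ext x
  rw [pd_ytest, star_sum, Finset.mul_sum, Complex.re_sum]
  refine Finset.sum_congr rfl fun j _ => ?_
  rw [star_add, star_mul', star_mul', mul_add, Complex.add_re]
  simp only [Complex.star_def, Complex.conj_ofReal]
  rw [mul_left_comm, Complex.re_ofReal_mul, mul_left_comm, Complex.re_ofReal_mul]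

/-- With ρ = |u|², adding the conjugate of conj(u) y·∇u gives y·∇ρ, which is the skew-adjoint field
applied to ρ minus ½ (div y) ρ. The further factor ½ is that of `re_bform_eq`. -/
theorem re_bform_ytest (l₁ l₂ : ℝ) {R : ℝ} (hR : 0 < R) (u : 𝓢(R3, ℂ)) :
    (bform (symbolA l₁ l₂) (dens u) (fun x => star (u x) * ytest hR u x)).re
      = 1 / 2 * (bform (symbolA l₁ l₂) (densS u) (vfield (yfield hR) (densS u))).re
        - 1 / 4 * (bform (symbolA l₁ l₂) (dens u) (fun x => (ydiv R x : ℂ) * dens u x)).re := by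
  have e1 : (fun x => star (u x) * ytest hR u x) = mulS (conjS u) (ytest hR u) := by
    ext x; rw [mulS_apply, conjS_apply]
  let D : 𝓢(R3, ℂ) := ∑ j, mulS (pd j (yfield hR j)) (densS u)
  have hD : ∀ x, D x = (ydiv R x : ℂ) * dens u x := by
    intro x
    simp only [D, sum_apply, mulS_apply, pd_yfield, coe_densS, ydiv]
    push_cast
    rw [Finset.sum_mul]
  rw [← coe_densS, e1, re_bform_eq l₁ l₂ (star_densS u)]
  have e2 : (fun x => mulS (conjS u) (ytest hR u) x + conjS (mulS (conjS u) (ytest hR u)) x)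
      = fun x => vfield (yfield hR) (densS u) x - ((1 / 2 : ℂ) • D) x := by
    ext x
    rw [vfield_apply, smul_apply, hD, conjS_apply, mulS_apply, conjS_apply, ytest_apply,
      ← coe_densS, ydiv]
    simp only [pd_densS, yfield_apply, pd_yfield]
    have hj : ∀ j, ((2 * (u x * star (pd j u x)).re : ℝ) : ℂ)
        = u x * star (pd j u x) + star (u x) * pd j u x := by
      intro j
      rw [← Complex.add_conj, map_mul, Complex.star_def, Complex.conj_conj]
    simp only [hj, Fin.sum_univ_three, star_mul', star_add, star_star]
    simp only [Complex.star_def, Complex.conj_ofReal, smul_eq_mul]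
    push_cast
    ring
  have h3 := bform_sub_right (l₁ := l₁) (l₂ := l₂) ((densS u).memLp 2)
    ((vfield (yfield hR) (densS u)).memLp 2) (((1 / 2 : ℂ) • D).memLp 2)
  have h4 : bform (symbolA l₁ l₂) (densS u) ((1 / 2 : ℂ) • D : 𝓢(R3, ℂ))
      = (1 / 2 : ℂ) * bform (symbolA l₁ l₂) (densS u) D := by
    have h5 : 𝓕 ((1 / 2 : ℂ) • D) = (1 / 2 : ℂ) • 𝓕 D :=
      map_smul (fourierCLM ℂ 𝓢(R3, ℂ)) (1 / 2 : ℂ) D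
    rw [bform_schwartz, bform_schwartz, ← integral_const_mul, h5]
    congr 1; ext ξ
    rw [smul_apply, smul_eq_mul, star_mul']
    have : star (1 / 2 : ℂ) = 1 / 2 := by simp
    rw [this]; ring
  have h6 : (fun x => (ydiv R x : ℂ) * (densS u) x) = D := by
    ext x; rw [hD, coe_densS]
  rw [e2, h3, h4, h6, Complex.sub_re]
  have : ((1 / 2 : ℂ) * bform (symbolA l₁ l₂) (densS u) D).re
      = 1 / 2 * (bform (symbolA l₁ l₂) (densS u) D).re := by
    rw [show (1 / 2 : ℂ) = ((1 / 2 : ℝ) : ℂ) by push_cast; ring, Complex.re_ofReal_mul]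
  rw [this]; ring

end DipolarGPE

end

noncomputable section

namespace DipolarGPE

open FourierTransform SchwartzMap LineDeriv

/-! ### Estimates in the `H¹` norm -/

/-- The `H¹` norm. -/
def h1n (u : R3 → ℂ) : ℝ := l2norm u + gradNorm u

theorem h1n_nonneg (u : R3 → ℂ) : 0 ≤ h1n u := add_nonneg (l2norm_nonneg u) (gradNorm_nonneg u)

theorem l2norm_le_h1n (u : R3 → ℂ) : l2norm u ≤ h1n u := le_add_of_nonneg_right (gradNorm_nonneg u)

theorem gradNorm_le_h1n (u : R3 → ℂ) : gradNorm u ≤ h1n u :=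
  le_add_of_nonneg_left (l2norm_nonneg u)

theorem l2norm_weakPartial_le_h1n (u : R3 → ℂ) (i : Fin 3) : l2norm (weakPartial i u) ≤ h1n u :=
  (Finset.single_le_sum (f := fun i => l2norm (weakPartial i u)) (fun _ _ => l2norm_nonneg _)
    (Finset.mem_univ i)).trans (gradNorm_le_h1n u)

theorem exists_h1_bounds : ∃ S : ℝ, 0 ≤ S ∧
    (∀ u, MemH1 u → l2norm (fun x => ‖u x‖ ^ 2) ≤ S * h1n u ^ 2) ∧
    (∀ u, MemH1 u → l2norm (fun x => ‖u x‖ ^ 3) ≤ S * h1n u ^ 3) ∧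
    ∀ u v, MemH1 u → MemH1 v → l2norm (fun x => ‖u x‖ * ‖v x‖) ≤ S * (h1n u * h1n v) := by
  obtain ⟨S₀, hS₀, h0⟩ := exists_sq_l2norm_sq_le
  obtain ⟨S₁, hS₁, h1⟩ := exists_sobolev_cube
  have hs := Real.sqrt_nonneg S₀
  have hss := Real.sq_sqrt hS₀
  have a2 : ∀ u, MemH1 u → l2norm (fun x => ‖u x‖ ^ 2) ≤ √S₀ * h1n u ^ 2 := by
    intro u hu
    have hn := h1n_nonneg u
    refine le_of_sq_le_sq ?_ (by positivity)
    refine (h0 u hu).trans ?_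
    rw [mul_pow, hss]
    refine mul_le_mul_of_nonneg_left ?_ hS₀
    calc l2norm u * gradNorm u ^ 3 ≤ h1n u * h1n u ^ 3 := by
          gcongr
          · exact pow_nonneg (gradNorm_nonneg u) 3
          · exact l2norm_le_h1n u
          · exact gradNorm_nonneg u
          · exact gradNorm_le_h1n u
      _ = _ := by ring
  refine ⟨√S₀ + S₁, by positivity, fun u hu => ?_, fun u hu => ?_, fun u v hu hv => ?_⟩
  · have := a2 u hu
    nlinarith [mul_nonneg hS₁ (sq_nonneg (h1n u))]
  · have h3 : l2norm (fun x => ‖u x‖ ^ 3) ≤ S₁ * h1n u ^ 3 := by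
      refine (h1 u hu).trans (mul_le_mul_of_nonneg_left ?_ hS₁)
      exact pow_le_pow_left₀ (gradNorm_nonneg u) (gradNorm_le_h1n u) 3
    nlinarith [mul_nonneg hs (pow_nonneg (h1n_nonneg u) 3)]
  · have hu0 := h1n_nonneg u
    have hv0 := h1n_nonneg v
    have h4 : l2norm (fun x => ‖u x‖ * ‖v x‖) ≤ √S₀ * (h1n u * h1n v) := by
      refine le_of_sq_le_sq ?_ (by positivity)
      refine (sq_l2norm_mul_le hu.1 hu.memLp_six hv.1 hv.memLp_six).trans ?_
      refine (mul_le_mul (a2 u hu) (a2 v hv) (l2norm_nonneg _) (by positivity)).trans_eq ?_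
      ring
    nlinarith [mul_nonneg hS₁ (mul_nonneg hu0 hv0)]

theorem l2norm_dens (u : R3 → ℂ) : l2norm (dens u) = l2norm fun x => ‖u x‖ ^ 2 :=
  l2norm_congr_norm (ae_of_all _ fun x => by simp [dens])

theorem norm_integral_mul_star_le {f g : R3 → ℂ} (hf : MemLp f 2) (hg : MemLp g 2) :
    ‖∫ x, f x * star (g x)‖ ≤ l2norm f * l2norm g :=
  norm_integral_le_l2norm_mul hf hg
    (ae_of_all _ fun x => ((norm_mul _ _).trans (by rw [norm_star])).le)

theorem norm_gradForm_le {u φ : R3 → ℂ} (hu : MemH1 u) (hφ : MemH1 φ) :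
    ‖gradForm u φ‖ ≤ h1n u * h1n φ := by
  unfold gradForm
  refine (norm_sum_le _ _).trans ?_
  calc ∑ i, ‖∫ x, weakPartial i u x * star (weakPartial i φ x)‖
      ≤ ∑ i, l2norm (weakPartial i u) * h1n φ := by
        refine Finset.sum_le_sum fun i _ => ?_
        refine (norm_integral_mul_star_le (weakPartial_spec hu i).1
          (weakPartial_spec hφ i).1).trans ?_
        exact mul_le_mul_of_nonneg_left (l2norm_weakPartial_le_h1n φ i) (l2norm_nonneg _)
    _ = gradNorm u * h1n φ := by rw [← Finset.sum_mul, gradNorm]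
    _ ≤ _ := mul_le_mul_of_nonneg_right (gradNorm_le_h1n u) (h1n_nonneg φ)

/-- The left-hand side of the equation is locally Lipschitz in `u`. -/
theorem exists_weakForm_sub_le (l₁ l₂ l₃ β : ℝ) : ∃ K : ℝ, 0 ≤ K ∧ ∀ u v φ : R3 → ℂ,
    MemH1 u → MemH1 v → MemH1 φ → ‖weakForm l₁ l₂ l₃ β u φ - weakForm l₁ l₂ l₃ β v φ‖
      ≤ K * (h1n (fun x => u x - v x) * (1 + h1n u + h1n v) ^ 3 * h1n φ) := by
  obtain ⟨S, hS, s2, s3, s11⟩ := exists_h1_bounds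
  have hM := boundA_nonneg l₁ l₂
  refine ⟨1 / 2 + boundA l₁ l₂ * (2 * S ^ 2) + |l₃| * (4 * S ^ 2) + |β|, by positivity,
    fun u v φ hu hv hφ => ?_⟩
  have hd := hu.sub hv
  have hu0 := h1n_nonneg u
  have hv0 := h1n_nonneg v
  have hφ0 := h1n_nonneg φ
  have hd0 := h1n_nonneg fun x => u x - v x
  set d := h1n fun x => u x - v x
  set H := 1 + h1n u + h1n v with hH
  have hH1 : 1 ≤ H := by linarith
  have huH : h1n u ≤ H := by linarith
  have hvH : h1n v ≤ H := by linarith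
  have hH0 : 0 ≤ H := by linarith
  set p := h1n φ
  have hH2 : H ^ 2 ≤ H ^ 3 := pow_le_pow_right₀ hH1 (by norm_num)
  have hH3 : 1 ≤ H ^ 3 := one_le_pow₀ hH1
  have g1 : ‖gradForm u φ - gradForm v φ‖ ≤ d * H ^ 3 * p := by
    rw [← gradForm_sub_left hu hv hφ]
    refine (norm_gradForm_le hd hφ).trans ?_
    calc d * p = d * 1 * p := by ring
      _ ≤ d * H ^ 3 * p := by gcongr
  have g2 : ‖bform (symbolA l₁ l₂) (dens u) (fun x => star (u x) * φ x)
        - bform (symbolA l₁ l₂) (dens v) (fun x => star (v x) * φ x)‖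
      ≤ boundA l₁ l₂ * (2 * S ^ 2) * (d * H ^ 3 * p) := by
    refine (norm_bform_dens_sub_le hu hv hφ).trans ?_
    rw [l2norm_dens, mul_assoc]
    refine mul_le_mul_of_nonneg_left ?_ hM
    calc _ ≤ (S * (d * h1n u) + S * (d * h1n v)) * (S * (h1n u * p))
          + S * h1n v ^ 2 * (S * (d * p)) := by
          refine add_le_add (mul_le_mul (add_le_add (s11 _ _ hd hu) (s11 _ _ hd hv))
            (s11 _ _ hu hφ) (l2norm_nonneg _) (by positivity))
            (mul_le_mul (s2 v hv) (s11 _ _ hd hφ) (l2norm_nonneg _) (by positivity))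
      _ = S ^ 2 * (d * ((h1n u + h1n v) * h1n u + h1n v ^ 2) * p) := by ring
      _ ≤ S ^ 2 * (d * (H * H + H ^ 2) * p) := by
          gcongr
          linarith
      _ = 2 * S ^ 2 * (d * H ^ 2 * p) := by ring
      _ ≤ 2 * S ^ 2 * (d * H ^ 3 * p) := by gcongr
  have g3 : ‖(∫ x, ((‖u x‖ ^ 3 : ℝ) : ℂ) * u x * star (φ x))
        - ∫ x, ((‖v x‖ ^ 3 : ℝ) : ℂ) * v x * star (φ x)‖ ≤ 4 * S ^ 2 * (d * H ^ 3 * p) := by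
    refine (norm_integral_cube_sub_le hu hv hφ).trans ?_
    calc _ ≤ 2 * ((S * H ^ 3 + S * H ^ 3) * (S * (d * p))) := by
          refine mul_le_mul_of_nonneg_left (mul_le_mul (add_le_add ((s3 u hu).trans ?_)
            ((s3 v hv).trans ?_)) (s11 _ _ hd hφ) (l2norm_nonneg _) (by positivity)) (by norm_num)
          · gcongr
          · gcongr
      _ = _ := by ring
  have g4 : ‖(∫ x, u x * star (φ x)) - ∫ x, v x * star (φ x)‖ ≤ d * H ^ 3 * p := by
    rw [← integral_sub (integrable_mul_star hu.1 hφ.1) (integrable_mul_star hv.1 hφ.1)]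
    simp_rw [← sub_mul]
    refine (norm_integral_mul_star_le hd.1 hφ.1).trans ?_
    calc _ ≤ d * p := mul_le_mul (l2norm_le_h1n _) (l2norm_le_h1n _) (l2norm_nonneg _) hd0
      _ = d * 1 * p := by ring
      _ ≤ d * H ^ 3 * p := by gcongr
  have e : weakForm l₁ l₂ l₃ β u φ - weakForm l₁ l₂ l₃ β v φ
      = (1 / 2 : ℂ) * (gradForm u φ - gradForm v φ)
        + (bform (symbolA l₁ l₂) (dens u) (fun x => star (u x) * φ x)
          - bform (symbolA l₁ l₂) (dens v) (fun x => star (v x) * φ x))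
        + (l₃ : ℂ) * ((∫ x, ((‖u x‖ ^ 3 : ℝ) : ℂ) * u x * star (φ x))
          - ∫ x, ((‖v x‖ ^ 3 : ℝ) : ℂ) * v x * star (φ x))
        + (β : ℂ) * ((∫ x, u x * star (φ x)) - ∫ x, v x * star (φ x)) := by
    unfold weakForm; ring
  rw [e, add_mul, add_mul, add_mul]
  refine (norm_add_le _ _).trans (add_le_add ((norm_add_le _ _).trans (add_le_add
    ((norm_add_le _ _).trans (add_le_add ?_ g2)) ?_)) ?_)
  · rw [norm_mul, show ‖(1 / 2 : ℂ)‖ = 1 / 2 by norm_num]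
    exact mul_le_mul_of_nonneg_left g1 (by norm_num)
  · rw [norm_mul, Complex.norm_real, mul_assoc]
    exact mul_le_mul_of_nonneg_left g3 (norm_nonneg _)
  · rw [norm_mul, Complex.norm_real]
    exact mul_le_mul_of_nonneg_left g4 (norm_nonneg _)

/-! ### Approximation in `H²` -/

/-- The `L²` norms of the first and second derivatives. -/
def h2n (v : 𝓢(R3, ℂ)) : ℝ := ∑ j, l2norm (pd j v) + ∑ k, ∑ j, l2norm (pd j (pd k v))

theorem h1n_sub_schwartz {u : R3 → ℂ} (hu : MemH1 u) (φ : 𝓢(R3, ℂ)) :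
    h1n (fun x => u x - φ x)
      = l2norm (fun x => φ x - u x) + ∑ i, l2norm (fun x => pd i φ x - weakPartial i u x) := by
  unfold h1n gradNorm
  congr 1
  · exact l2norm_congr_norm (ae_of_all _ fun x => norm_sub_rev _ _)
  · refine Finset.sum_congr rfl fun i _ => l2norm_congr_norm ?_
    filter_upwards [weakPartial_sub hu (memH1_schwartz φ) i, weakPartial_schwartz φ i] with x h1 h2
    rw [h1, h2, norm_sub_rev]

theorem l2norm_fourier (s : 𝓢(R3, ℂ)) : l2norm (𝓕 s : 𝓢(R3, ℂ)) = l2norm s := by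
  refine Eq.trans ?_ (l2norm_ft2 (s.memLp 2))
  exact l2norm_congr_norm ((ft2_schwartz s).symm.mono fun x hx => by rw [hx])

/-- The point is that B does not depend on δ: approximation in the weighted Fourier norm controls
the second derivatives at the same time as the H¹ error. -/
theorem exists_schwartz_near_h2 {u : R3 → ℂ} (hu : MemH1 u)
    (hw : MemLp (fun ξ => (1 + ‖ξ‖ ^ 2) ^ (1 : ℝ) • ft2 u ξ) 2) : ∃ B : ℝ, 0 ≤ B ∧
      ∀ δ : ℝ, 0 < δ → δ ≤ 1 → ∃ φ : 𝓢(R3, ℂ), h1n (fun x => u x - φ x) < δ ∧ h2n φ ≤ B := by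
  have hpi := Real.pi_pos
  set N := l2norm fun ξ => (1 + ‖ξ‖ ^ 2) ^ (1 : ℝ) • ft2 u ξ
  have hN : 0 ≤ N := l2norm_nonneg _
  refine ⟨3 * (2 * Real.pi * (N + 1)) + 9 * ((2 * Real.pi) ^ 2 * (N + 1)), by positivity,
    fun δ hδ hδ1 => ?_⟩
  have hc : 0 < 1 + 3 * (2 * Real.pi) := by positivity
  obtain ⟨φ, hφ⟩ := exists_schwartz_weight 1 hw (δ := δ / (1 + 3 * (2 * Real.pi))) (by positivity)
  have hm := memLp_sub_schwartz_weight 1 hw φ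
  simp only [Real.rpow_one] at hφ hm
  have scale : ∀ (c : ℝ), 0 ≤ c → ∀ (a : R3 → ℝ) (g : R3 → ℂ),
      MemLp (fun ξ => (1 + ‖ξ‖ ^ 2) • g ξ) 2 → (∀ ξ, |a ξ| ≤ c * (1 + ‖ξ‖ ^ 2)) →
      l2norm (fun ξ => a ξ • g ξ) ≤ c * l2norm fun ξ => (1 + ‖ξ‖ ^ 2) • g ξ := by
    intro c hc0 a g hg ha
    have h1 : MemLp (fun ξ => (c * (1 + ‖ξ‖ ^ 2)) • g ξ) 2 := by
      simp_rw [mul_smul]; exact hg.const_smul c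
    refine (l2norm_smul_mono ha h1).trans_eq ?_
    simp_rw [mul_smul]
    rw [l2norm_const_smul, abs_of_nonneg hc0]
  have hx1 : ∀ ξ : R3, ‖ξ‖ ≤ 1 + ‖ξ‖ ^ 2 := fun ξ => by nlinarith [sq_nonneg (‖ξ‖ - 1)]
  have hcoord : ∀ (i : Fin 3) (ξ : R3), |2 * Real.pi * ξ i| ≤ 2 * Real.pi * (1 + ‖ξ‖ ^ 2) := by
    intro i ξ
    rw [abs_mul, abs_of_pos (by positivity : 0 < 2 * Real.pi)]
    gcongr
    exact (abs_coord_le ξ i).trans (hx1 ξ)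
  refine ⟨φ, ?_, ?_⟩
  · rw [h1n_sub_schwartz hu, l2norm_sub_schwartz hu.1]
    simp_rw [l2norm_pd_sub_weakPartial hu]
    set e := l2norm fun ξ => (1 + ‖ξ‖ ^ 2) • (𝓕 φ ξ - ft2 u ξ)
    have b0 : l2norm (fun ξ => 𝓕 φ ξ - ft2 u ξ) ≤ 1 * e := by
      have := scale 1 zero_le_one (fun _ => 1) _ hm fun ξ => by
        rw [abs_one]; nlinarith [sq_nonneg ‖ξ‖]
      simp only [one_smul] at this
      exact this
    have b1 : ∀ i : Fin 3, l2norm (fun ξ => (2 * Real.pi * ξ i) • (𝓕 φ ξ - ft2 u ξ))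
        ≤ 2 * Real.pi * e := fun i => scale _ (by positivity) _ _ hm (hcoord i)
    have b2 := Finset.sum_le_sum fun (i : Fin 3) (_ : i ∈ Finset.univ) => b1 i
    simp only [Finset.sum_const, Finset.card_univ, Fintype.card_fin, nsmul_eq_mul] at b2
    have b3 := (lt_div_iff₀ hc).mp hφ
    push_cast at b2
    nlinarith
  · have hgm : MemLp (fun ξ => (1 + ‖ξ‖ ^ 2) • 𝓕 φ ξ) 2 := by
      have h3 := hm.add hw
      refine h3.congr_norm ?_ (ae_of_all _ fun ξ => ?_)
      · exact (Continuous.aestronglyMeasurable (f := fun ξ : R3 => 1 + ‖ξ‖ ^ 2) (by fun_prop)).smul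
          (𝓕 φ).continuous.aestronglyMeasurable
      · simp only [Pi.add_apply, Real.rpow_one]
        rw [← smul_add, sub_add_cancel]
    have hg : l2norm (fun ξ => (1 + ‖ξ‖ ^ 2) • 𝓕 φ ξ) ≤ N + 1 := by
      have h4 := l2norm_add_le hm hw
      have h5 : (fun ξ => (1 + ‖ξ‖ ^ 2) • (𝓕 φ ξ - ft2 u ξ) + (1 + ‖ξ‖ ^ 2) ^ (1 : ℝ) • ft2 u ξ)
          = fun ξ => (1 + ‖ξ‖ ^ 2) • 𝓕 φ ξ := by
        ext ξ; rw [Real.rpow_one, ← smul_add, sub_add_cancel]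
      rw [h5] at h4
      have h6 : δ / (1 + 3 * (2 * Real.pi)) ≤ 1 := by
        rw [div_le_one hc]; linarith
      linarith
    have b1 : ∀ j : Fin 3, l2norm (pd j φ) ≤ 2 * Real.pi * (N + 1) := by
      intro j
      rw [← l2norm_fourier]
      have h1 := scale (2 * Real.pi) (by positivity) _ _ hgm (hcoord j)
      refine le_trans (le_of_eq (l2norm_congr_norm (ae_of_all _ fun ξ => ?_)))
        (h1.trans (mul_le_mul_of_nonneg_left hg (by positivity)))
      rw [fourier_lineDeriv, norm_mul, norm_smul]; simp
    have b2 : ∀ k j : Fin 3, l2norm (pd j (pd k φ)) ≤ (2 * Real.pi) ^ 2 * (N + 1) := by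
      intro k j
      rw [← l2norm_fourier]
      have h1 := scale ((2 * Real.pi) ^ 2) (by positivity)
        (fun ξ => (2 * Real.pi * ξ j) * (2 * Real.pi * ξ k)) _ hgm fun ξ => by
          rw [abs_mul (2 * Real.pi * ξ j), abs_mul (2 * Real.pi) (ξ j),
            abs_mul (2 * Real.pi) (ξ k), abs_of_pos (by positivity : 0 < 2 * Real.pi)]
          have e1 := abs_coord_le ξ j
          have e2 := abs_coord_le ξ k
          have e3 : |ξ j| * |ξ k| ≤ 1 + ‖ξ‖ ^ 2 := by
            refine (mul_le_mul e1 e2 (abs_nonneg _) (norm_nonneg _)).trans ?_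
            nlinarith
          calc 2 * Real.pi * |ξ j| * (2 * Real.pi * |ξ k|)
              = (2 * Real.pi) ^ 2 * (|ξ j| * |ξ k|) := by ring
            _ ≤ _ := by gcongr
      refine le_trans (le_of_eq (l2norm_congr_norm (ae_of_all _ fun ξ => ?_)))
        (h1.trans (mul_le_mul_of_nonneg_left hg (by positivity)))
      rw [fourier_lineDeriv, fourier_lineDeriv, norm_mul, norm_mul, norm_smul, norm_mul]
      simp; ring
    unfold h2n
    have c1 := Finset.sum_le_sum fun (i : Fin 3) (_ : i ∈ Finset.univ) => b1 i
    have c2 := Finset.sum_le_sum fun (k : Fin 3) (_ : k ∈ Finset.univ) =>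
      Finset.sum_le_sum fun (i : Fin 3) (_ : i ∈ Finset.univ) => b2 k i
    simp only [Finset.sum_const, Finset.card_univ, Fintype.card_fin, nsmul_eq_mul] at c1 c2
    push_cast at c1 c2
    linarith

end DipolarGPE

end

noncomputable section

namespace DipolarGPE

open FourierTransform SchwartzMap LineDeriv

/-! ### The approximating sequence -/

theorem l2norm_sum_le {ι : Type*} (s : Finset ι) {f : ι → R3 → ℂ} (hf : ∀ i ∈ s, MemLp (f i) 2) :
    l2norm (fun x => ∑ i ∈ s, f i x) ≤ ∑ i ∈ s, l2norm (f i) := by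
  classical
  induction s using Finset.induction_on with
  | empty => simp [l2norm]
  | insert a s ha ih =>
    simp_rw [Finset.sum_insert ha]
    have h1 : ∀ i ∈ s, MemLp (f i) 2 := fun i hi => hf i (Finset.mem_insert_of_mem hi)
    refine (l2norm_add_le (hf a (Finset.mem_insert_self a s)) (memLp_finsetSum s h1)).trans ?_
    exact add_le_add le_rfl (ih h1)

theorem l2norm_ofReal_mul_le {a : R3 → ℝ} {M : ℝ} (hM : 0 ≤ M) (ha : ∀ x, |a x| ≤ M) {w : R3 → ℂ}
    (hw : MemLp w 2) : l2norm (fun x => (a x : ℂ) * w x) ≤ M * l2norm w := by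
  have h1 : l2norm (fun x => M • w x) = M * l2norm w := by
    rw [l2norm_const_smul, abs_of_nonneg hM]
  rw [← h1]
  refine l2norm_mono (hw.const_smul M) (ae_of_all _ fun x => ?_)
  rw [norm_mul, norm_smul, Complex.norm_real, Real.norm_eq_abs, Real.norm_eq_abs, abs_of_nonneg hM]
  exact mul_le_mul_of_nonneg_right (ha x) (norm_nonneg _)

theorem memLp_ofReal_mul {a : R3 → ℝ} {M : ℝ} (hac : Continuous a) (ha : ∀ x, |a x| ≤ M)
    {w : R3 → ℂ} (hw : MemLp w 2) : MemLp (fun x => (a x : ℂ) * w x) 2 := by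
  refine MemLp.of_le_mul (c := M) hw
    ((Complex.continuous_ofReal.comp hac).aestronglyMeasurable.mul hw.1) (ae_of_all _ fun x => ?_)
  rw [norm_mul, Complex.norm_real]
  exact mul_le_mul_of_nonneg_right (ha x) (norm_nonneg _)

theorem exists_yfun_bound {R : ℝ} (hR : 0 < R) : ∃ M : ℝ, 0 ≤ M ∧
    (∀ j x, |yfun R j x| ≤ M) ∧ ∀ j k x, |fderiv ℝ (yfun R j) x (e3 k)| ≤ M := by
  have h1 : ∀ j, ∃ C, ∀ x, ‖yfun R j x‖ ≤ C := fun j =>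
    (hasCompactSupport_yfun hR j).exists_bound_of_continuous (contDiff_yfun R j).continuous
  have h2 : ∀ j k, ∃ C, ∀ x, ‖fderiv ℝ (yfun R j) x (e3 k)‖ ≤ C := fun j k =>
    ((hasCompactSupport_yfun hR j).fderiv_apply (𝕜 := ℝ) (e3 k)).exists_bound_of_continuous
      (continuous_fderiv_yfun R j k)
  choose c hc using h1
  choose d hd using h2
  have hc0 : ∀ j, 0 ≤ c j := fun j => (norm_nonneg _).trans (hc j 0)
  have hd0 : ∀ j k, 0 ≤ d j k := fun j k => (norm_nonneg _).trans (hd j k 0)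
  have hs1 : 0 ≤ ∑ j, c j := Finset.sum_nonneg fun j _ => hc0 j
  have hs2 : 0 ≤ ∑ j, ∑ k, d j k :=
    Finset.sum_nonneg fun j _ => Finset.sum_nonneg fun k _ => hd0 j k
  refine ⟨∑ j, c j + ∑ j, ∑ k, d j k, add_nonneg hs1 hs2, fun j x => ?_, fun j k x => ?_⟩
  · have := Finset.single_le_sum (f := c) (fun j _ => hc0 j) (Finset.mem_univ j)
    exact (hc j x).trans (by linarith)
  · have a1 := Finset.single_le_sum (f := d j) (fun k _ => hd0 j k) (Finset.mem_univ k)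
    have a2 := Finset.single_le_sum (f := fun j => ∑ k, d j k)
      (fun j _ => Finset.sum_nonneg fun k _ => hd0 j k) (Finset.mem_univ j)
    exact (hd j k x).trans (by linarith)

/-- Here D depends on the radius without control. This is harmless, because the approximation error
is chosen after the radius. -/
theorem exists_h1n_ytest_le {R : ℝ} (hR : 0 < R) : ∃ D : ℝ, 0 ≤ D ∧
    ∀ v : 𝓢(R3, ℂ), h1n (ytest hR v) ≤ D * h2n v := by
  obtain ⟨M, hM, hy, hdy⟩ := exists_yfun_bound hR
  refine ⟨4 * M, by positivity, fun v => ?_⟩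
  have hcy : ∀ j, Continuous (yfun R j) := fun j => (contDiff_yfun R j).continuous
  have b0 : l2norm (ytest hR v) ≤ ∑ j, M * l2norm (pd j v) := by
    have e : (ytest hR v : R3 → ℂ) = fun x => ∑ j, (yfun R j x : ℂ) * pd j v x := by
      ext x; exact ytest_apply hR v x
    rw [e]
    refine (l2norm_sum_le _ fun j _ => memLp_ofReal_mul (hcy j) (hy j) ((pd j v).memLp 2)).trans ?_
    exact Finset.sum_le_sum fun j _ => l2norm_ofReal_mul_le hM (hy j) ((pd j v).memLp 2)
  have b1 : ∀ k, l2norm (weakPartial k (ytest hR v))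
      ≤ ∑ j, (M * l2norm (pd j v) + M * l2norm (pd j (pd k v))) := by
    intro k
    have e : l2norm (weakPartial k (ytest hR v))
        = l2norm fun x => ∑ j, ((fderiv ℝ (yfun R j) x (e3 k) : ℂ) * pd j v x
          + (yfun R j x : ℂ) * pd j (pd k v) x) := by
      refine l2norm_congr_norm ((weakPartial_schwartz (ytest hR v) k).mono fun x hx => ?_)
      rw [hx, pd_ytest]
    rw [e]
    have m1 : ∀ j, MemLp (fun x => (fderiv ℝ (yfun R j) x (e3 k) : ℂ) * pd j v x) 2 := fun j =>
      memLp_ofReal_mul (continuous_fderiv_yfun R j k) (hdy j k) ((pd j v).memLp 2)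
    have m2 : ∀ j, MemLp (fun x => (yfun R j x : ℂ) * pd j (pd k v) x) 2 := fun j =>
      memLp_ofReal_mul (hcy j) (hy j) ((pd j (pd k v)).memLp 2)
    refine (l2norm_sum_le _ fun j _ => (m1 j).add (m2 j)).trans
      (Finset.sum_le_sum fun j _ => (l2norm_add_le (m1 j) (m2 j)).trans (add_le_add ?_ ?_))
    · exact l2norm_ofReal_mul_le hM (hdy j k) ((pd j v).memLp 2)
    · exact l2norm_ofReal_mul_le hM (hy j) ((pd j (pd k v)).memLp 2)
  have b2 := Finset.sum_le_sum fun (k : Fin 3) (_ : k ∈ Finset.univ) => b1 k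
  have s2 : 0 ≤ ∑ k : Fin 3, ∑ j : Fin 3, l2norm (pd j (pd k v)) :=
    Finset.sum_nonneg fun _ _ => Finset.sum_nonneg fun _ _ => l2norm_nonneg _
  simp only [Finset.sum_add_distrib, ← Finset.mul_sum, Finset.sum_const, Finset.card_univ,
    Fintype.card_fin, nsmul_eq_mul] at b0 b2
  push_cast at b2
  unfold h1n gradNorm h2n
  nlinarith [mul_nonneg hM s2]

theorem h1n_le_add_sub {u v : R3 → ℂ} (hu : MemH1 u) (hv : MemH1 v) :
    h1n v ≤ h1n u + h1n fun x => u x - v x := by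
  have a0 := l2norm_le_add_sub hv.1 hu.1
  have a1 : ∀ i : Fin 3, l2norm (weakPartial i v)
      ≤ l2norm (weakPartial i u) + l2norm (weakPartial i fun x => u x - v x) := by
    intro i
    refine (l2norm_le_add_sub (weakPartial_spec hv i).1 (weakPartial_spec hu i).1).trans
      (add_le_add le_rfl (le_of_eq (l2norm_congr_norm ?_)))
    filter_upwards [weakPartial_sub hu hv i] with x hx
    rw [hx, norm_sub_rev]
  have a2 := Finset.sum_le_sum fun (i : Fin 3) (_ : i ∈ Finset.univ) => a1 i
  have a3 : l2norm (fun x => v x - u x) = l2norm fun x => u x - v x :=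
    l2norm_congr_norm (ae_of_all _ fun x => norm_sub_rev _ _)
  rw [Finset.sum_add_distrib] at a2
  unfold h1n gradNorm
  linarith

/-- A solution is approximated in `H¹` by Schwartz functions `v n` for which the equation tested
with the dilation field of radius `n + 1` holds up to a vanishing error. -/
theorem IsSolution.exists_approx {l₁ l₂ l₃ β : ℝ} {u : R3 → ℂ} (h : IsSolution l₁ l₂ l₃ u β) :
    ∃ v : ℕ → 𝓢(R3, ℂ), Tendsto (fun n => h1n fun x => u x - v n x) atTop (𝓝 0) ∧
      Tendsto (fun n => (weakForm l₁ l₂ l₃ β (v n)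
        (ytest (Nat.cast_add_one_pos (α := ℝ) n) (v n))).re) atTop (𝓝 0) := by
  have hu := h.1
  obtain ⟨K, hK, hlip⟩ := exists_weakForm_sub_le l₁ l₂ l₃ β
  obtain ⟨B, hB, happ⟩ := exists_schwartz_near_h2 hu h.memLp_weight
  choose D hD hDb using fun n : ℕ => exists_h1n_ytest_le (Nat.cast_add_one_pos (α := ℝ) n)
  have hu0 := h1n_nonneg u
  set H := 2 + 2 * h1n u with hH
  -- In the Lipschitz bound the approximation error is multiplied by at most K H³ D n B. Dividing
  -- the allowed error by P n makes the tested equation hold up to 1/(n + 1).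
  let P : ℕ → ℝ := fun n => 1 + K * H ^ 3 * (D n * B)
  have hP : ∀ n, 1 ≤ P n := fun n => by
    have := hD n
    have : 0 ≤ K * H ^ 3 * (D n * B) := by positivity
    simp only [P]; linarith
  have hδ : ∀ n : ℕ, 0 < 1 / ((n + 1 : ℝ) * P n) := fun n => by
    have := hP n
    positivity
  have hδ1 : ∀ n : ℕ, 1 / ((n + 1 : ℝ) * P n) ≤ 1 / (n + 1 : ℝ) := fun n => by
    refine one_div_le_one_div_of_le (by positivity) ?_
    have hn : (0 : ℝ) ≤ n := n.cast_nonneg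
    nlinarith [hP n]
  have hδ2 : ∀ n : ℕ, 1 / (n + 1 : ℝ) ≤ 1 := fun n => by
    rw [div_le_one (by positivity)]
    have hn : (0 : ℝ) ≤ n := n.cast_nonneg
    linarith
  choose v hv1 hv2 using fun n => happ _ (hδ n) ((hδ1 n).trans (hδ2 n))
  refine ⟨v, ?_, ?_⟩
  · exact squeeze_zero (fun n => h1n_nonneg _) (fun n => (hv1 n).le.trans (hδ1 n))
      tendsto_one_div_add_atTop_nhds_zero_nat
  · refine squeeze_zero_norm (fun n => ?_) tendsto_one_div_add_atTop_nhds_zero_nat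
    set φ := ytest (Nat.cast_add_one_pos (α := ℝ) n) (v n)
    have hφ := memH1_schwartz φ
    have hvn := memH1_schwartz (v n)
    have e1 := hlip u (v n) φ hu hvn hφ
    rw [h.weakForm_eq_zero hφ, zero_sub, norm_neg] at e1
    have e2 : h1n (v n) ≤ h1n u + 1 :=
      (h1n_le_add_sub hu hvn).trans (by linarith [(hv1 n).le.trans ((hδ1 n).trans (hδ2 n))])
    have e3 : h1n φ ≤ D n * B := (hDb n (v n)).trans (mul_le_mul_of_nonneg_left (hv2 n) (hD n))
    have e4 : (1 + h1n u + h1n (v n)) ^ 3 ≤ H ^ 3 :=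
      pow_le_pow_left₀ (by linarith [h1n_nonneg (v n)]) (by rw [hH]; linarith) 3
    refine (Complex.abs_re_le_norm _).trans (e1.trans ?_)
    have hDn := hD n
    have hPn := hP n
    calc K * (h1n (fun x => u x - v n x) * (1 + h1n u + h1n (v n)) ^ 3 * h1n φ)
        ≤ K * (1 / ((n + 1 : ℝ) * P n) * H ^ 3 * (D n * B)) := by
          refine mul_le_mul_of_nonneg_left ?_ hK
          refine mul_le_mul (mul_le_mul (hv1 n).le e4 ?_ (hδ n).le) e3 (h1n_nonneg _) ?_
          · exact pow_nonneg (by linarith [h1n_nonneg (v n)]) 3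
          · exact mul_nonneg (hδ n).le (by positivity)
      _ = 1 / ((n + 1 : ℝ) * P n) * (P n - 1) := by simp only [P]; ring
      _ ≤ 1 / ((n + 1 : ℝ) * P n) * P n :=
          mul_le_mul_of_nonneg_left (by linarith) (hδ n).le
      _ = 1 / (n + 1 : ℝ) := by field_simp

/-! ### Passing to the limit in the weighted integrals -/

section limits

variable {b : ℕ → R3 → ℝ} {C c : ℝ}

/-- The weights converge only pointwise but stay bounded: boundedness handles the L¹ error F n - f,
and dominated convergence handles the weights against the fixed f. -/
theorem tendsto_integral_weight (hb : ∀ n, Continuous (b n)) (hC : ∀ n x, |b n x| ≤ C)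
    (hlim : ∀ x, Tendsto (fun n => b n x) atTop (𝓝 c)) {f : R3 → ℝ} {F : ℕ → R3 → ℝ}
    (hf : Integrable f) (hF : ∀ n, Integrable (F n))
    (h : Tendsto (fun n => ∫ x, |F n x - f x|) atTop (𝓝 0)) :
    Tendsto (fun n => ∫ x, b n x * F n x) atTop (𝓝 (c * ∫ x, f x)) := by
  have h1 : Tendsto (fun n => ∫ x, b n x * f x) atTop (𝓝 (c * ∫ x, f x)) := by
    rw [← integral_const_mul]
    refine tendsto_integral_of_dominated_convergence (fun x => C * ‖f x‖) (fun n => ?_)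
      (hf.norm.const_mul C) (fun n => ae_of_all _ fun x => ?_)
      (ae_of_all _ fun x => (hlim x).mul_const _)
    · exact (hb n).aestronglyMeasurable.mul hf.1
    · rw [norm_mul]
      exact mul_le_mul_of_nonneg_right (hC n x) (norm_nonneg _)
  have hi : ∀ n (g : R3 → ℝ), Integrable g → Integrable fun x => b n x * g x := fun n g hg =>
    hg.bdd_mul (c := C) (hb n).aestronglyMeasurable (ae_of_all _ fun x => hC n x)
  have h2 : Tendsto (fun n => ∫ x, b n x * (F n x - f x)) atTop (𝓝 0) := by
    have h3 := h.const_mul C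
    rw [mul_zero] at h3
    refine squeeze_zero_norm (fun n => ?_) h3
    rw [← integral_const_mul]
    refine norm_integral_le_of_norm_le (((hF n).sub hf).norm.const_mul C) (ae_of_all _ fun x => ?_)
    rw [norm_mul]
    exact mul_le_mul_of_nonneg_right (hC n x) (norm_nonneg _)
  have h3 := h2.add h1
  rw [zero_add] at h3
  refine h3.congr fun n => ?_
  rw [← integral_add (hi n (fun x => F n x - f x) ((hF n).sub hf)) (hi n f hf)]
  congr 1; ext x; ring

theorem l2norm_tendsto_of_sub {p : R3 → ℂ} {P : ℕ → R3 → ℂ} (hp : MemLp p 2)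
    (hP : ∀ n, MemLp (P n) 2) (h : Tendsto (fun n => l2norm fun x => P n x - p x) atTop (𝓝 0)) :
    Tendsto (fun n => l2norm (P n)) atTop (𝓝 (l2norm p)) := by
  rw [tendsto_iff_dist_tendsto_zero]
  refine squeeze_zero (fun _ => dist_nonneg) (fun n => ?_) h
  rw [Real.dist_eq, abs_le]
  have h1 := l2norm_le_add_sub (hP n) hp
  have h2 := l2norm_le_add_sub hp (hP n)
  have h3 : l2norm (fun x => p x - P n x) = l2norm fun x => P n x - p x :=
    l2norm_congr_norm (ae_of_all _ fun x => norm_sub_rev _ _)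
  constructor <;> linarith

theorem tendsto_integral_weight_mul_star (hb : ∀ n, Continuous (b n)) (hC : ∀ n x, |b n x| ≤ C)
    (hlim : ∀ x, Tendsto (fun n => b n x) atTop (𝓝 c)) {p q : R3 → ℂ} {P Q : ℕ → R3 → ℂ}
    (hp : MemLp p 2) (hq : MemLp q 2) (hP : ∀ n, MemLp (P n) 2) (hQ : ∀ n, MemLp (Q n) 2)
    (h : Tendsto (fun n => l2norm fun x => P n x - p x) atTop (𝓝 0))
    (h' : Tendsto (fun n => l2norm fun x => Q n x - q x) atTop (𝓝 0)) :
    Tendsto (fun n => ∫ x, b n x * (P n x * star (Q n x)).re) atTop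
      (𝓝 (c * ∫ x, (p x * star (q x)).re)) := by
  refine tendsto_integral_weight hb hC hlim (integrable_mul_star hp hq).re
    (fun n => (integrable_mul_star (hP n) (hQ n)).re) ?_
  have h3 := (h.mul (l2norm_tendsto_of_sub hq hQ h')).add (h'.const_mul (l2norm p))
  rw [zero_mul, mul_zero, add_zero] at h3
  refine squeeze_zero (fun n => integral_nonneg fun _ => abs_nonneg _) (fun n => ?_) h3
  have i1 := integrable_norm_mul_norm ((hP n).sub hp) (hQ n)
  have i2 := integrable_norm_mul_norm hp ((hQ n).sub hq)
  have g1 := integral_norm_mul_norm_le ((hP n).sub hp) (hQ n)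
  have g2 := integral_norm_mul_norm_le hp ((hQ n).sub hq)
  refine le_trans ?_ (add_le_add g1 g2)
  rw [← integral_add i1 i2]
  refine integral_mono_of_nonneg (ae_of_all _ fun _ => abs_nonneg _) (i1.fun_add i2)
    (ae_of_all _ fun x => ?_)
  simp only [Pi.sub_apply]
  have e : P n x * star (Q n x) - p x * star (q x)
      = (P n x - p x) * star (Q n x) + p x * star (Q n x - q x) := by
    rw [star_sub]; ring
  calc |(P n x * star (Q n x)).re - (p x * star (q x)).re|
      = |(P n x * star (Q n x) - p x * star (q x)).re| := by rw [Complex.sub_re]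
    _ ≤ ‖(P n x - p x) * star (Q n x) + p x * star (Q n x - q x)‖ := by
        rw [e]; exact Complex.abs_re_le_norm _
    _ ≤ _ := by
        refine (norm_add_le _ _).trans (le_of_eq ?_)
        rw [norm_mul, norm_mul, norm_star, norm_star]

theorem tendsto_bform {l₁ l₂ : ℝ} {p q : R3 → ℂ} {P Q : ℕ → R3 → ℂ}
    (hp : MemLp p 2) (hq : MemLp q 2) (hP : ∀ n, MemLp (P n) 2) (hQ : ∀ n, MemLp (Q n) 2)
    (h : Tendsto (fun n => l2norm fun x => P n x - p x) atTop (𝓝 0))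
    (h' : Tendsto (fun n => l2norm fun x => Q n x - q x) atTop (𝓝 0)) :
    Tendsto (fun n => bform (symbolA l₁ l₂) (P n) (Q n)) atTop
      (𝓝 (bform (symbolA l₁ l₂) p q)) := by
  rw [tendsto_iff_norm_sub_tendsto_zero]
  have h3 := ((h.mul (l2norm_tendsto_of_sub hq hQ h')).add
    (h'.const_mul (l2norm p))).const_mul (boundA l₁ l₂)
  rw [zero_mul, mul_zero, add_zero, mul_zero] at h3
  refine squeeze_zero (fun n => norm_nonneg _) (fun n => ?_) h3
  have e : bform (symbolA l₁ l₂) (P n) (Q n) - bform (symbolA l₁ l₂) p q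
      = bform (symbolA l₁ l₂) (fun x => P n x - p x) (Q n)
        + bform (symbolA l₁ l₂) p (fun x => Q n x - q x) := by
    rw [bform_sub_left (hP n) hp (hQ n), bform_sub_right hp (hQ n) hq]; ring
  rw [e, mul_add]
  exact (norm_add_le _ _).trans (add_le_add (norm_bform_le ((hP n).sub hp) (hQ n))
    (norm_bform_le hp ((hQ n).sub hq)))

theorem tendsto_l2norm_weight_mul_sub (hb : ∀ n, Continuous (b n)) (hC0 : 0 ≤ C)
    (hC : ∀ n x, |b n x| ≤ C)
    (hlim : ∀ x, Tendsto (fun n => b n x) atTop (𝓝 c)) {p : R3 → ℂ} {P : ℕ → R3 → ℂ}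
    (hp : MemLp p 2) (hP : ∀ n, MemLp (P n) 2)
    (h : Tendsto (fun n => l2norm fun x => P n x - p x) atTop (𝓝 0)) :
    Tendsto (fun n => l2norm fun x => (b n x : ℂ) * P n x - (c : ℂ) * p x) atTop (𝓝 0) := by
  have hbc : ∀ n x, |b n x - c| ≤ C + |c| := fun n x =>
    (abs_sub _ _).trans (add_le_add (hC n x) le_rfl)
  have h1 : Tendsto (fun n => l2norm fun x => ((b n x - c : ℝ) : ℂ) * p x) atTop (𝓝 0) := by
    have h2 : Tendsto (fun n => ∫ x, ‖((b n x - c : ℝ) : ℂ) * p x‖ ^ 2) atTop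
        (𝓝 (∫ _ : R3, (0 : ℝ))) := by
      refine tendsto_integral_of_dominated_convergence (fun x => (C + |c|) ^ 2 * ‖p x‖ ^ 2)
        (fun n => ?_) ((integrable_norm_sq hp).const_mul _) (fun n => ae_of_all _ fun x => ?_)
        (ae_of_all _ fun x => ?_)
      · exact ((Complex.continuous_ofReal.comp
          ((hb n).sub continuous_const)).aestronglyMeasurable.mul hp.1).norm.pow 2
      · rw [Real.norm_of_nonneg (by positivity), norm_mul, mul_pow, Complex.norm_real]
        gcongr
        exact hbc n x
      · have h3 := (hlim x).sub_const c
        rw [sub_self] at h3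
        have h4 := (((Complex.continuous_ofReal.tendsto _).comp h3).mul_const (p x)).norm.pow 2
        simpa [Function.comp_def] using h4
    have h5 := (Real.continuous_sqrt.tendsto _).comp h2
    simpa [l2norm, Function.comp_def] using h5
  have h3 := (h.const_mul C).add h1
  rw [mul_zero, add_zero] at h3
  refine squeeze_zero (fun n => l2norm_nonneg _) (fun n => ?_) h3
  have e : (fun x => (b n x : ℂ) * P n x - (c : ℂ) * p x)
      = fun x => (b n x : ℂ) * (P n x - p x) + ((b n x - c : ℝ) : ℂ) * p x := by
    ext x; push_cast; ring
  rw [e]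
  refine (l2norm_add_le (memLp_ofReal_mul (hb n) (hC n) ((hP n).sub hp))
    (memLp_ofReal_mul ((hb n).sub continuous_const) (hbc n) hp)).trans (add_le_add ?_ le_rfl)
  exact l2norm_ofReal_mul_le hC0 (hC n) ((hP n).sub hp)

end limits

end DipolarGPE

end

noncomputable section

namespace DipolarGPE

open FourierTransform SchwartzMap LineDeriv

/-! ### The Pohozaev identity -/

theorem integrable_norm_pow_five {u : R3 → ℂ} (hu : MemH1 u) : Integrable fun x => ‖u x‖ ^ 5 := by
  refine (integrable_norm_mul_norm hu.memLp_normSq (memLp_norm_pow_three hu.memLp_six)).congr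
    (ae_of_all _ fun x => ?_)
  simp only [norm_pow, norm_norm]; ring

theorem abs_pow_five_sub_le (a b : ℂ) : |‖a‖ ^ 5 - ‖b‖ ^ 5|
    ≤ 2 * (‖a - b‖ * ‖a‖ + ‖a - b‖ * ‖b‖) * (‖a‖ ^ 3 + ‖b‖ ^ 3) := by
  have ha := norm_nonneg a
  have hb := norm_nonneg b
  rw [show ‖a‖ ^ 5 - ‖b‖ ^ 5 = (‖a‖ - ‖b‖) * (‖a‖ ^ 4 + ‖a‖ ^ 3 * ‖b‖ + ‖a‖ ^ 2 * ‖b‖ ^ 2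
    + ‖a‖ * ‖b‖ ^ 3 + ‖b‖ ^ 4) by ring, abs_mul, abs_of_nonneg
    (by positivity : 0 ≤ ‖a‖ ^ 4 + ‖a‖ ^ 3 * ‖b‖ + ‖a‖ ^ 2 * ‖b‖ ^ 2 + ‖a‖ * ‖b‖ ^ 3 + ‖b‖ ^ 4)]
  have h1 : ‖a‖ ^ 4 + ‖a‖ ^ 3 * ‖b‖ + ‖a‖ ^ 2 * ‖b‖ ^ 2 + ‖a‖ * ‖b‖ ^ 3 + ‖b‖ ^ 4
      ≤ 2 * (‖a‖ + ‖b‖) * (‖a‖ ^ 3 + ‖b‖ ^ 3) := by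
    have p1 : 0 ≤ ‖a‖ ^ 3 * ‖b‖ := by positivity
    have p2 : 0 ≤ ‖a‖ * ‖b‖ ^ 3 := by positivity
    nlinarith [sq_nonneg (‖a‖ ^ 2 - ‖b‖ ^ 2), sq_nonneg (‖a‖ ^ 2 + ‖b‖ ^ 2)]
  refine (mul_le_mul (abs_norm_sub_norm_le a b) h1 (by positivity) (norm_nonneg _)).trans_eq ?_
  ring

theorem integral_abs_pow_five_sub_le {u v : R3 → ℂ} (hu : MemH1 u) (hv : MemH1 v) :
    ∫ x, |‖u x‖ ^ 5 - ‖v x‖ ^ 5|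
      ≤ 2 * ((l2norm (fun x => ‖u x - v x‖ * ‖u x‖) + l2norm (fun x => ‖u x - v x‖ * ‖v x‖))
        * (l2norm (fun x => ‖u x‖ ^ 3) + l2norm (fun x => ‖v x‖ ^ 3))) := by
  have hd := hu.sub hv
  have m1 := memLp_norm_mul_norm hd.1 hd.memLp_six hu.1 hu.memLp_six
  have m2 := memLp_norm_mul_norm hd.1 hd.memLp_six hv.1 hv.memLp_six
  have m3 := memLp_norm_pow_three hu.memLp_six
  have m4 := memLp_norm_pow_three hv.memLp_six
  have h1 : ∫ x, |‖u x‖ ^ 5 - ‖v x‖ ^ 5|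
      ≤ ∫ x, 2 * (‖‖u x - v x‖ * ‖u x‖ + ‖u x - v x‖ * ‖v x‖‖ * ‖‖u x‖ ^ 3 + ‖v x‖ ^ 3‖) := by
    refine integral_mono_of_nonneg (ae_of_all _ fun _ => abs_nonneg _)
      ((integrable_norm_mul_norm (m1.add m2) (m3.add m4)).const_mul 2) (ae_of_all _ fun x => ?_)
    refine (abs_pow_five_sub_le _ _).trans_eq ?_
    simp only
    rw [Real.norm_of_nonneg (by positivity), Real.norm_of_nonneg (by positivity)]
    ring
  refine h1.trans ?_
  rw [integral_const_mul]
  refine mul_le_mul_of_nonneg_left ?_ zero_le_two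
  refine (integral_norm_mul_norm_le (m1.add m2) (m3.add m4)).trans ?_
  exact mul_le_mul (l2norm_add_le m1 m2) (l2norm_add_le m3 m4) (l2norm_nonneg _)
    (add_nonneg (l2norm_nonneg _) (l2norm_nonneg _))

theorem tendsto_natCast_add_one : Tendsto (fun n : ℕ => (n + 1 : ℝ)) atTop atTop :=
  tendsto_natCast_atTop_atTop.atTop_add tendsto_const_nhds

theorem tendsto_ydiv (x : R3) : Tendsto (fun n : ℕ => ydiv (n + 1) x) atTop (𝓝 3) := by
  have h := tendsto_finsetSum (Finset.univ : Finset (Fin 3)) fun j _ =>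
    (tendsto_fderiv_yfun j j x).comp tendsto_natCast_add_one
  have e : ∑ j : Fin 3, (if j = j then (1 : ℝ) else 0) = 3 := by simp
  rw [e] at h
  exact h

theorem abs_ydiv_le {C : ℝ} (hC : ∀ R : ℝ, 1 ≤ R → ∀ (j k : Fin 3) (x : R3),
    |fderiv ℝ (yfun R j) x (e3 k)| ≤ C) {R : ℝ} (hR : 1 ≤ R) (x : R3) : |ydiv R x| ≤ 3 * C := by
  refine (Finset.abs_sum_le_sum_abs _ _).trans
    ((Finset.sum_le_sum fun j _ => hC R hR j j x).trans_eq ?_)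
  simp

theorem bform_const_mul_right {l₁ l₂ : ℝ} (c : ℝ) {f g : R3 → ℂ} (hg : MemLp g 2) :
    bform (symbolA l₁ l₂) f (fun x => (c : ℂ) * g x) = (c : ℂ) * bform (symbolA l₁ l₂) f g := by
  have h1 : ft2 (fun x => (c : ℂ) * g x) =ᵐ[volume] fun ξ => (c : ℂ) * ft2 g ξ := by
    refine ft2_ae_eq (hg.const_mul _)
      (((memLp_ft2 hg).const_mul _).locallyIntegrable (by norm_num)) fun s _ => ?_
    simp_rw [mul_left_comm _ (c : ℂ)]
    rw [integral_const_mul, integral_const_mul, integral_mul_ft2 hg]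
  rw [bform, bform, ← integral_const_mul]
  refine integral_congr_ae ?_
  filter_upwards [h1] with ξ h
  rw [h, star_mul', Complex.star_def, Complex.conj_ofReal]
  ring

/-- The commutator terms vanish along sequences converging in `L²`. -/
theorem tendsto_re_bform_vfield_seq (l₁ l₂ : ℝ) {p : R3 → ℂ} (hp : MemLp p 2)
    {P : ℕ → 𝓢(R3, ℂ)} (h : Tendsto (fun n => l2norm fun x => P n x - p x) atTop (𝓝 0)) :
    Tendsto (fun n => (bform (symbolA l₁ l₂) (P n)
      (vfield (yfield (Nat.cast_add_one_pos (α := ℝ) n)) (P n))).re) atTop (𝓝 0) := by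
  set W := |l₂| * ∫ ζ, commWeight (yfield one_pos) ζ with hW
  have hPm : ∀ n, MemLp (P n) 2 := fun n => (P n).memLp 2
  have hn := l2norm_tendsto_of_sub hp hPm h
  rw [Metric.tendsto_atTop]
  intro ε hε
  have hK : 0 < |W| * (2 * (l2norm p + 1)) + 1 := by
    have := l2norm_nonneg p
    positivity
  set δ := ε / 4 / (|W| * (2 * (l2norm p + 1)) + 1) with hδ
  have hδ0 : 0 < δ := by positivity
  have hev := (h.eventually (gt_mem_nhds hδ0)).and
    (hn.eventually (gt_mem_nhds (lt_add_one (l2norm p))))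
  obtain ⟨m, hm⟩ := eventually_atTop.mp hev
  -- The function P m is frozen here. For later n the field of radius n + 1 is tested on P m, and
  -- the uniform commutator bound transfers the smallness to P n.
  obtain ⟨R₀, hR₀⟩ := tendsto_re_bform_vfield l₁ l₂ (P m) (half_pos hε)
  obtain ⟨k, hk⟩ := exists_nat_ge R₀
  refine ⟨max m k, fun n hn' => ?_⟩
  have hnm := hm n ((le_max_left _ _).trans hn')
  have hmm := hm m le_rfl
  have hkn : (k : ℝ) ≤ n := by exact_mod_cast (le_max_right _ _).trans hn'
  have hpos := Nat.cast_add_one_pos (α := ℝ) n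
  have e1 := hR₀ (n + 1) (by linarith) hpos
  have e2 := abs_re_bform_vfield_sub_le l₁ l₂ (star_yfield hpos) (P n) (P m)
  -- Scale invariance makes the constant the same for every radius.
  rw [integral_commWeight_yfield, ← hW] at e2
  have e3 : l2norm (fun x => P n x - P m x) ≤ 2 * δ := by
    have := l2norm_sub_le (f := fun x => P n x - p x) (g := fun x => P m x - p x)
      ((hPm n).sub hp) ((hPm m).sub hp)
    simp only [sub_sub_sub_cancel_right] at this
    refine this.trans ?_
    linarith [hnm.1.le, hmm.1.le]
  have e4 : W * (l2norm (fun x => P n x - P m x) * (l2norm (P n) + l2norm (P m)))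
      ≤ |W| * (2 * δ * (2 * (l2norm p + 1))) := by
    have hs : l2norm (P n) + l2norm (P m) ≤ 2 * (l2norm p + 1) := by
      linarith [hnm.2.le, hmm.2.le]
    have hs0 := add_nonneg (l2norm_nonneg (P n)) (l2norm_nonneg (P m))
    exact mul_le_mul (le_abs_self W) (mul_le_mul e3 hs hs0 (by positivity))
      (mul_nonneg (l2norm_nonneg _) hs0) (abs_nonneg _)
  have e5 : |W| * (2 * δ * (2 * (l2norm p + 1))) < ε / 2 := by
    have : δ * (|W| * (2 * (l2norm p + 1)) + 1) = ε / 4 := by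
      rw [hδ, div_mul_cancel₀ _ hK.ne']
    nlinarith
  rw [Real.dist_eq, sub_zero]
  have e6 := abs_sub_abs_le_abs_sub (bform (symbolA l₁ l₂) (P n) (vfield (yfield hpos) (P n))).re
    (bform (symbolA l₁ l₂) (P m) (vfield (yfield hpos) (P m))).re
  linarith

/-! ### Limits of the tested terms -/

section limit

variable {u : R3 → ℂ} {v : ℕ → 𝓢(R3, ℂ)}

theorem tendsto_l2norm_sub_of_h1n (h : Tendsto (fun n => h1n fun x => u x - v n x) atTop (𝓝 0)) :
    Tendsto (fun n => l2norm fun x => v n x - u x) atTop (𝓝 0) := by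
  refine squeeze_zero (fun n => l2norm_nonneg _) (fun n => ?_) h
  refine le_trans (le_of_eq ?_) (l2norm_le_h1n _)
  exact l2norm_congr_norm (ae_of_all _ fun x => norm_sub_rev _ _)

theorem tendsto_l2norm_pd_sub_of_h1n (hu : MemH1 u)
    (h : Tendsto (fun n => h1n fun x => u x - v n x) atTop (𝓝 0)) (k : Fin 3) :
    Tendsto (fun n => l2norm fun x => pd k (v n) x - weakPartial k u x) atTop (𝓝 0) := by
  refine squeeze_zero (fun n => l2norm_nonneg _) (fun n => ?_) h
  rw [h1n_sub_schwartz hu]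
  exact (Finset.single_le_sum (f := fun i => l2norm fun x => pd i (v n) x - weakPartial i u x)
    (fun _ _ => l2norm_nonneg _) (Finset.mem_univ k)).trans
    (le_add_of_nonneg_left (l2norm_nonneg _))

theorem tendsto_l2norm_dens_sub (hu : MemH1 u)
    (h : Tendsto (fun n => h1n fun x => u x - v n x) atTop (𝓝 0)) :
    Tendsto (fun n => l2norm fun x => dens (v n) x - dens u x) atTop (𝓝 0) := by
  obtain ⟨S, hS, -, -, s11⟩ := exists_h1_bounds
  have h1 : Tendsto (fun n => S * (h1n (fun x => u x - v n x)
      * (h1n u + (h1n u + h1n fun x => u x - v n x)))) atTop (𝓝 0) := by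
    simpa using (h.mul ((h.const_add (h1n u)).const_add (h1n u))).const_mul S
  refine squeeze_zero (fun n => l2norm_nonneg _) (fun n => ?_) h1
  have hv := memH1_schwartz (v n)
  have e : l2norm (fun x => dens (v n) x - dens u x) = l2norm fun x => dens u x - dens (v n) x :=
    l2norm_congr_norm (ae_of_all _ fun x => norm_sub_rev _ _)
  rw [e]
  refine (l2norm_dens_sub_le hu hv).trans ((add_le_add (s11 _ _ (hu.sub hv) hu)
    (s11 _ _ (hu.sub hv) hv)).trans ?_)
  rw [← mul_add, ← mul_add]
  refine mul_le_mul_of_nonneg_left (mul_le_mul_of_nonneg_left (add_le_add le_rfl ?_)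
    (h1n_nonneg _)) hS
  exact h1n_le_add_sub hu hv

theorem tendsto_integral_abs_pow_five_sub (hu : MemH1 u)
    (h : Tendsto (fun n => h1n fun x => u x - v n x) atTop (𝓝 0)) :
    Tendsto (fun n => ∫ x, |‖v n x‖ ^ 5 - ‖u x‖ ^ 5|) atTop (𝓝 0) := by
  obtain ⟨S, hS, -, s3, s11⟩ := exists_h1_bounds
  have h1 : Tendsto (fun n => 2 * (S * (h1n (fun x => u x - v n x)
      * (h1n u + (h1n u + h1n fun x => u x - v n x)))
      * (S * h1n u ^ 3 + S * (h1n u + h1n fun x => u x - v n x) ^ 3))) atTop (𝓝 0) := by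
    simpa using (((h.mul ((h.const_add (h1n u)).const_add (h1n u))).const_mul S).mul
      ((((h.const_add (h1n u)).pow 3).const_mul S).const_add (S * h1n u ^ 3))).const_mul 2
  refine squeeze_zero (fun n => integral_nonneg fun _ => abs_nonneg _) (fun n => ?_) h1
  have hv := memH1_schwartz (v n)
  have hle := h1n_le_add_sub hu hv
  have hu0 := h1n_nonneg u
  have hv0 := h1n_nonneg (v n)
  have hd0 := h1n_nonneg fun x => u x - v n x
  simp_rw [abs_sub_comm (‖v n _‖ ^ 5)]
  refine (integral_abs_pow_five_sub_le hu hv).trans (mul_le_mul_of_nonneg_left ?_ zero_le_two)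
  refine mul_le_mul ((add_le_add (s11 _ _ (hu.sub hv) hu) (s11 _ _ (hu.sub hv) hv)).trans ?_)
    (add_le_add (s3 u hu) ((s3 _ hv).trans ?_)) (add_nonneg (l2norm_nonneg _) (l2norm_nonneg _))
    (by positivity)
  · rw [← mul_add, ← mul_add]
    exact mul_le_mul_of_nonneg_left (mul_le_mul_of_nonneg_left (add_le_add le_rfl hle) hd0) hS
  · exact mul_le_mul_of_nonneg_left (pow_le_pow_left₀ hv0 hle 3) hS

theorem re_mul_star_self (z : ℂ) : (z * star z).re = ‖z‖ ^ 2 := by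
  rw [mul_star_eq, Complex.ofReal_re]

/-- In the limit the derivative of the field is the identity matrix and its divergence is 3, giving
A - (3/2) A. -/
theorem tendsto_re_gradForm_ytest (hu : MemH1 u)
    (h : Tendsto (fun n => h1n fun x => u x - v n x) atTop (𝓝 0)) :
    Tendsto (fun n => (gradForm (v n) (ytest (Nat.cast_add_one_pos (α := ℝ) n) (v n))).re) atTop
      (𝓝 (-(1 / 2) * funA u)) := by
  obtain ⟨C, hC0, hC⟩ := exists_fderiv_yfun_bound
  have hn1 : ∀ n : ℕ, (1 : ℝ) ≤ n + 1 := fun n => by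
    have hn : (0 : ℝ) ≤ n := n.cast_nonneg
    linarith
  have hw := fun k => (weakPartial_spec hu k).1
  have hc := tendsto_l2norm_pd_sub_of_h1n hu h
  have g1 : ∀ k j : Fin 3, Tendsto (fun n : ℕ => ∫ x, fderiv ℝ (yfun (n + 1) j) x (e3 k)
      * (pd k (v n) x * star (pd j (v n) x)).re) atTop
      (𝓝 ((if j = k then 1 else 0) * ∫ x, (weakPartial k u x * star (weakPartial j u x)).re)) := by
    intro k j
    exact tendsto_integral_weight_mul_star (fun n => continuous_fderiv_yfun (n + 1) j k)
      (fun n x => hC (n + 1) (hn1 n) j k x)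
      (fun x => (tendsto_fderiv_yfun j k x).comp tendsto_natCast_add_one) (hw k) (hw j)
      (fun n => (pd k (v n)).memLp 2) (fun n => (pd j (v n)).memLp 2) (hc k) (hc j)
  have g2 : ∀ k : Fin 3, Tendsto (fun n : ℕ => ∫ x, ydiv (n + 1) x * ‖pd k (v n) x‖ ^ 2) atTop
      (𝓝 (3 * ∫ x, ‖weakPartial k u x‖ ^ 2)) := by
    intro k
    have := tendsto_integral_weight_mul_star (fun n : ℕ => continuous_ydiv (n + 1))
      (fun n x => abs_ydiv_le hC (hn1 n) x) tendsto_ydiv (hw k) (hw k)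
      (fun n => (pd k (v n)).memLp 2) (fun n => (pd k (v n)).memLp 2) (hc k) (hc k)
    simpa only [re_mul_star_self] using this
  have g3 := (tendsto_finsetSum Finset.univ fun k _ => tendsto_finsetSum Finset.univ fun j _ =>
    g1 k j).sub ((tendsto_finsetSum Finset.univ fun k _ => g2 k).const_mul (1 / 2))
  simp_rw [re_gradForm_ytest]
  convert g3 using 2
  unfold funA
  simp only [ite_mul, one_mul, zero_mul, Finset.sum_ite_eq', Finset.mem_univ, if_true,
    re_mul_star_self, ← Finset.mul_sum]
  ring

/-- The commutator part vanishes, and the divergence part contributes -¼ · 3. -/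
theorem tendsto_re_bform_ytest (l₁ l₂ : ℝ) (hu : MemH1 u)
    (h : Tendsto (fun n => h1n fun x => u x - v n x) atTop (𝓝 0)) :
    Tendsto (fun n => (bform (symbolA l₁ l₂) (dens (v n))
      (fun x => star (v n x) * ytest (Nat.cast_add_one_pos (α := ℝ) n) (v n) x)).re) atTop
      (𝓝 (-(3 / 4) * (bform (symbolA l₁ l₂) (dens u) (dens u)).re)) := by
  obtain ⟨C, hC0, hC⟩ := exists_fderiv_yfun_bound
  have hn1 : ∀ n : ℕ, (1 : ℝ) ≤ n + 1 := fun n => by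
    have hn : (0 : ℝ) ≤ n := n.cast_nonneg
    linarith
  have hd := tendsto_l2norm_dens_sub hu h
  have hm := fun n => (memH1_schwartz (v n)).memLp_dens
  have g1 := tendsto_re_bform_vfield_seq l₁ l₂ hu.memLp_dens (P := fun n => densS (v n))
    (by simpa only [coe_densS] using hd)
  have hb := fun (n : ℕ) (x : R3) => abs_ydiv_le hC (hn1 n) x
  have g2 := tendsto_l2norm_weight_mul_sub (fun n : ℕ => continuous_ydiv (n + 1))
    (by positivity) hb tendsto_ydiv hu.memLp_dens hm hd
  have g3 := tendsto_bform (l₁ := l₁) (l₂ := l₂) hu.memLp_dens (hu.memLp_dens.const_mul ((3 : ℝ) : ℂ))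
    hm (fun n => memLp_ofReal_mul (continuous_ydiv (n + 1)) (hb n) (hm n)) hd g2
  rw [bform_const_mul_right 3 hu.memLp_dens] at g3
  have g4 := (g1.const_mul (1 / 2)).sub
    (((Complex.continuous_re.tendsto _).comp g3).const_mul (1 / 4))
  simp_rw [re_bform_ytest]
  rw [Complex.re_ofReal_mul] at g4
  have e : 1 / 2 * 0 - 1 / 4 * (3 * (bform (symbolA l₁ l₂) (dens u) (dens u)).re)
      = -(3 / 4) * (bform (symbolA l₁ l₂) (dens u) (dens u)).re := by ring
  rw [e] at g4
  exact g4

end limit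

/-- The Pohozaev identity, with the nonlocal term in terms of the `L²` Fourier transform. -/
theorem IsSolution.pohozaev {l₁ l₂ l₃ β : ℝ} {u : R3 → ℂ} (h : IsSolution l₁ l₂ l₃ u β) :
    1 / 4 * funA u + 3 / 4 * (bform (symbolA l₁ l₂) (dens u) (dens u)).re
      + 3 / 5 * funC l₃ u + 3 / 2 * β * mass u = 0 := by
  obtain ⟨v, hv, hlim⟩ := h.exists_approx
  have hu := h.1
  obtain ⟨C, hC0, hC⟩ := exists_fderiv_yfun_bound
  have hn1 : ∀ n : ℕ, (1 : ℝ) ≤ n + 1 := fun n => by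
    have hn : (0 : ℝ) ≤ n := n.cast_nonneg
    linarith
  have hb := fun (n : ℕ) (x : R3) => abs_ydiv_le hC (hn1 n) x
  have g1 := tendsto_re_gradForm_ytest hu hv
  have g2 := tendsto_re_bform_ytest l₁ l₂ hu hv
  have g3 := tendsto_integral_weight (fun n : ℕ => continuous_ydiv (n + 1)) hb tendsto_ydiv
    (integrable_norm_pow_five hu) (fun n => integrable_norm_pow_five (memH1_schwartz (v n)))
    (tendsto_integral_abs_pow_five_sub hu hv)
  have g4 : Tendsto (fun n : ℕ => ∫ x, ydiv (n + 1) x * ‖v n x‖ ^ 2) atTop (𝓝 (3 * mass u)) := by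
    have hl := tendsto_l2norm_sub_of_h1n hv
    have := tendsto_integral_weight_mul_star (fun n : ℕ => continuous_ydiv (n + 1)) hb tendsto_ydiv
      hu.1 hu.1 (fun n => (v n).memLp 2) (fun n => (v n).memLp 2) hl hl
    simpa only [re_mul_star_self, mass] using this
  -- The four limits are those of the four terms of `weakForm`. Their sum also tends to zero along
  -- the approximating sequence, and this is the negative of the identity.
  have g5 := (((g1.const_mul (1 / 2)).add g2).add ((g3.const_mul (-(1 / 5))).const_mul l₃)).add
    ((g4.const_mul (-(1 / 2))).const_mul β)
  have g6 := tendsto_nhds_unique (g5.congr fun n => ?_) hlim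
  · unfold funC
    linarith
  · rw [weakForm, Complex.add_re, Complex.add_re, Complex.add_re, Complex.re_ofReal_mul,
      Complex.re_ofReal_mul, re_integral_mul_star_ytest, re_integral_cube_mul_star_ytest,
      show (1 / 2 : ℂ) = ((1 / 2 : ℝ) : ℂ) by push_cast; ring, Complex.re_ofReal_mul]

end DipolarGPE

end

noncomputable section

namespace DipolarGPE

open FourierTransform SchwartzMap LineDeriv

/-! ### The nonlocal energy -/

theorem fourierT_eq (f : R3 → ℝ) (ξ : R3) :
    fourierT f ξ = 𝓕 (fun x => (f x : ℂ)) ((2 * Real.pi)⁻¹ • ξ) := by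
  have hpi : (2 * Real.pi) ≠ 0 := by positivity
  rw [Real.fourier_eq', fourierT]
  congr 1; ext x
  rw [smul_eq_mul, mul_comm, inner_smul_right]
  congr 2
  rw [show -2 * Real.pi * ((2 * Real.pi)⁻¹ * inner ℝ x ξ) = -(inner ℝ x ξ : ℝ) by
    field_simp]
  push_cast; ring

theorem re_bform_self (l₁ l₂ : ℝ) {u : R3 → ℂ} (hu : MemH1 u) :
    (bform (symbolA l₁ l₂) (dens u) (dens u)).re
      = ∫ ξ, symbolA l₁ l₂ ξ * ‖ft2 (dens u) ξ‖ ^ 2 := by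
  rw [bform, re_integral_eq (integrable_bform hu.memLp_dens hu.memLp_dens)]
  congr 1; ext ξ
  rw [Complex.re_ofReal_mul, re_mul_star_self]

/-- The two Fourier conventions differ by the dilation of frequencies by 2π. Its Jacobian cancels
the factor (2π)⁻³, and the degree zero symbol is unaffected. -/
theorem funB_eq (l₁ l₂ : ℝ) {u : R3 → ℂ} (hu : MemH1 u) :
    funB l₁ l₂ u = (bform (symbolA l₁ l₂) (dens u) (dens u)).re := by
  have hpi : 0 < 2 * Real.pi := by positivity
  have hi : Integrable (dens u) := (integrable_norm_sq hu.1).ofReal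
  have h1 : ∀ ξ, (l₁ + l₂ * symbolK ξ) * ‖fourierT (fun x => ‖u x‖ ^ 2) ξ‖ ^ 2
      = (fun η => symbolA l₁ l₂ η * ‖𝓕 (dens u) η‖ ^ 2) ((2 * Real.pi)⁻¹ • ξ) := by
    intro ξ
    simp only
    rw [fourierT_eq, symbolA_smul l₁ l₂ (inv_ne_zero hpi.ne'), symbolA]
    rfl
  have hfr : Module.finrank ℝ R3 = 3 := by simp
  rw [funB, re_bform_self l₁ l₂ hu]
  simp_rw [h1]
  rw [Measure.integral_comp_smul (volume : Measure R3)
    (fun η => symbolA l₁ l₂ η * ‖𝓕 (dens u) η‖ ^ 2), hfr, abs_of_pos (by positivity), smul_eq_mul,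
    inv_pow, inv_inv, ← mul_assoc, one_div, inv_mul_cancel₀ (by positivity), one_mul]
  refine integral_congr_ae ?_
  filter_upwards [ft2_ae_eq_fourier hi hu.memLp_dens] with ξ h
  rw [h]

theorem funB_le (l₁ l₂ : ℝ) {u : R3 → ℂ} (hu : MemH1 u) :
    funB l₁ l₂ u ≤ boundA l₁ l₂ * l2norm (fun x => ‖u x‖ ^ 2) ^ 2 := by
  rw [funB_eq l₁ l₂ hu]
  refine (Complex.re_le_norm _).trans ((norm_bform_le hu.memLp_dens hu.memLp_dens).trans_eq ?_)
  rw [l2norm_dens]; ring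

theorem funB_nonpos {l₁ l₂ : ℝ} (h : ∀ ξ, symbolA l₁ l₂ ξ ≤ 0) {u : R3 → ℂ} (hu : MemH1 u) :
    funB l₁ l₂ u ≤ 0 := by
  rw [funB_eq l₁ l₂ hu, re_bform_self l₁ l₂ hu]
  exact integral_nonpos fun ξ => mul_nonpos_of_nonpos_of_nonneg (h ξ) (by positivity)

/-- The symbol K̂ takes values in [-4π/3, 8π/3], and the sign of l₂ decides which endpoint is the
worst case. -/
theorem symbolA_nonpos {l₁ l₂ : ℝ} (h : (0 < l₂ ∧ l₁ + 8 * Real.pi / 3 * l₂ ≤ 0) ∨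
    (l₂ ≤ 0 ∧ l₁ - 4 * Real.pi / 3 * l₂ ≤ 0)) (ξ : R3) : symbolA l₁ l₂ ξ ≤ 0 := by
  unfold symbolA
  rcases h with ⟨h1, h2⟩ | ⟨h1, h2⟩
  · nlinarith [mul_le_mul_of_nonneg_left (symbolK_le ξ) h1.le]
  · nlinarith [mul_le_mul_of_nonpos_left (le_symbolK ξ) h1]

/-! ### The identities -/

section identities

variable {l₁ l₂ l₃ β : ℝ} {u : R3 → ℂ}

/-- The equation tested with the solution itself. -/
theorem IsSolution.energy (h : IsSolution l₁ l₂ l₃ u β) :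
    1 / 2 * funA u + funB l₁ l₂ u + funC l₃ u + β * mass u = 0 := by
  have h1 := congrArg Complex.re (h.weakForm_eq_zero h.1)
  have e1 : (fun x => star (u x) * u x) = dens u := by
    ext x; rw [mul_comm, mul_star_eq]; rfl
  have e2 : ∀ x, ((‖u x‖ ^ 3 : ℝ) : ℂ) * u x * star (u x) = ((‖u x‖ ^ 5 : ℝ) : ℂ) := by
    intro x
    rw [mul_assoc, mul_star_eq]
    push_cast; ring
  rw [weakForm, gradForm_self, e1] at h1
  simp_rw [e2, mul_star_eq] at h1
  rw [integral_complex_ofReal, integral_complex_ofReal, Complex.add_re, Complex.add_re,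
    Complex.add_re, Complex.re_ofReal_mul, Complex.re_ofReal_mul, Complex.ofReal_re,
    Complex.ofReal_re, show (1 / 2 : ℂ) = ((1 / 2 : ℝ) : ℂ) by push_cast; ring,
    Complex.re_ofReal_mul, Complex.ofReal_re, ← funB_eq l₁ l₂ h.1] at h1
  exact h1

theorem IsSolution.pohozaev_funB (h : IsSolution l₁ l₂ l₃ u β) :
    1 / 4 * funA u + 3 / 4 * funB l₁ l₂ u + 3 / 5 * funC l₃ u + 3 / 2 * β * mass u = 0 := by
  rw [funB_eq l₁ l₂ h.1]
  exact h.pohozaev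

/-- Three times the energy identity minus twice the Pohozaev identity cancels β. -/
theorem IsSolution.funQ_eq_zero (h : IsSolution l₁ l₂ l₃ u β) : funQ l₁ l₂ l₃ u = 0 := by
  have h1 := h.energy
  have h2 := h.pohozaev_funB
  unfold funQ
  linarith

/-- Eliminating C from the two identities reduces the sign of β to comparing B with A/3. -/
theorem IsSolution.mul_mass_eq (h : IsSolution l₁ l₂ l₃ u β) :
    β * mass u = funA u / 18 - funB l₁ l₂ u / 6 := by
  have h1 := h.energy
  have h2 := h.pohozaev_funB
  linarith

end identities

/-! ### Positivity of the multiplier -/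

/-- A vanishing gradient forces the L⁴ norm to vanish by Gagliardo–Nirenberg, hence the function and
its mass. -/
theorem funA_pos {u : R3 → ℂ} (hu : MemH1 u) (hm : 0 < mass u) : 0 < funA u := by
  refine lt_of_le_of_ne (funA_nonneg u) fun h0 => ?_
  have hg : gradNorm u = 0 := by
    have := sq_gradNorm_le u
    rw [← h0, mul_zero] at this
    exact pow_eq_zero_iff two_ne_zero |>.mp (le_antisymm this (sq_nonneg _))
  obtain ⟨S, -, hS⟩ := exists_sq_l2norm_sq_le
  have h1 := hS u hu
  rw [hg, zero_pow three_ne_zero, mul_zero, mul_zero] at h1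
  have h2 := le_antisymm h1 (sq_nonneg _)
  rw [sq_l2norm, integral_eq_zero_iff_of_nonneg (fun _ => by positivity)
    (integrable_norm_sq hu.memLp_normSq)] at h2
  have h3 : mass u = 0 := by
    refine integral_eq_zero_of_ae ?_
    filter_upwards [h2] with x hx
    simpa using hx
  exact hm.ne' h3

/-- The `L⁴` norm is controlled by the `L⁵` and the `L²` norm. -/
theorem sq_l2norm_sq_le_pow_five {u : R3 → ℂ} (hu : MemH1 u) {ε : ℝ} (hε : 0 < ε) :
    l2norm (fun x => ‖u x‖ ^ 2) ^ 2 ≤ ε * (∫ x, ‖u x‖ ^ 5) + (ε ^ 2)⁻¹ * mass u := by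
  have i5 := (integrable_norm_pow_five hu).const_mul ε
  have i2 := (integrable_norm_sq hu.1).const_mul (ε ^ 2)⁻¹
  rw [sq_l2norm, mass, ← integral_const_mul, ← integral_const_mul, ← integral_add i5 i2]
  refine integral_mono (integrable_norm_sq hu.memLp_normSq) (i5.fun_add i2) fun x => ?_
  simp only [norm_pow, norm_norm]
  have ha := norm_nonneg (u x)
  generalize ‖u x‖ = a at ha
  -- With b = εa the claim reduces to b³ - b² + 1 ≥ 0 for b ≥ 0.
  have e : ε * a ^ 5 + (ε ^ 2)⁻¹ * a ^ 2 - (a ^ 2) ^ 2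
      = (ε ^ 2)⁻¹ * a ^ 2 * ((ε * a) ^ 3 - (ε * a) ^ 2 + 1) := by
    field_simp
    ring
  have h2 : 0 ≤ (ε * a) ^ 3 - (ε * a) ^ 2 + 1 := by
    have hb : 0 ≤ ε * a := by positivity
    generalize ε * a = b at hb
    nlinarith [mul_nonneg hb (sq_nonneg (b - 1)), sq_nonneg (b - 1)]
  have h3 : 0 ≤ (ε ^ 2)⁻¹ * a ^ 2 * ((ε * a) ^ 3 - (ε * a) ^ 2 + 1) := by positivity
  linarith

theorem exists_sq_l2norm_pow_le : ∃ S : ℝ, 0 ≤ S ∧ ∀ u : R3 → ℂ, MemH1 u →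
    (l2norm (fun x => ‖u x‖ ^ 2) ^ 2) ^ 2 ≤ S * (mass u * funA u ^ 3) := by
  obtain ⟨S, hS, h⟩ := exists_sq_l2norm_sq_le
  refine ⟨27 * S ^ 2, by positivity, fun u hu => ?_⟩
  have hm : l2norm u ^ 2 = mass u := sq_l2norm u
  have hg : (gradNorm u ^ 2) ^ 3 ≤ (3 * funA u) ^ 3 :=
    pow_le_pow_left₀ (sq_nonneg _) (sq_gradNorm_le u) 3
  calc (l2norm (fun x => ‖u x‖ ^ 2) ^ 2) ^ 2 ≤ (S * (l2norm u * gradNorm u ^ 3)) ^ 2 :=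
        pow_le_pow_left₀ (sq_nonneg _) (h u hu) 2
    _ = S ^ 2 * (mass u * (gradNorm u ^ 2) ^ 3) := by rw [← hm]; ring
    _ ≤ S ^ 2 * (mass u * (3 * funA u) ^ 3) := by
        refine mul_le_mul_of_nonneg_left (mul_le_mul_of_nonneg_left hg ?_) (sq_nonneg S)
        rw [← hm]; positivity
    _ = _ := by ring

/-- For solutions of small mass, the nonlocal energy is dominated by the kinetic energy. -/
theorem exists_funB_lt (l₁ l₂ l₃ : ℝ) (hl₃ : l₃ < 0) : ∃ c₀ : ℝ, 0 < c₀ ∧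
    ∀ (u : R3 → ℂ) (β : ℝ), IsSolution l₁ l₂ l₃ u β → 0 < mass u → mass u < c₀ →
      funB l₁ l₂ u < funA u / 3 := by
  obtain ⟨S, hS, hS4⟩ := exists_sq_l2norm_pow_le
  set M := boundA l₁ l₂ with hMd
  have hM : 0 ≤ M := boundA_nonneg l₁ l₂
  -- The constant for which Q = 0 reads ‖u‖₅⁵ = k (A + (3/2) B); positivity needs l₃ < 0.
  set k := 5 / (9 * -l₃) with hk
  have hk0 : 0 < k := div_pos (by norm_num) (by linarith)
  -- Small enough that the L⁵ part of the interpolated L⁴ bound is at most B/2 and can be absorbed;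
  -- the 1 in the denominator covers M = 0.
  set ε := 1 / (9 * M * k + 1) with hε
  have hε0 : 0 < ε := by positivity
  have hεM : M * ε * (9 / 2 * k) ≤ 1 / 2 := by
    have : ε * (9 * M * k + 1) = 1 := by rw [hε]; field_simp
    nlinarith
  set L := 6 * M * (ε ^ 2)⁻¹ with hL
  have hL0 : 0 ≤ L := by positivity
  set T := 9 * M ^ 2 * S * L with hT
  have hT0 : 0 ≤ T := by positivity
  -- The contradiction will read 1 ≤ T m² for the mass m. The threshold 1/(1 + T) makes both m < 1
  -- and T m < 1.
  refine ⟨1 / (1 + T), by positivity, fun u β h hm hmc => ?_⟩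
  by_contra! hB
  have hu := h.1
  have hA := funA_pos hu hm
  set D := ∫ x, ‖u x‖ ^ 5
  set N := l2norm (fun x => ‖u x‖ ^ 2) ^ 2 with hN
  have hN0 : 0 ≤ N := sq_nonneg _
  have hBN : funB l₁ l₂ u ≤ M * N := funB_le l₁ l₂ hu
  have hN5 : N ≤ ε * D + (ε ^ 2)⁻¹ * mass u := sq_l2norm_sq_le_pow_five hu hε0
  have hQ : funA u + 3 / 2 * funB l₁ l₂ u + 9 / 5 * (l₃ * D) = 0 := h.funQ_eq_zero
  have hD : D = k * (funA u + 3 / 2 * funB l₁ l₂ u) := by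
    have : funA u + 3 / 2 * funB l₁ l₂ u = 9 / 5 * (-l₃ * D) := by linarith
    rw [this, hk]
    have : l₃ ≠ 0 := hl₃.ne
    field_simp
  set B := funB l₁ l₂ u
  set A := funA u
  -- From A ≤ 3B, the negation of the claim: A + (3/2) B ≤ (9/2) B.
  have hD2 : D ≤ 9 / 2 * k * B := by
    rw [hD]
    nlinarith
  have hB0 : 0 < B := by linarith
  have hB2 : B ≤ 2 * M * (ε ^ 2)⁻¹ * mass u := by
    have h1 : M * N ≤ M * (ε * (9 / 2 * k * B) + (ε ^ 2)⁻¹ * mass u) := by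
      refine mul_le_mul_of_nonneg_left (hN5.trans ?_) hM
      gcongr
    have h2 : M * ε * (9 / 2 * k) * B ≤ 1 / 2 * B := mul_le_mul_of_nonneg_right hεM hB0.le
    nlinarith
  have hA2 : A ≤ L * mass u := by rw [hL]; linarith
  have hAN : A ≤ 3 * (M * N) := by linarith
  -- Gagliardo–Nirenberg is cubic in A on the right, so dividing by A² > 0 gives a positive lower
  -- bound for m·A, against the upper bound A ≤ L m.
  have h5 : A ^ 2 ≤ 9 * M ^ 2 * (S * (mass u * A ^ 3)) := by
    calc A ^ 2 ≤ (3 * (M * N)) ^ 2 := pow_le_pow_left₀ hA.le hAN 2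
      _ = 9 * M ^ 2 * N ^ 2 := by ring
      _ ≤ _ := mul_le_mul_of_nonneg_left (hS4 u hu) (by positivity)
  have h6 : 1 ≤ 9 * M ^ 2 * S * mass u * A := by
    refine le_of_mul_le_mul_left ?_ (pow_pos hA 2)
    calc A ^ 2 * 1 = A ^ 2 := mul_one _
      _ ≤ _ := h5
      _ = _ := by ring
  have h7 : 1 ≤ T * mass u * mass u := by
    calc 1 ≤ 9 * M ^ 2 * S * mass u * A := h6
      _ ≤ 9 * M ^ 2 * S * mass u * (L * mass u) := by gcongr
      _ = _ := by rw [hT]; ring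
  have h8 : mass u * (1 + T) < 1 := by
    rwa [lt_div_iff₀ (by positivity)] at hmc
  have h9 : mass u < 1 := by nlinarith [mul_nonneg hm.le hT0]
  nlinarith [mul_nonneg hT0 hm.le]

theorem IsSolution.beta_pos {l₁ l₂ l₃ β : ℝ} {u : R3 → ℂ} (h : IsSolution l₁ l₂ l₃ u β)
    (hm : 0 < mass u) (hB : funB l₁ l₂ u < funA u / 3) : 0 < β := by
  have h1 := h.mul_mass_eq
  exact pos_of_mul_pos_left (by rw [h1]; linarith) hm.le

end DipolarGPE

end

theorem lemma4p1 (l₁ l₂ l₃ : ℝ) (hl₃ : l₃ < 0) :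
    (∀ ξ : DipolarGPE.R3, ξ ≠ 0 →
      DifferentiableAt ℝ DipolarGPE.symbolK ξ ∧
        inner ℝ ξ (gradient DipolarGPE.symbolK ξ) = 0) ∧
    (∀ (u : DipolarGPE.R3 → ℂ) (β : ℝ), DipolarGPE.IsSolution l₁ l₂ l₃ u β →
      1 / 4 * DipolarGPE.funA u + 3 / 4 * DipolarGPE.funB l₁ l₂ u
          + 3 / 5 * DipolarGPE.funC l₃ u + 3 / 2 * β * DipolarGPE.mass u = 0 ∧
        DipolarGPE.funQ l₁ l₂ l₃ u = 0) ∧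
    ∃ c₀ : ℝ≥0∞, 0 < c₀ ∧
      (∀ c : ℝ, 0 < c → ENNReal.ofReal c < c₀ →
        ∀ (u : DipolarGPE.R3 → ℂ) (β : ℝ), DipolarGPE.IsSolution l₁ l₂ l₃ u β →
          u ∈ DipolarGPE.sphereS c → 0 < β) ∧
      ((0 < l₂ ∧ l₁ + 8 * Real.pi / 3 * l₂ ≤ 0) ∨ (l₂ ≤ 0 ∧ l₁ - 4 * Real.pi / 3 * l₂ ≤ 0) →
        c₀ = ⊤) := by
  refine ⟨fun ξ hξ => ⟨DipolarGPE.differentiableAt_symbolK ξ hξ,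
    DipolarGPE.inner_gradient_symbolK ξ hξ⟩, fun u β h => ⟨h.pohozaev_funB, h.funQ_eq_zero⟩, ?_⟩
  -- The existential must produce ⊤ whenever the sign condition holds, so the condition decides the
  -- witness before anything else.
  by_cases hsign : (0 < l₂ ∧ l₁ + 8 * Real.pi / 3 * l₂ ≤ 0) ∨
    (l₂ ≤ 0 ∧ l₁ - 4 * Real.pi / 3 * l₂ ≤ 0)
  · refine ⟨⊤, by simp, fun c hc _ u β h hu => ?_, fun _ => rfl⟩
    have hm : 0 < DipolarGPE.mass u := hu.2.symm ▸ hc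
    refine h.beta_pos hm ?_
    have h1 := DipolarGPE.funB_nonpos (DipolarGPE.symbolA_nonpos hsign) hu.1
    have h2 := DipolarGPE.funA_pos hu.1 hm
    linarith
  · obtain ⟨c₀, hc₀, hlt⟩ := DipolarGPE.exists_funB_lt l₁ l₂ l₃ hl₃
    refine ⟨ENNReal.ofReal c₀, ENNReal.ofReal_pos.mpr hc₀, fun c hc hcc u β h hu => ?_,
      fun hs => absurd hs hsign⟩
    have hm : 0 < DipolarGPE.mass u := hu.2.symm ▸ hc
    refine h.beta_pos hm (hlt u β h hm ?_)
    rw [hu.2]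
    exact (ENNReal.ofReal_lt_ofReal_iff hc₀).mp hcc
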